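/- Let $\varphi:\mathbb{R}\to[-\infty,\infty)$ be concave and upper semicontinuous such that $f=e^{\varphi}$ (with $e^{-\infty}=0$) is a probability density, let $F$ be the distribution function of $f$, and write $\{x\in\mathbb{R}: 0<F(x)<1\}=(a_o,b_o)$ with $-\infty\le a_o<b_o\le\infty$. Let $X_1,X_2,\dots$ be independent random variables with density $f$. For $n\ge 2$ let $\hat\varphi_n$ be the log-concave maximum likelihood estimator of $\varphi$ based on $X_1,\dots,X_n$, i.e. the (almost surely unique) maximizer of $\sum_{i=1}^n\psi(X_i)$ over all concave functions $\psi:\mathbb{R}\to[-\infty,\infty)$ with $\int e^{\psi(x)}\,dx=1$, and let $\hat f_n=e^{\hat\varphi_n}$. Let $\hat\varphi_n'(x+)$ denote the right-sided derivative of $\hat\varphi_n$ at $x$, with $\hat\varphi_n'(x+):=-\infty$ for $x\ge\max(X_1,\dots,X_n)$, let $\varphi'(b_o-)\in[-\infty,\infty)$ be the left-sided derivative of $\varphi$ at $b_o$, and put $\rho_n=\log(n)/n$. All limits are for $n\to\infty$, and $\to_{p}$ denotes convergence in probability (also towards $-\infty$). Suppose that $b_o<\infty$. (a) Let $f(b_o)=0$.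 Then for any fixed $a\in(a_o,b_o)$, $$\sup_{x\ge a}\bigl|\hat f_n(x)-f(x)\bigr|\to_{p}0 .$$ Moreover, $\varphi'(b_o-)=-\infty$, and for any sequence $(b_n)_n$ in $(a_o,b_o)$ with limit $b_o$, $\hat\varphi_n'(b_n+)\to_{p}\varphi'(b_o-)=-\infty$. (b) Let $f(b_o)>0$. Then for any fixed $a\in(a_o,b_o)$ and any sequence $(b_n)_n$ in $(a_o,b_o)$ with limit $b_o$ such that $n(1-F(b_n))\to\infty$, $$\sup_{x\in[a,b_n]}\bigl|\hat\varphi_n(x)-\varphi(x)\bigr|\to_{p}0 .$$ (c) Let $f(b_o)>0$ and $\varphi'(b_o-)>-\infty$. Then for any sequence $(b_n)_n$ in $(a_o,b_o)$ with limit $b_o$ such that $\rho_n^{-1/3}(1-F(b_n))\to\infty$, $$\hat\varphi_n'(b_n+)\to_{p}\varphi'(b_o-) .$$ -/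

import Mathlib

open MeasureTheory ProbabilityTheory Filter Topology
open scoped ENNReal

/-- `ψ : ℝ → [-∞, ∞)` is concave. (Since the value `+∞` is excluded, the convex combination of
values never has the form `∞ - ∞`.) -/
def IsConcaveFn (ψ : ℝ → EReal) : Prop :=
  (∀ x, ψ x < ⊤) ∧
    ∀ x y s t : ℝ, 0 ≤ s → 0 ≤ t → s + t = 1 →
      (s : EReal) * ψ x + (t : EReal) * ψ y ≤ ψ (s * x + t * y)

/-- The function `exp ∘ ψ`, with `exp (-∞) = 0`. -/
noncomputable def expFn (ψ : ℝ → EReal) (x : ℝ) : ℝ≥0∞ := EReal.exp (ψ x)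

/-- `ψ` is concave with values in `[-∞, ∞)`, and `exp ∘ ψ` is a probability density. -/
def IsLogDensity (ψ : ℝ → EReal) : Prop :=
  IsConcaveFn ψ ∧ ∫⁻ x, expFn ψ x = 1

/-- The probability distribution with density `exp ∘ ψ`. -/
noncomputable def distOf (ψ : ℝ → EReal) : Measure ℝ :=
  volume.withDensity (expFn ψ)

/-- `ψ` is a log-concave maximum likelihood estimator for the observations `x`: it maximizes
the log-likelihood `∑ i, ψ (x i)` over all concave log-densities. -/
def IsLogConcaveMLE {n : ℕ} (x : Fin n → ℝ) (ψ : ℝ → EReal) : Prop :=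
  IsLogDensity ψ ∧ ∀ χ : ℝ → EReal, IsLogDensity χ → ∑ i, χ (x i) ≤ ∑ i, ψ (x i)

open Classical in
/-- The log-concave maximum likelihood estimator of the log-density. It exists and is unique
when the observations are not all equal; otherwise the value is irrelevant. -/
noncomputable def logConcaveMLE {n : ℕ} (x : Fin n → ℝ) : ℝ → EReal :=
  if h : ∃ ψ, IsLogConcaveMLE x ψ then h.choose else fun _ => ⊥

/-- The right-sided derivative `ψ'(x+)` in `[-∞, ∞]`. For concave `ψ` and `ψ x > -∞` the
difference quotients converge, so that the upper limit is their limit. -/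
noncomputable def rightDeriv (ψ : ℝ → EReal) (x : ℝ) : EReal :=
  limsup (fun y : ℝ => (ψ y - ψ x) / ((y - x : ℝ) : EReal)) (𝓝[>] x)

/-- The left-sided derivative `ψ'(x-)` in `[-∞, ∞]`. If `ψ` is concave and upper semicontinuous
and `ψ > -∞` on some interval with right endpoint `x`, then the difference quotients
converge, so that the upper limit is their limit; it is `-∞` if `ψ x = -∞`. -/
noncomputable def leftDeriv (ψ : ℝ → EReal) (x : ℝ) : EReal :=
  limsup (fun y : ℝ => (ψ x - ψ y) / ((x - y : ℝ) : EReal)) (𝓝[<] x)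

open Classical in
/-- The right-sided derivative at `t` of the log-concave maximum likelihood estimator, equal to
`-∞` by convention if `t` is at least the largest observation. -/
noncomputable def mleRightDeriv {n : ℕ} (x : Fin n → ℝ) (t : ℝ) : EReal :=
  if ∀ i, x i ≤ t then ⊥ else rightDeriv (logConcaveMLE x) t

/-- The supremum over `s` of `|g - h|`, with values in `[0, ∞]`. -/
noncomputable def supDist (s : Set ℝ) (g h : ℝ → EReal) : ℝ≥0∞ :=
  ⨆ x ∈ s, (g x - h x).abs

/-- Convergence in probability of `Z n` to the constant `c`: the (outer) probability that `Z n`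
lies outside any given neighbourhood of `c` tends to zero. -/
def TendstoInProb {Ω E : Type*} [MeasurableSpace Ω] [TopologicalSpace E] (μ : Measure Ω)
    (Z : ℕ → Ω → E) (c : E) : Prop :=
  ∀ U ∈ 𝓝 c, Tendsto (fun n => μ {ω | Z n ω ∉ U}) atTop (𝓝 0)

/-! On the range of the data the estimator `g` obeys a first-order condition: whenever `g + tΔ` is
concave for some `t > 0`, the empirical mean of `Δ` is at most `∫ Δ e^g`
(`empMean_le_of_perturbation`). The choice `Δ = -(z - s)⁺` is always admissible and `Δ = (z - τ)⁺`
is admissible at a knot `τ`. So the fitted mean excess never exceeds the empirical one, and the two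
agree at knots. Moreover `g` is affine between observations, so from any point one can go left to
the last knot (`exists_knot`).

Inside the support, consistency is a Kullback–Leibler argument. Likelihood considerations bound the
estimator above (`exists_upper_bound`) and below (`lower_bound`), and concavity turns bounds into
Lipschitz constants. With `u = g - φ`, a deviation at a single point keeps `∫ (e^u - 1 - u) dP` away
from zero, while the likelihood inequality and a uniform law of large numbers make this integral
small (`exists_uniform`).

(a) If the density vanishes at `bₒ`, semicontinuity makes `φ` arbitrarily low just left of `bₒ`. A
chord of the estimator between two interior points is then steeply decreasing, and concavity
propagates this to everything further right.

(b) If the density is positive at `bₒ`, extrapolating interior chords bounds the estimator from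
above up to the end of its range. For the lower bound let `τ` be the last knot before `b_n`. A value
below `φ(bₒ) - ε` at `b_n` would make the fitted excess over `τ`, hence the empirical one, too small
by a constant factor (`empMean_max_sub_le_of_lt`). This contradicts a relative lower bound for the
empirical excess, uniform in `τ` (`eventually_empMean_max_sub_ge`), which holds because `n (bₒ -
b_n) → ∞`. If there is no knot on the relevant stretch, the estimator is affine there and interior
consistency suffices.

(c) Upper bounds for the derivative again come from interior chords. If the slope at `b_n` were at
most `φ'(bₒ-) - ε`, then `u` would decrease at rate at least `ε` from the last knot `τ` on. Put `H =
bₒ - τ`. Comparing first moments about the conditional mean beyond `τ` forces a discrepancy of order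
`ε H³`, whereas the stochastic error is of order `H √(H ρ_n)` (`mul_sq_le_of_isKnot`,
`eventually_empMean_near_right_end`). Hence `H³` is at most a constant times `ρ_n`, which the
assumption on `b_n` excludes. -/

/-! ### Concave functions with values in `[-∞, ∞)` and their real restrictions -/

section
open Set

lemma IsConcaveFn.coe_toReal {ψ : ℝ → EReal} (h : IsConcaveFn ψ) {x : ℝ} (hx : ψ x ≠ ⊥) :
    ((ψ x).toReal : EReal) = ψ x :=
  EReal.coe_toReal (h.1 x).ne hx

lemma IsConcaveFn.ne_bot_of_mem_Icc {ψ : ℝ → EReal} (h : IsConcaveFn ψ) {u v x : ℝ}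
    (hu : ψ u ≠ ⊥) (hv : ψ v ≠ ⊥) (hx : x ∈ Icc u v) : ψ x ≠ ⊥ := by
  have hx' : x ∈ segment ℝ u v := by
    rw [segment_eq_Icc (hx.1.trans hx.2)]; exact hx
  obtain ⟨s, t, hs, ht, hst, rfl⟩ := hx'
  have := h.2 u v s t hs ht hst
  rw [← h.coe_toReal hu, ← h.coe_toReal hv] at this
  intro hbot
  simp only [smul_eq_mul] at hbot
  rw [hbot, ← EReal.coe_mul, ← EReal.coe_mul, ← EReal.coe_add] at this
  exact EReal.coe_ne_bot _ (le_bot_iff.1 this)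

lemma IsConcaveFn.concaveOn_toReal {ψ : ℝ → EReal} (h : IsConcaveFn ψ) {S : Set ℝ}
    (hS : Convex ℝ S) (hb : ∀ x ∈ S, ψ x ≠ ⊥) : ConcaveOn ℝ S fun x => (ψ x).toReal := by
  refine ⟨hS, fun x hx y hy s t hs ht hst => ?_⟩
  have := h.2 x y s t hs ht hst
  rw [← h.coe_toReal (hb x hx), ← h.coe_toReal (hb y hy),
    ← h.coe_toReal (hb (s * x + t * y) (hS hx hy hs ht hst))] at this
  exact_mod_cast this

lemma ConcaveOn.le_extrapolation {S : Set ℝ} {g : ℝ → ℝ} (h : ConcaveOn ℝ S g) {c d x : ℝ}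
    (hc : c ∈ S) (hx : x ∈ S) (hcd : c < d) (hdx : d ≤ x) :
    g x ≤ g d + (x - d) * ((g d - g c) / (d - c)) := by
  rcases hdx.eq_or_lt with rfl | hdx
  · simp
  have := h.slope_anti_adjacent hc hx hcd hdx
  rw [div_le_iff₀ (by linarith)] at this
  linarith

lemma IsConcaveFn.le_extrapolation {ψ : ℝ → EReal} (h : IsConcaveFn ψ) {c d x gc gd : ℝ}
    (hc : ψ c = gc) (hd : ψ d = gd) (hcd : c < d) (hdx : d ≤ x) :
    ψ x ≤ ((gd + (x - d) * ((gd - gc) / (d - c)) : ℝ) : EReal) := by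
  by_cases hx : ψ x = ⊥
  · rw [hx]; exact bot_le
  have hc' : ψ c ≠ ⊥ := by rw [hc]; exact EReal.coe_ne_bot _
  have := (h.concaveOn_toReal (convex_Icc c x)
    fun y hy => h.ne_bot_of_mem_Icc hc' hx hy).le_extrapolation
    (left_mem_Icc.2 (hcd.le.trans hdx)) (right_mem_Icc.2 (hcd.le.trans hdx)) hcd hdx
  rw [← h.coe_toReal hx]
  simp only [hc, hd, EReal.toReal_coe] at this
  exact_mod_cast this

lemma ConcaveOn.min_le_of_mem_Icc' {a b x : ℝ} {g : ℝ → ℝ} (h : ConcaveOn ℝ (Icc a b) g)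
    (hx : x ∈ Icc a b) : min (g a) (g b) ≤ g x :=
  h.min_le_of_mem_Icc (left_mem_Icc.2 (hx.1.trans hx.2)) (right_mem_Icc.2 (hx.1.trans hx.2)) hx

/-- Reflect `x` in the midpoint: the value at the midpoint dominates the average of the values at
`x` and at its reflection, and the latter is at least the smaller endpoint value. -/
lemma ConcaveOn.le_two_mul_sub {a b x : ℝ} {g : ℝ → ℝ} (h : ConcaveOn ℝ (Icc a b) g)
    (hx : x ∈ Icc a b) : g x ≤ 2 * g ((a + b) / 2) - min (g a) (g b) := by
  have hx' : a + b - x ∈ Icc a b := ⟨by linarith [hx.2], by linarith [hx.1]⟩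
  have h1 := h.min_le_of_mem_Icc' hx'
  have h2 := h.2 hx hx' (by norm_num : (0 : ℝ) ≤ 1 / 2) (by norm_num : (0 : ℝ) ≤ 1 / 2)
    (by norm_num)
  simp only [smul_eq_mul] at h2
  have h3 : 1 / 2 * x + 1 / 2 * (a + b - x) = (a + b) / 2 := by ring
  rw [h3] at h2
  linarith

/-- Continuity is only available in the interior, but the two endpoints form a null set. -/
lemma ConcaveOn.aestronglyMeasurable_Icc {a b : ℝ} {g : ℝ → ℝ} (h : ConcaveOn ℝ (Icc a b) g) :
    AEStronglyMeasurable g (volume.restrict (Icc a b)) := by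
  rw [← Measure.restrict_congr_set Ioo_ae_eq_Icc]
  have := h.continuousOn_interior
  rw [interior_Icc] at this
  exact this.aestronglyMeasurable measurableSet_Ioo

lemma ConcaveOn.exists_abs_le {a b : ℝ} {g : ℝ → ℝ} (h : ConcaveOn ℝ (Icc a b) g) :
    ∃ C, ∀ x ∈ Icc a b, |g x| ≤ C := by
  refine ⟨max (2 * g ((a + b) / 2) - min (g a) (g b)) (-min (g a) (g b)), fun x hx => ?_⟩
  exact abs_le'.2 ⟨(h.le_two_mul_sub hx).trans (le_max_left _ _),
    (neg_le_neg (h.min_le_of_mem_Icc' hx)).trans (le_max_right _ _)⟩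

lemma ConcaveOn.aestronglyMeasurable_exp_Icc {a b : ℝ} {g : ℝ → ℝ}
    (h : ConcaveOn ℝ (Icc a b) g) :
    AEStronglyMeasurable (fun t => Real.exp (g t)) (volume.restrict (Icc a b)) :=
  Real.continuous_exp.comp_aestronglyMeasurable h.aestronglyMeasurable_Icc

lemma ConcaveOn.integrableOn_exp {a b : ℝ} {g : ℝ → ℝ} (h : ConcaveOn ℝ (Icc a b) g) :
    IntegrableOn (fun t => Real.exp (g t)) (Icc a b) := by
  obtain ⟨C, hC⟩ := h.exists_abs_le
  refine IntegrableOn.of_bound (C := Real.exp C) (by simp) h.aestronglyMeasurable_exp_Icc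
    ((ae_restrict_iff' measurableSet_Icc).2 (ae_of_all _ fun x hx => ?_))
  rw [Real.norm_eq_abs, Real.abs_exp]
  exact Real.exp_le_exp.2 ((le_abs_self _).trans (hC x hx))

lemma ConcaveOn.setIntegral_exp_pos {a b : ℝ} (hab : a < b) {g : ℝ → ℝ}
    (h : ConcaveOn ℝ (Icc a b) g) : 0 < ∫ t in Icc a b, Real.exp (g t) := by
  rw [setIntegral_pos_iff_support_of_nonneg_ae (ae_of_all _ fun x => (Real.exp_pos _).le)
    h.integrableOn_exp]
  have : (Function.support fun t => Real.exp (g t)) = univ := by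
    ext; simp [Real.exp_ne_zero]
  rw [this, univ_inter]; simpa using hab

open Classical in
/-- The extension of `g` by `-∞` outside of `[a, b]`. -/
noncomputable def extendBot (a b : ℝ) (g : ℝ → ℝ) (x : ℝ) : EReal :=
  if x ∈ Icc a b then (g x : EReal) else ⊥

lemma extendBot_of_mem {a b x : ℝ} {g : ℝ → ℝ} (hx : x ∈ Icc a b) :
    extendBot a b g x = g x := by rw [extendBot, if_pos hx]

lemma extendBot_of_notMem {a b x : ℝ} {g : ℝ → ℝ} (hx : x ∉ Icc a b) :
    extendBot a b g x = ⊥ := by rw [extendBot, if_neg hx]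

lemma ConcaveOn.isConcaveFn_extendBot {a b : ℝ} {g : ℝ → ℝ} (h : ConcaveOn ℝ (Icc a b) g) :
    IsConcaveFn (extendBot a b g) := by
  have key : ∀ x y s t : ℝ, 0 < s → x ∉ Icc a b →
      (s : EReal) * extendBot a b g x + (t : EReal) * extendBot a b g y ≤
        extendBot a b g (s * x + t * y) := by
    intro x y s t hs hx
    rw [extendBot_of_notMem hx, EReal.coe_mul_bot_of_pos hs, EReal.bot_add]
    exact bot_le
  refine ⟨fun x => ?_, fun x y s t hs ht hst => ?_⟩
  · by_cases hx : x ∈ Icc a b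
    · rw [extendBot_of_mem hx]; exact EReal.coe_lt_top _
    · rw [extendBot_of_notMem hx]; exact bot_lt_top
  rcases hs.eq_or_lt with rfl | hs
  · simp only [zero_add] at hst; subst hst; simp
  rcases ht.eq_or_lt with rfl | ht
  · simp only [add_zero] at hst; subst hst; simp
  by_cases hx : x ∈ Icc a b
  swap
  · exact key x y s t hs hx
  by_cases hy : y ∈ Icc a b
  swap
  · rw [add_comm, add_comm (s * x)]; exact key y x t s ht hy
  have := h.2 hx hy hs.le ht.le hst
  have hm := h.1 hx hy hs.le ht.le hst
  simp only [smul_eq_mul] at this hm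
  rw [extendBot_of_mem hx, extendBot_of_mem hy, extendBot_of_mem hm]
  exact_mod_cast this

lemma ConcaveOn.lintegral_expFn_extendBot {a b : ℝ} {g : ℝ → ℝ} (h : ConcaveOn ℝ (Icc a b) g) :
    ∫⁻ x, expFn (extendBot a b g) x = ENNReal.ofReal (∫ t in Icc a b, Real.exp (g t)) := by
  rw [ofReal_integral_eq_lintegral_ofReal h.integrableOn_exp
    (ae_of_all _ fun x => (Real.exp_pos _).le), ← lintegral_indicator measurableSet_Icc]
  congr 1
  ext x
  by_cases hx : x ∈ Icc a b
  · simp [expFn, extendBot_of_mem hx, indicator_of_mem hx]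
  · simp [expFn, extendBot_of_notMem hx, indicator_of_notMem hx]

lemma IsLogDensity.setIntegral_exp_le {ψ : ℝ → EReal} (h : IsLogDensity ψ) {a b : ℝ}
    (hb : ∀ x ∈ Icc a b, ψ x ≠ ⊥) : ∫ t in Icc a b, Real.exp ((ψ t).toReal) ≤ 1 := by
  have hc := h.1.concaveOn_toReal (convex_Icc a b) hb
  rw [← ENNReal.ofReal_le_one, ← hc.lintegral_expFn_extendBot, ← h.2]
  refine lintegral_mono fun x => ?_
  by_cases hx : x ∈ Icc a b
  · simp only [expFn, extendBot_of_mem hx, h.1.coe_toReal (hb x hx), le_refl]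
  · simp [expFn, extendBot_of_notMem hx]

/-- Turns an arbitrary real concave function on an interval into an admissible competitor for the
estimator. -/
lemma ConcaveOn.isLogDensity_extendBot {a b : ℝ} (hab : a < b) {g : ℝ → ℝ}
    (h : ConcaveOn ℝ (Icc a b) g) :
    IsLogDensity (extendBot a b fun t => g t - Real.log (∫ s in Icc a b, Real.exp (g s))) := by
  have h' : ConcaveOn ℝ (Icc a b) fun t => g t - Real.log (∫ s in Icc a b, Real.exp (g s)) := by
    simp only [sub_eq_add_neg]
    exact h.add_const (-Real.log (∫ s in Icc a b, Real.exp (g s)))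
  refine ⟨h'.isConcaveFn_extendBot, ?_⟩
  have hpos := h.setIntegral_exp_pos hab
  rw [h'.lintegral_expFn_extendBot]
  simp only [Real.exp_sub, Real.exp_log hpos, integral_div, div_self hpos.ne',
    ENNReal.ofReal_one]

lemma EReal.sum_coe {ι : Type*} (s : Finset ι) (f : ι → ℝ) :
    ∑ i ∈ s, (f i : EReal) = ((∑ i ∈ s, f i : ℝ) : EReal) := by
  classical
  induction s using Finset.induction_on with
  | empty => simp
  | insert i s hi ih => rw [Finset.sum_insert hi, Finset.sum_insert hi, ih, EReal.coe_add]

lemma EReal.sum_eq_bot {ι : Type*} {s : Finset ι} {f : ι → EReal} {i : ι} (hi : i ∈ s)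
    (h : f i = ⊥) : ∑ i ∈ s, f i = ⊥ := by
  classical
  rw [← Finset.add_sum_erase s f hi, h, EReal.bot_add]

end

/-! ### Existence of the estimator and its real-valued description -/

section
open Set

/-- The mean of `h` under the empirical distribution of the observations `x`. -/
noncomputable def empMean {n : ℕ} (x : Fin n → ℝ) (h : ℝ → ℝ) : ℝ := (∑ i, h (x i)) / n

lemma empMean_mono {n : ℕ} {x : Fin n → ℝ} {g h : ℝ → ℝ} (H : ∀ i, g (x i) ≤ h (x i)) :
    empMean x g ≤ empMean x h :=
  div_le_div_of_nonneg_right (Finset.sum_le_sum fun i _ => H i) n.cast_nonneg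

lemma empMean_congr {n : ℕ} {x : Fin n → ℝ} {g h : ℝ → ℝ} (H : ∀ i, g (x i) = h (x i)) :
    empMean x g = empMean x h := by
  simp only [empMean, H]

lemma empMean_add {n : ℕ} (x : Fin n → ℝ) (g h : ℝ → ℝ) :
    empMean x (fun t => g t + h t) = empMean x g + empMean x h := by
  simp only [empMean, Finset.sum_add_distrib, add_div]

lemma empMean_sub {n : ℕ} (x : Fin n → ℝ) (g h : ℝ → ℝ) :
    empMean x (fun t => g t - h t) = empMean x g - empMean x h := by
  simp only [empMean, Finset.sum_sub_distrib, sub_div]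

lemma empMean_const_mul {n : ℕ} (x : Fin n → ℝ) (c : ℝ) (h : ℝ → ℝ) :
    empMean x (fun t => c * h t) = c * empMean x h := by
  simp only [empMean, ← Finset.mul_sum, mul_div_assoc]

lemma empMean_const {n : ℕ} (hn : n ≠ 0) (x : Fin n → ℝ) (c : ℝ) :
    empMean x (fun _ => c) = c := by
  have : (n : ℝ) ≠ 0 := by exact_mod_cast hn
  simp only [empMean, Finset.sum_const, Finset.card_univ, Fintype.card_fin, nsmul_eq_mul]
  field_simp

/-- A concave function stays above `c` between two points where it is above `c`. Combined with total
mass at most one, this bounds the width of high level sets. -/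
lemma ConcaveOn.mul_exp_le_setIntegral {a b u v c : ℝ} {g : ℝ → ℝ} (h : ConcaveOn ℝ (Icc a b) g)
    (hu : u ∈ Icc a b) (hv : v ∈ Icc a b) (huc : c ≤ g u) (hvc : c ≤ g v) :
    |v - u| * Real.exp c ≤ ∫ t in Icc a b, Real.exp (g t) := by
  wlog huv : u ≤ v generalizing u v
  · rw [abs_sub_comm]; exact this hv hu hvc huc (le_of_not_ge huv)
  rw [abs_of_nonneg (sub_nonneg.2 huv)]
  have hsub : Icc u v ⊆ Icc a b := Icc_subset_Icc hu.1 hv.2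
  calc (v - u) * Real.exp c = ∫ _ in Icc u v, Real.exp c := by
        simp [huv]
    _ ≤ ∫ t in Icc u v, Real.exp (g t) := by
        refine setIntegral_mono_on (by simp) (h.integrableOn_exp.mono_set hsub)
          measurableSet_Icc fun t ht => Real.exp_le_exp.2 ?_
        exact (le_min huc hvc).trans (h.min_le_of_mem_Icc hu hv ht)
    _ ≤ ∫ t in Icc a b, Real.exp (g t) :=
        setIntegral_mono_set h.integrableOn_exp (ae_of_all _ fun _ => (Real.exp_pos _).le)
          hsub.eventuallyLE

/-- A concave log-subdensity with likelihood bounded from below is bounded from above, if the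
observations are not concentrated on a short interval. -/
lemma exists_upper_bound (θ δ L : ℝ) (hθ : 0 < θ) (hδ : 0 < δ) :
    ∃ M : ℝ, 0 ≤ M ∧ ∀ (n : ℕ) (x : Fin n → ℝ) (a b : ℝ) (g : ℝ → ℝ) (p q : ℝ),
      ConcaveOn ℝ (Icc a b) g → (∫ t in Icc a b, Real.exp (g t)) ≤ 1 →
      (∀ i, x i ∈ Icc a b) → p + δ ≤ q →
      θ ≤ empMean x ((Iic p).indicator 1) → θ ≤ empMean x ((Ici q).indicator 1) →
      L ≤ empMean x g → ∀ t ∈ Icc a b, g t ≤ M := by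
  -- If a fraction `θ` of the data has values below `-K m` and the rest at most `m`, the mean is at
  -- most `m - (1 + K) m θ < -m`. This is below `L` once `m > -L`, which is why `K θ = 2` suffices.
  set K : ℝ := 2 / θ with hK
  have hKpos : 0 < K := by positivity
  have hlim : Tendsto (fun m : ℝ => (1 + K) * Real.exp 1 * (m ^ 1 * Real.exp (-m))) atTop
      (𝓝 ((1 + K) * Real.exp 1 * 0)) :=
    (Real.tendsto_pow_mul_exp_neg_atTop_nhds_zero 1).const_mul _
  rw [mul_zero] at hlim
  obtain ⟨M, hM⟩ := eventually_atTop.1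
    ((hlim.eventually (gt_mem_nhds (half_pos hδ))).and
      ((eventually_ge_atTop 1).and (eventually_gt_atTop (-L))))
  refine ⟨M, by linarith [(hM M le_rfl).2.1], ?_⟩
  intro n x a b g p q hg hint hx hpq hp hq hL t ht
  by_contra! hlt
  have hn : n ≠ 0 := by
    rintro rfl
    simp [empMean] at hp
    linarith
  obtain ⟨t₀, ht₀, hgt, hdata⟩ : ∃ t₀ ∈ Icc a b, M < g t₀ ∧ ∀ i, g (x i) ≤ g t₀ := by
    have : Nonempty (Fin n) := ⟨⟨0, Nat.pos_of_ne_zero hn⟩⟩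
    obtain ⟨j, hj⟩ := Finite.exists_max fun i => g (x i)
    rcases le_total (g (x j)) (g t) with h | h
    · exact ⟨t, ht, hlt, fun i => (hj i).trans h⟩
    · exact ⟨x j, hx j, hlt.trans_le h, hj⟩
  set m := g t₀ with hm
  obtain ⟨h1, h2, h3⟩ := hM m hgt.le
  have hmpos : 0 < m := by linarith
  -- Going the fraction `l = 1 / ((1 + K) m)` of the way from `t₀` to `y` lowers `g` by at most one.
  -- Mass at most one then gives `l |y - t₀| e^(m - 1) ≤ 1`, and the choice of `M` makes the
  -- resulting distance less than `δ / 2`.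
  have near : ∀ y ∈ Icc a b, -K * m ≤ g y → |y - t₀| < δ / 2 := by
    intro y hy hgy
    set l : ℝ := 1 / ((1 + K) * m) with hl
    have hden : 1 ≤ (1 + K) * m := by nlinarith
    have hl0 : 0 < l := by positivity
    have hl1 : l ≤ 1 := by rw [hl, div_le_one (by positivity)]; exact hden
    have hlm : l * ((1 + K) * m) = 1 := by rw [hl]; field_simp
    have hmem := hg.1 ht₀ hy (sub_nonneg.2 hl1) hl0.le (by ring)
    have hval := hg.2 ht₀ hy (sub_nonneg.2 hl1) hl0.le (by ring)
    simp only [smul_eq_mul] at hmem hval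
    have hz : m - 1 ≤ g ((1 - l) * t₀ + l * y) := by
      have : l * (-K * m) ≤ l * g y := mul_le_mul_of_nonneg_left hgy hl0.le
      rw [← hm] at hval
      nlinarith
    have hlen := (hg.mul_exp_le_setIntegral ht₀ hmem (by linarith) hz).trans hint
    have e1 : (1 - l) * t₀ + l * y - t₀ = l * (y - t₀) := by ring
    rw [e1, abs_mul, abs_of_pos hl0] at hlen
    have e2 : Real.exp (m - 1) * (Real.exp 1 * Real.exp (-m)) = 1 := by
      rw [← Real.exp_add, ← Real.exp_add, Real.exp_eq_one_iff]; ring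
    have e3 : |y - t₀| ≤ (1 + K) * Real.exp 1 * (m ^ 1 * Real.exp (-m)) := by
      have hc : 0 ≤ (1 + K) * m * (Real.exp 1 * Real.exp (-m)) := by positivity
      calc |y - t₀| = (l * |y - t₀| * Real.exp (m - 1)) *
            ((1 + K) * m * (Real.exp 1 * Real.exp (-m))) := by
            linear_combination (-|y - t₀|) * e2 - |y - t₀| * Real.exp (m - 1) *
              (Real.exp 1 * Real.exp (-m)) * hlm
        _ ≤ 1 * ((1 + K) * m * (Real.exp 1 * Real.exp (-m))) :=
            mul_le_mul_of_nonneg_right hlen hc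
        _ = _ := by ring
    exact e3.trans_lt h1
  have final : ∀ s : Set ℝ, θ ≤ empMean x (s.indicator 1) →
      (∀ i, x i ∈ s → g (x i) < -K * m) → False := by
    intro s hs hlow
    have : empMean x g ≤ empMean x fun t => m - (1 + K) * m * s.indicator 1 t := by
      refine empMean_mono fun i => ?_
      by_cases hi : x i ∈ s
      · have := hlow i hi
        simp only [indicator_of_mem hi, Pi.one_apply]
        linarith
      · simpa [indicator_of_notMem hi] using hdata i
    rw [empMean_sub, empMean_const hn, empMean_const_mul] at this
    have h4 : (1 + K) * m * θ ≤ (1 + K) * m * empMean x (s.indicator 1) :=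
      mul_le_mul_of_nonneg_left hs (by positivity)
    have h5 : K * θ = 2 := by rw [hK]; field_simp
    nlinarith
  -- Points left of `p` and right of `q` are at least `δ` apart, so they cannot both be near `t₀`.
  -- On one of the two sides all observations have low values.
  by_cases hcase : ∃ i, x i ∈ Iic p ∧ -K * m ≤ g (x i)
  · obtain ⟨i, hip, hi⟩ := hcase
    refine final (Ici q) hq fun j hj => ?_
    by_contra! hlow
    have h6 := abs_lt.1 (near _ (hx i) hi)
    have h7 := abs_lt.1 (near _ (hx j) hlow)
    simp only [mem_Iic, mem_Ici] at hip hj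
    linarith [h6.1, h7.2]
  · push Not at hcase
    exact final (Iic p) hp hcase

/-- The vectors of values at the observations which are dominated by some concave
log-subdensity. -/
def subdensityValues {n : ℕ} (x : Fin n → ℝ) (a b : ℝ) : Set (Fin n → ℝ) :=
  {y | ∃ g : ℝ → ℝ, ConcaveOn ℝ (Icc a b) g ∧ (∀ i, y i ≤ g (x i)) ∧
    (∫ t in Icc a b, Real.exp (g t)) ≤ 1}

/-- Add to the `k`-th dominating function the distance of the `k`-th vector from the limit, so that
it dominates the limit vector. The infimum over `k` is concave, still dominates, and has integral at
most `e^dist → 1`. It is finite because `a` and `b` are observations, which gives a common lower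
bound on `[a, b]`. -/
lemma isClosed_subdensityValues {n : ℕ} {x : Fin n → ℝ} {a b : ℝ}
    (ha : ∃ i, x i = a) (hb : ∃ i, x i = b) : IsClosed (subdensityValues x a b) := by
  obtain ⟨ia, hia⟩ := ha
  obtain ⟨ib, hib⟩ := hb
  refine IsSeqClosed.isClosed fun Y y hY hlim => ?_
  choose G hG hle hint using hY
  have hdist : ∀ k i, y i ≤ Y k i + dist (Y k) y := fun k i => by
    have := (abs_le.1 ((Real.dist_eq _ _).symm.le.trans (dist_le_pi_dist (Y k) y i))).1
    linarith
  have hbd : ∀ t ∈ Icc a b, ∀ k, min (y ia) (y ib) ≤ G k t + dist (Y k) y := by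
    intro t ht k
    have h1 := (hG k).min_le_of_mem_Icc' ht
    have h2 := hle k ia
    have h3 := hle k ib
    rw [hia] at h2
    rw [hib] at h3
    rw [min_le_iff] at h1
    rcases h1 with h1 | h1
    · exact (min_le_left _ _).trans (by linarith [hdist k ia])
    · exact (min_le_right _ _).trans (by linarith [hdist k ib])
  have hbdd : ∀ t ∈ Icc a b, BddBelow (range fun k => G k t + dist (Y k) y) := by
    rintro t ht
    refine ⟨min (y ia) (y ib), ?_⟩
    rintro _ ⟨k, rfl⟩
    exact hbd t ht k
  have hconc : ConcaveOn ℝ (Icc a b) fun t => ⨅ k, (G k t + dist (Y k) y) := by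
    refine ⟨convex_Icc a b, fun u hu v hv s t hs ht hst => le_ciInf fun k => ?_⟩
    have h1 := (hG k).2 hu hv hs ht hst
    have h2 := mul_le_mul_of_nonneg_left (ciInf_le (hbdd u hu) k) hs
    have h3 := mul_le_mul_of_nonneg_left (ciInf_le (hbdd v hv) k) ht
    have h4 : s * dist (Y k) y + t * dist (Y k) y = dist (Y k) y := by rw [← add_mul, hst, one_mul]
    simp only [smul_eq_mul] at h1 ⊢
    linarith
  refine ⟨_, hconc, fun i => le_ciInf fun k => ?_, ?_⟩
  · linarith [hle k i, hdist k i]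
  have hlim' : Tendsto (fun k => Real.exp (dist (Y k) y)) atTop (𝓝 1) := by
    rw [← Real.exp_zero]
    exact (Real.continuous_exp.tendsto 0).comp (tendsto_iff_dist_tendsto_zero.1 hlim)
  refine ge_of_tendsto' hlim' fun k => ?_
  calc (∫ t in Icc a b, Real.exp (⨅ k, (G k t + dist (Y k) y)))
      ≤ ∫ t in Icc a b, Real.exp (dist (Y k) y) * Real.exp (G k t) := by
        refine setIntegral_mono_on hconc.integrableOn_exp ((hG k).integrableOn_exp.const_mul _)
          measurableSet_Icc fun t ht => ?_
        rw [← Real.exp_add]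
        exact Real.exp_le_exp.2 ((ciInf_le (hbdd t ht) k).trans (by linarith))
    _ ≤ Real.exp (dist (Y k) y) := by
        rw [integral_const_mul]
        exact mul_le_of_le_one_right (Real.exp_pos _).le (hint k)

/-- Relaxing to functions of mass at most one and to vectors dominated by them makes the set of
competitors closed. Vectors doing at least as well as the uniform density form a compact set, on
which the likelihood attains its maximum. -/
lemma exists_isLogConcaveMLE {n : ℕ} {x : Fin n → ℝ} {a b : ℝ} (hab : a < b)
    (hx : ∀ i, x i ∈ Icc a b) (ha : ∃ i, x i = a) (hb : ∃ i, x i = b) :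
    ∃ ψ, IsLogConcaveMLE x ψ := by
  obtain ⟨ia, hia⟩ := ha
  obtain ⟨ib, hib⟩ := hb
  have hn : n ≠ 0 := fun h => by subst h; exact ia.elim0
  have hn' : (0 : ℝ) < n := by exact_mod_cast Nat.pos_of_ne_zero hn
  set c : ℝ := -Real.log (b - a)
  have hc : (fun _ => c) ∈ subdensityValues x a b := by
    refine ⟨fun _ => c, concaveOn_const _ (convex_Icc a b), fun _ => le_rfl, ?_⟩
    have : 0 < b - a := sub_pos.2 hab
    simp [c, Real.exp_neg, Real.exp_log this, hab.le, this.ne']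
  -- Each of the extreme observations `a` and `b` carries empirical mass at least `1 / n`.
  obtain ⟨M, hM0, hM⟩ := exists_upper_bound (1 / n) (b - a) c (by positivity) (sub_pos.2 hab)
  have hatom : ∀ (s : Set ℝ) i, x i ∈ s → (1 : ℝ) / n ≤ empMean x (s.indicator 1) := by
    intro s i hi
    refine div_le_div_of_nonneg_right ?_ hn'.le
    calc (1 : ℝ) = s.indicator 1 (x i) := by simp [hi]
      _ ≤ _ := Finset.single_le_sum (f := fun i => s.indicator (1 : ℝ → ℝ) (x i))
        (fun j _ => indicator_nonneg (fun _ _ => zero_le_one) _) (Finset.mem_univ i)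
  set S := subdensityValues x a b ∩ {y | n * c ≤ ∑ i, y i}
  have hup : ∀ g, ConcaveOn ℝ (Icc a b) g → (∫ t in Icc a b, Real.exp (g t)) ≤ 1 →
      n * c ≤ ∑ i, g (x i) → ∀ t ∈ Icc a b, g t ≤ M := fun g hg hint hs =>
    hM n x a b g a b hg hint hx (by linarith) (hatom _ ia hia.le) (hatom _ ib hib.ge)
      (by rw [empMean, le_div_iff₀ hn']; linarith)
  have hcomp : IsCompact S := by
    refine (isCompact_Icc (a := fun _ => n * c - n * M) (b := fun _ => M)).of_isClosed_subset
      ((isClosed_subdensityValues ⟨ia, hia⟩ ⟨ib, hib⟩).inter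
        (isClosed_le continuous_const (by fun_prop))) ?_
    rintro y ⟨⟨g, hg, hyg, hint⟩, hy⟩
    have hgM := hup g hg hint (hy.trans (Finset.sum_le_sum fun i _ => hyg i))
    have hyM : ∀ i, y i ≤ M := fun i => (hyg i).trans (hgM _ (hx i))
    refine ⟨fun i => ?_, hyM⟩
    have h1 : ∑ j ∈ Finset.univ.erase i, y j ≤ ∑ j ∈ (Finset.univ : Finset (Fin n)).erase i, M :=
      Finset.sum_le_sum fun j _ => hyM j
    have h2 : ∑ j ∈ (Finset.univ : Finset (Fin n)).erase i, M ≤ ∑ j : Fin n, M :=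
      Finset.sum_le_sum_of_subset_of_nonneg (Finset.erase_subset _ _) fun _ _ _ => hM0
    have h3 := Finset.add_sum_erase Finset.univ y (Finset.mem_univ i)
    simp only [Finset.sum_const, Finset.card_univ, Fintype.card_fin, nsmul_eq_mul] at h2
    have hy' : n * c ≤ ∑ i, y i := hy
    simp only [Finset.sum_const, nsmul_eq_mul] at h1
    linarith
  have hcS : (fun _ => c) ∈ S := ⟨hc, by simp⟩
  obtain ⟨y, ⟨⟨g, hg, hyg, hint⟩, hyS⟩, hmax⟩ := hcomp.exists_isMaxOn ⟨_, hcS⟩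
    (f := fun y => ∑ i, y i) (by fun_prop)
  have hmax' : ∀ z ∈ subdensityValues x a b, ∑ i, z i ≤ ∑ i, g (x i) := by
    intro z hz
    refine le_trans ?_ (Finset.sum_le_sum fun i _ => hyg i)
    by_cases h : n * c ≤ ∑ i, z i
    · exact hmax ⟨hz, h⟩
    · have hyS' : n * c ≤ ∑ i, y i := hyS
      linarith
  have hpos := hg.setIntegral_exp_pos hab
  refine ⟨_, hg.isLogDensity_extendBot hab, fun χ hχ => ?_⟩
  by_cases hbot : ∃ i, χ (x i) = ⊥
  · obtain ⟨i, hi⟩ := hbot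
    rw [EReal.sum_eq_bot (Finset.mem_univ i) hi]
    exact bot_le
  push Not at hbot
  have hne : ∀ t ∈ Icc a b, χ t ≠ ⊥ := fun t ht =>
    hχ.1.ne_bot_of_mem_Icc (hia ▸ hbot ia) (hib ▸ hbot ib) ht
  have h1 := hmax' (fun i => (χ (x i)).toReal)
    ⟨_, hχ.1.concaveOn_toReal (convex_Icc a b) hne, fun _ => le_rfl, hχ.setIntegral_exp_le hne⟩
  -- The maximiser has mass at most one, so normalising it can only increase the likelihood.
  have h2 : ∑ i, g (x i) ≤ ∑ i, (g (x i) - Real.log (∫ s in Icc a b, Real.exp (g s))) :=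
    Finset.sum_le_sum fun i _ => by linarith [Real.log_nonpos hpos.le hint]
  rw [Finset.sum_congr rfl fun i _ => (hχ.1.coe_toReal (hbot i)).symm,
    Finset.sum_congr rfl fun i _ => extendBot_of_mem (hx i), EReal.sum_coe, EReal.sum_coe]
  exact_mod_cast h1.trans h2

/-- `g` is the log-concave maximum likelihood estimator on the range `[a, b]` of the
observations. -/
structure IsMLEOn {n : ℕ} (x : Fin n → ℝ) (a b : ℝ) (g : ℝ → ℝ) : Prop where
  lt : a < b
  mem : ∀ i, x i ∈ Icc a b
  exists_left : ∃ i, x i = a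
  exists_right : ∃ i, x i = b
  concaveOn : ConcaveOn ℝ (Icc a b) g
  setIntegral_exp : ∫ t in Icc a b, Real.exp (g t) = 1
  le : ∀ χ : ℝ → ℝ, ConcaveOn ℝ (Icc a b) χ →
    empMean x χ ≤ empMean x g + Real.log (∫ t in Icc a b, Real.exp (χ t))

lemma IsMLEOn.ne_zero {n : ℕ} {x : Fin n → ℝ} {a b : ℝ} {g : ℝ → ℝ} (h : IsMLEOn x a b g) :
    n ≠ 0 := by
  rintro rfl
  exact h.exists_left.choose.elim0

/-- Normalising a competitor subtracts the logarithm of its integral, which removes the mass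
constraint from the optimality inequality. Comparison with the uniform density rules out the value
`-∞` at the data, and testing with the estimator itself shows that all its mass lies on `[a, b]`. -/
lemma IsLogConcaveMLE.isMLEOn {n : ℕ} {x : Fin n → ℝ} {ψ : ℝ → EReal} (h : IsLogConcaveMLE x ψ)
    {a b : ℝ} (hab : a < b) (hx : ∀ i, x i ∈ Icc a b) (ha : ∃ i, x i = a) (hb : ∃ i, x i = b) :
    (∀ t ∈ Icc a b, ψ t ≠ ⊥) ∧ IsMLEOn x a b fun t => (ψ t).toReal := by
  obtain ⟨ia, hia⟩ := ha
  obtain ⟨ib, hib⟩ := hb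
  have hn : n ≠ 0 := fun h => by subst h; exact ia.elim0
  have hn' : (0 : ℝ) < n := by exact_mod_cast Nat.pos_of_ne_zero hn
  have key : ∀ χ, ConcaveOn ℝ (Icc a b) χ →
      ((∑ i, (χ (x i) - Real.log (∫ s in Icc a b, Real.exp (χ s))) : ℝ) : EReal) ≤
        ∑ i, ψ (x i) := by
    intro χ hχ
    refine le_trans ?_ (h.2 _ (hχ.isLogDensity_extendBot hab))
    rw [Finset.sum_congr rfl fun i _ => extendBot_of_mem (hx i), EReal.sum_coe]
  have hbot : ∀ i, ψ (x i) ≠ ⊥ := by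
    intro i hi
    have := key (fun _ => 0) (concaveOn_const _ (convex_Icc a b))
    rw [EReal.sum_eq_bot (Finset.mem_univ i) hi] at this
    exact EReal.coe_ne_bot _ (le_bot_iff.1 this)
  have hne : ∀ t ∈ Icc a b, ψ t ≠ ⊥ := fun t ht =>
    h.1.1.ne_bot_of_mem_Icc (hia ▸ hbot ia) (hib ▸ hbot ib) ht
  have hconc := h.1.1.concaveOn_toReal (convex_Icc a b) hne
  have hle : ∀ χ : ℝ → ℝ, ConcaveOn ℝ (Icc a b) χ →
      empMean x χ ≤ empMean x (fun t => (ψ t).toReal) +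
        Real.log (∫ t in Icc a b, Real.exp (χ t)) := by
    intro χ hχ
    have := key χ hχ
    rw [Finset.sum_congr rfl fun i _ => (h.1.1.coe_toReal (hbot i)).symm, EReal.sum_coe] at this
    have h2 : ∑ i, (χ (x i) - Real.log (∫ s in Icc a b, Real.exp (χ s))) ≤
      ∑ i, (ψ (x i)).toReal := by exact_mod_cast this
    have h3 : empMean x (fun t => χ t - Real.log (∫ s in Icc a b, Real.exp (χ s))) ≤
      empMean x (fun t => (ψ t).toReal) := div_le_div_of_nonneg_right h2 hn'.le
    rw [empMean_sub, empMean_const hn] at h3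
    linarith
  refine ⟨hne, hab, hx, ⟨ia, hia⟩, ⟨ib, hib⟩, hconc, ?_, hle⟩
  refine le_antisymm (h.1.setIntegral_exp_le hne) ?_
  have h1 := hle _ hconc
  have hpos := hconc.setIntegral_exp_pos hab
  rw [← Real.log_nonneg_iff hpos]
  linarith

/-- If the observations are not all equal, the maximum likelihood estimator exists and is finite
on their range. -/
lemma exists_isMLEOn {n : ℕ} {x : Fin n → ℝ} {i j : Fin n} (hij : x i < x j) :
    IsConcaveFn (logConcaveMLE x) ∧ ∃ a b, a ≤ x i ∧ x j ≤ b ∧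
      (∀ t ∈ Icc a b, logConcaveMLE x t ≠ ⊥) ∧
      IsMLEOn x a b fun t => (logConcaveMLE x t).toReal := by
  have : Nonempty (Fin n) := ⟨i⟩
  obtain ⟨k, hk⟩ := Finite.exists_min x
  obtain ⟨l, hl⟩ := Finite.exists_max x
  have hlt : x k < x l := (hk i).trans_lt (hij.trans_le (hl j))
  have hmem : ∀ m, x m ∈ Icc (x k) (x l) := fun m => ⟨hk m, hl m⟩
  have hex := exists_isLogConcaveMLE hlt hmem ⟨k, rfl⟩ ⟨l, rfl⟩
  have hmle : IsLogConcaveMLE x (logConcaveMLE x) := by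
    rw [logConcaveMLE, dif_pos hex]
    exact hex.choose_spec
  exact ⟨hmle.1.1, x k, x l, hk i, hl j, hmle.isMLEOn hlt hmem ⟨k, rfl⟩ ⟨l, rfl⟩⟩

end

/-! ### Knots and the first-order condition -/

section
open Set

/-- A maximum at `τ` makes gluing possible. For `u ≤ r ≤ τ ≤ v` write `r = μ u + (1 - μ) τ`: then
`μ` is at most the weight of `u` in the combination of `u` and `v`, and since `H ≤ 0` both this
change of weight and dropping `v` go in the right direction. -/
lemma concaveOn_of_glue {H : ℝ → ℝ} {a b τ : ℝ} (hτ : τ ∈ Icc a b) (hle : ∀ z ∈ Icc a b, H z ≤ 0)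
    (h0 : H τ = 0) (h₁ : ConcaveOn ℝ (Icc a τ) H) (h₂ : ConcaveOn ℝ (Icc τ b) H) :
    ConcaveOn ℝ (Icc a b) H := by
  have key : ∀ (S : Set ℝ) (u r α μ : ℝ), ConcaveOn ℝ S H → u ∈ S → τ ∈ S → H u ≤ 0 → 0 ≤ μ →
      μ ≤ α → μ ≤ 1 → r = μ * u + (1 - μ) * τ → α * H u ≤ H r := by
    intro S u r α μ hS hu hτ hHu h1 h2 h3 hr
    have := hS.2 hu hτ h1 (sub_nonneg.2 h3) (by ring)
    simp only [smul_eq_mul, h0, mul_zero, add_zero, ← hr] at this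
    exact (mul_le_mul_of_nonpos_right h2 hHu).trans this
  have main : ∀ u ∈ Icc a b, ∀ v ∈ Icc a b, u ≤ v → ∀ α β : ℝ, 0 ≤ α → 0 ≤ β → α + β = 1 →
      α * H u + β * H v ≤ H (α * u + β * v) := by
    intro u hu v hv huv α β hα hβ hαβ
    rcases le_total v τ with hvτ | hvτ
    · exact h₁.2 ⟨hu.1, huv.trans hvτ⟩ ⟨hv.1, hvτ⟩ hα hβ hαβ
    rcases le_total τ u with huτ | huτ
    · exact h₂.2 ⟨huτ, hu.2⟩ ⟨hvτ, hv.2⟩ hα hβ hαβ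
    have hα1 : α = 1 - β := by linarith
    rcases le_total (α * u + β * v) τ with hr | hr
    · rcases huτ.eq_or_lt with rfl | huτ
      · exact h₂.2 ⟨le_rfl, hτ.2⟩ ⟨hvτ, hv.2⟩ hα hβ hαβ
      have hpos : 0 < τ - u := sub_pos.2 huτ
      have hμ : (τ - (α * u + β * v)) / (τ - u) ≤ α := by
        rw [div_le_iff₀ hpos]
        subst hα1
        nlinarith
      have h := key _ u (α * u + β * v) α ((τ - (α * u + β * v)) / (τ - u)) h₁ ⟨hu.1, huτ.le⟩
        ⟨hτ.1, le_rfl⟩ (hle u hu) (div_nonneg (by linarith) hpos.le) hμ (hμ.trans (by linarith))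
        (by field_simp; ring)
      nlinarith [hle v hv]
    · rcases hvτ.eq_or_lt with rfl | hvτ
      · exact h₁.2 ⟨hu.1, huτ⟩ ⟨hτ.1, le_rfl⟩ hα hβ hαβ
      have hpos : 0 < v - τ := sub_pos.2 hvτ
      have hμ : ((α * u + β * v) - τ) / (v - τ) ≤ β := by
        rw [div_le_iff₀ hpos]
        subst hα1
        nlinarith
      have h := key _ v (α * u + β * v) β (((α * u + β * v) - τ) / (v - τ)) h₂ ⟨hvτ.le, hv.2⟩
        ⟨le_rfl, hτ.2⟩ (hle v hv) (div_nonneg (by linarith) hpos.le) hμ (hμ.trans (by linarith))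
        (by field_simp; ring)
      nlinarith [hle u hu]
  refine ⟨convex_Icc a b, fun u hu v hv α β hα hβ hαβ => ?_⟩
  simp only [smul_eq_mul]
  rcases le_total u v with h | h
  · exact main u hu v hv h α β hα hβ hαβ
  · rw [add_comm, add_comm (α * u)]
    exact main v hv u hu h β α hβ hα (by linarith)

lemma ConcaveOn.le_line {S : Set ℝ} {g : ℝ → ℝ} (h : ConcaveOn ℝ S g) {u v z s : ℝ}
    (hu : u ∈ S) (hv : v ∈ S) (hz : z ∈ S) (huv : u < v) (hs : g v = g u + s * (v - u))
    (hzuv : z ∉ Ioo u v) : g z ≤ g u + s * (z - u) := by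
  have hsl : (g v - g u) / (v - u) = s := by
    rw [hs]; field_simp [(sub_pos.2 huv).ne']; ring
  rw [mem_Ioo, not_and_or, not_lt, not_lt] at hzuv
  rcases hzuv with hz' | hz'
  · rcases hz'.eq_or_lt with rfl | hz'
    · simp
    have := h.slope_anti_adjacent hz hv hz' huv
    rw [hsl, le_div_iff₀ (by linarith)] at this
    linarith
  · have := h.le_extrapolation hu hz huv hz'
    rw [hsl, hs] at this
    linarith

lemma concaveOn_affine (S : Set ℝ) (hS : Convex ℝ S) (c s u : ℝ) :
    ConcaveOn ℝ S fun z => c + s * (z - u) := by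
  refine ⟨hS, fun x _ y _ α β _ _ hαβ => le_of_eq ?_⟩
  simp only [smul_eq_mul]
  linear_combination (c - s * u) * hαβ

lemma convexOn_max_sub (S : Set ℝ) (hS : Convex ℝ S) (u : ℝ) :
    ConvexOn ℝ S fun z => max (z - u) 0 := by
  refine ⟨hS, fun x _ y _ α β hα hβ hαβ => ?_⟩
  simp only [smul_eq_mul]
  refine max_le ?_ (by positivity)
  have h1 := mul_le_mul_of_nonneg_left (le_max_left (x - u) 0) hα
  have h2 := mul_le_mul_of_nonneg_left (le_max_left (y - u) 0) hβ
  have : α * x + β * y - u = α * (x - u) + β * (y - u) := by linear_combination u * hαβ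
  linarith

/-- `τ` is a point at which the slope of `g` drops. -/
def IsKnot (a b : ℝ) (g : ℝ → ℝ) (τ : ℝ) : Prop :=
  ∃ t > 0, ConcaveOn ℝ (Icc a b) fun z => g z + t * max (z - τ) 0

/-- After subtraction of the left tangent line, `g + (s₁ - s₂)(z - τ)⁺` vanishes near `τ` on both
sides. It has its maximum at `τ`, is concave on each side, and hence can be glued. -/
lemma isKnot_of_slope_lt {a b p τ q s₁ s₂ : ℝ} {g : ℝ → ℝ} (hg : ConcaveOn ℝ (Icc a b) g)
    (hp : p ∈ Icc a b) (hq : q ∈ Icc a b) (hpτ : p < τ) (hτq : τ < q)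
    (h₁ : ∀ z ∈ Icc p τ, g z = g τ + s₁ * (z - τ)) (h₂ : ∀ z ∈ Icc τ q, g z = g τ + s₂ * (z - τ))
    (hs : s₂ < s₁) :
    IsKnot a b g τ := by
  have hτ : τ ∈ Icc a b := ⟨hp.1.trans hpτ.le, hτq.le.trans hq.2⟩
  have hg' : ConcaveOn ℝ (Icc a b) fun z => g z + -(g τ + s₁ * (z - τ)) := by
    refine hg.add ?_
    exact (concaveOn_affine (Icc a b) (convex_Icc a b) (-g τ) (-s₁) τ).congr fun z _ => by ring
  have hlin : ∀ t c : ℝ, ConcaveOn ℝ (Icc a b) fun z => t * (z - c) := by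
    intro t c
    simpa using concaveOn_affine (Icc a b) (convex_Icc a b) 0 t c
  have hglue : ConcaveOn ℝ (Icc a b)
      fun z => g z + (s₁ - s₂) * max (z - τ) 0 - (g τ + s₁ * (z - τ)) := by
    refine concaveOn_of_glue hτ (fun z hz => ?_) (by simp) ?_ ?_
    · rcases le_total z τ with hzτ | hzτ
      · rw [max_eq_right (by linarith)]
        by_cases hpz : z ∈ Ioo p τ
        · linarith [h₁ z ⟨hpz.1.le, hpz.2.le⟩]
        · have hpe := h₁ p ⟨le_rfl, hpτ.le⟩
          have := hg.le_line (u := p) (v := τ) (s := s₁) hp hτ hz hpτ (by linarith) hpz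
          linarith
      · rw [max_eq_left (by linarith)]
        by_cases hzq : z ∈ Ioo τ q
        · linarith [h₂ z ⟨hzq.1.le, hzq.2.le⟩]
        · have := hg.le_line hτ hq hz hτq (h₂ q ⟨hτq.le, le_rfl⟩) hzq
          linarith
    · refine (hg'.subset (Icc_subset_Icc le_rfl hτ.2) (convex_Icc _ _)).congr fun z hz => ?_
      simp only [max_eq_right (sub_nonpos.2 hz.2)]
      ring
    · refine ((hg'.add (hlin (s₁ - s₂) τ)).subset (Icc_subset_Icc hτ.1 le_rfl)
        (convex_Icc _ _)).congr fun z hz => ?_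
      simp only [Pi.add_apply, max_eq_left (sub_nonneg.2 hz.1)]
      ring
  refine ⟨s₁ - s₂, sub_pos.2 hs, ?_⟩
  exact (hglue.add (concaveOn_affine (Icc a b) (convex_Icc a b) (g τ) s₁ τ)).congr
    fun z _ => by simp

lemma eventually_notMem_Ico {n : ℕ} (x : Fin n → ℝ) (τ : ℝ) :
    ∀ᶠ p in 𝓝[<] τ, ∀ i, x i ∉ Ico p τ := by
  refine eventually_all.2 fun i => ?_
  rcases lt_or_ge (x i) τ with hi | hi
  · filter_upwards [Ioo_mem_nhdsLT hi] with p hp h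
    exact absurd hp.1 (not_lt.2 h.1)
  · exact Eventually.of_forall fun p h => absurd h.2 (not_lt.2 hi)

lemma eventually_notMem_Ioc {n : ℕ} (x : Fin n → ℝ) (τ : ℝ) :
    ∀ᶠ q in 𝓝[>] τ, ∀ i, x i ∉ Ioc τ q := by
  refine eventually_all.2 fun i => ?_
  rcases lt_or_ge τ (x i) with hi | hi
  · filter_upwards [Ioo_mem_nhdsGT hi] with p hp h
    exact absurd hp.2 (not_lt.2 h.2)
  · exact Eventually.of_forall fun p h => absurd h.1 (not_lt.2 hi)

namespace IsMLEOn

variable {n : ℕ} {x : Fin n → ℝ} {a b : ℝ} {g : ℝ → ℝ}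

/-- Compare the estimator with `g + sΔ` and let `s` tend to zero. The logarithm of the new integral
is at most `s ∫ Δ e^g + s² B²`, since `log I ≤ I - 1` and `e^y ≤ 1 + y + y²` for `|y| ≤ 1`. -/
lemma empMean_le_of_perturbation (h : IsMLEOn x a b g) {Δ : ℝ → ℝ} {t : ℝ} (ht : 0 < t)
    (hΔ : ConcaveOn ℝ (Icc a b) fun z => g z + t * Δ z) :
    empMean x Δ ≤ ∫ z in Icc a b, Δ z * Real.exp (g z) := by
  obtain ⟨C₁, hC₁⟩ := h.concaveOn.exists_abs_le
  obtain ⟨C₂, hC₂⟩ := hΔ.exists_abs_le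
  set B : ℝ := max ((C₁ + C₂) / t) 1 with hB
  have hB1 : 1 ≤ B := le_max_right _ _
  have hΔB : ∀ z ∈ Icc a b, |Δ z| ≤ B := by
    intro z hz
    refine le_trans ?_ (le_max_left _ _)
    rw [le_div_iff₀ ht]
    calc |Δ z| * t = |(g z + t * Δ z) - g z| := by
          rw [add_sub_cancel_left, abs_mul, abs_of_pos ht, mul_comm]
      _ ≤ |g z + t * Δ z| + |g z| := abs_sub _ _
      _ ≤ C₁ + C₂ := by linarith [hC₁ z hz, hC₂ z hz]
  have hmeas : AEStronglyMeasurable Δ (volume.restrict (Icc a b)) := by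
    have := (hΔ.aestronglyMeasurable_Icc.sub h.concaveOn.aestronglyMeasurable_Icc).const_mul t⁻¹
    refine this.congr (ae_of_all _ fun z => ?_)
    simp only [Pi.sub_apply]
    field_simp
    ring
  have hint : IntegrableOn (fun z => Δ z * Real.exp (g z)) (Icc a b) :=
    h.concaveOn.integrableOn_exp.bdd_mul hmeas
      ((ae_restrict_iff' measurableSet_Icc).2 (ae_of_all _ fun z hz => hΔB z hz))
  have key : ∀ s, 0 < s → s ≤ t → s * B ≤ 1 →
      empMean x Δ ≤ (∫ z in Icc a b, Δ z * Real.exp (g z)) + s * B ^ 2 := by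
    intro s hs hst hsB
    -- Small multiples remain admissible because `g + sΔ` is a convex combination of `g` and `g +
    -- tΔ`.
    have hconc : ConcaveOn ℝ (Icc a b) fun z => g z + s * Δ z := by
      have h1 := (h.concaveOn.smul (c := 1 - s / t)
        (sub_nonneg.2 ((div_le_one ht).2 hst))).add (hΔ.smul (c := s / t) (by positivity))
      refine h1.congr fun z _ => ?_
      simp only [Pi.add_apply, smul_eq_mul]
      field_simp
      ring
    have h1 := h.le _ hconc
    rw [empMean_add, empMean_const_mul] at h1
    have hpos := hconc.setIntegral_exp_pos h.lt
    have h2 := Real.log_le_sub_one_of_pos hpos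
    have h3 : (∫ z in Icc a b, Real.exp (g z + s * Δ z)) ≤
        ∫ z in Icc a b, (Real.exp (g z) + s * (Δ z * Real.exp (g z)) +
          s ^ 2 * B ^ 2 * Real.exp (g z)) := by
      refine setIntegral_mono_on hconc.integrableOn_exp
        ((h.concaveOn.integrableOn_exp.add (hint.const_mul _)).add
          (h.concaveOn.integrableOn_exp.const_mul _)) measurableSet_Icc fun z hz => ?_
      have hb : |s * Δ z| ≤ 1 := by
        rw [abs_mul, abs_of_pos hs]
        exact (mul_le_mul_of_nonneg_left (hΔB z hz) hs.le).trans hsB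
      have h4 := (abs_le.1 (Real.abs_exp_sub_one_sub_id_le hb)).2
      have h5 : (s * Δ z) ^ 2 ≤ s ^ 2 * B ^ 2 := by
        rw [mul_pow]
        exact mul_le_mul_of_nonneg_left (sq_le_sq' (abs_le.1 (hΔB z hz)).1
          (abs_le.1 (hΔB z hz)).2) (sq_nonneg _)
      rw [Real.exp_add]
      have h6 : Real.exp (s * Δ z) ≤ 1 + s * Δ z + s ^ 2 * B ^ 2 := by linarith
      have := mul_le_mul_of_nonneg_left h6 (Real.exp_pos (g z)).le
      linarith
    have i1 := h.concaveOn.integrableOn_exp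
    rw [integral_add (f := fun z => Real.exp (g z) + s * (Δ z * Real.exp (g z)))
      (i1.add (hint.const_mul _)) (i1.const_mul _), integral_add i1 (hint.const_mul _),
      integral_const_mul, integral_const_mul,
      h.setIntegral_exp] at h3
    have h7 : s * empMean x Δ ≤ s * ((∫ z in Icc a b, Δ z * Real.exp (g z)) + s * B ^ 2) := by
      nlinarith
    exact le_of_mul_le_mul_left h7 hs
  refine le_of_forall_pos_le_add fun ε hε => ?_
  have hBp : 0 < B := by linarith
  refine (key (min t (min (1 / B) (ε / B ^ 2))) (by positivity) (min_le_left _ _) ?_).trans ?_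
  · rw [← le_div_iff₀ hBp]
    exact (min_le_right _ _).trans (min_le_left _ _)
  · have : min t (min (1 / B) (ε / B ^ 2)) ≤ ε / B ^ 2 :=
      (min_le_right _ _).trans (min_le_right _ _)
    rw [le_div_iff₀ (by positivity)] at this
    linarith

lemma integrableOn_max_sub_mul_exp (h : IsMLEOn x a b g) (s : ℝ) :
    IntegrableOn (fun z => max (z - s) 0 * Real.exp (g z)) (Icc a b) :=
  h.concaveOn.integrableOn_exp.continuousOn_mul (by fun_prop) isCompact_Icc

/-- Subtracting a convex function never destroys concavity, so no knot is needed in this direction.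
-/
lemma integral_max_sub_le (h : IsMLEOn x a b g) (s : ℝ) :
    ∫ z in Icc a b, max (z - s) 0 * Real.exp (g z) ≤ empMean x fun z => max (z - s) 0 := by
  have := h.empMean_le_of_perturbation (Δ := fun z => (-1) * max (z - s) 0) one_pos (by
    exact (h.concaveOn.add (convexOn_max_sub (Icc a b) (convex_Icc a b) s).neg).congr
      fun z _ => by simp)
  rw [empMean_const_mul] at this
  simp only [mul_assoc, integral_const_mul] at this
  linarith

lemma empMean_max_sub_le (h : IsMLEOn x a b g) {τ : ℝ} (hτ : IsKnot a b g τ) :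
    (empMean x fun z => max (z - τ) 0) ≤ ∫ z in Icc a b, max (z - τ) 0 * Real.exp (g z) := by
  obtain ⟨t, ht, hc⟩ := hτ
  exact h.empMean_le_of_perturbation ht hc

end IsMLEOn
end

/-! ### Tail masses at knots and affine pieces of the estimator -/

section
open Set
namespace IsMLEOn

variable {n : ℕ} {x : Fin n → ℝ} {a b : ℝ} {g : ℝ → ℝ}

/-- Take `p < τ` with no observation in `[p, τ)`. The excess inequality at `p` and its reverse at
the knot `τ` can be subtracted. At the observations the difference of the two excess functions is `τ
- p` times the indicator of `[τ, ∞)`, and it is nonnegative everywhere. -/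
lemma setIntegral_exp_le_empMean (h : IsMLEOn x a b g) {τ : ℝ} (hτ : IsKnot a b g τ)
    (haτ : a ≤ τ) : ∫ z in Icc τ b, Real.exp (g z) ≤ empMean x ((Ici τ).indicator 1) := by
  obtain ⟨p, hp, hpτ⟩ := ((eventually_notMem_Ico x τ).and self_mem_nhdsWithin).exists
  have hpτ : p < τ := hpτ
  have h1 := h.integral_max_sub_le p
  have h2 := h.empMean_max_sub_le hτ
  have hI : IntegrableOn (fun z => (max (z - p) 0 - max (z - τ) 0) * Real.exp (g z))
      (Icc a b) :=
    h.concaveOn.integrableOn_exp.continuousOn_mul (by fun_prop) isCompact_Icc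
  have h3 : (τ - p) * ∫ z in Icc τ b, Real.exp (g z) ≤
      ∫ z in Icc a b, (max (z - p) 0 - max (z - τ) 0) * Real.exp (g z) := by
    have hsub : Icc τ b ⊆ Icc a b := Icc_subset_Icc haτ le_rfl
    rw [← integral_const_mul]
    calc ∫ z in Icc τ b, (τ - p) * Real.exp (g z)
        ≤ ∫ z in Icc τ b, (max (z - p) 0 - max (z - τ) 0) * Real.exp (g z) := by
          refine setIntegral_mono_on ((h.concaveOn.integrableOn_exp.mono_set hsub).const_mul _)
            (hI.mono_set hsub) measurableSet_Icc fun z hz => ?_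
          rw [max_eq_left (by linarith [hz.1]), max_eq_left (by linarith [hz.1])]
          exact le_of_eq (by ring)
      _ ≤ _ := by
          refine setIntegral_mono_set hI (ae_of_all _ fun z => ?_) hsub.eventuallyLE
          refine mul_nonneg (sub_nonneg.2 (max_le_max (by linarith) le_rfl)) (Real.exp_pos _).le
  have h4 : (∫ z in Icc a b, (max (z - p) 0 - max (z - τ) 0) * Real.exp (g z)) =
      (∫ z in Icc a b, max (z - p) 0 * Real.exp (g z)) -
        ∫ z in Icc a b, max (z - τ) 0 * Real.exp (g z) := by
    rw [← integral_sub (h.integrableOn_max_sub_mul_exp p) (h.integrableOn_max_sub_mul_exp τ)]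
    simp only [sub_mul]
  have h5 : (empMean x fun z => max (z - p) 0) - (empMean x fun z => max (z - τ) 0) =
      (τ - p) * empMean x ((Ici τ).indicator 1) := by
    rw [← empMean_sub, ← empMean_const_mul]
    refine empMean_congr fun i => ?_
    by_cases hi : τ ≤ x i
    · rw [indicator_of_mem (mem_Ici.2 hi), max_eq_left (by linarith), max_eq_left (by linarith)]
      simp
    · push Not at hi
      have : x i < p := by
        by_contra! hc
        exact hp i ⟨hc, hi⟩
      rw [indicator_of_notMem (by simpa using hi), max_eq_right (by linarith),
        max_eq_right (by linarith)]
      simp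
  have : (τ - p) * ∫ z in Icc τ b, Real.exp (g z) ≤
      (τ - p) * empMean x ((Ici τ).indicator 1) := by linarith
  exact le_of_mul_le_mul_left this (sub_pos.2 hpτ)

/-- The estimator is affine between observations. -/
lemma exists_slope (h : IsMLEOn x a b g) {u v : ℝ} (hu : u ∈ Icc a b) (hv : v ∈ Icc a b)
    (huv : u < v) (hdata : ∀ i, x i ∉ Ioo u v) :
    ∃ s, ∀ z ∈ Icc u v, g z = g u + s * (z - u) := by
  set s : ℝ := (g v - g u) / (v - u) with hs
  have hvs : g v = g u + s * (v - u) := by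
    rw [hs]; field_simp [(sub_pos.2 huv).ne']; ring
  have hlow : ∀ z ∈ Icc u v, g u + s * (z - u) ≤ g z := by
    intro z hz
    have hl : 0 < v - u := sub_pos.2 huv
    have := h.concaveOn.2 hu hv (div_nonneg (sub_nonneg.2 hz.2) hl.le)
      (div_nonneg (sub_nonneg.2 hz.1) hl.le) (by field_simp; ring)
    simp only [smul_eq_mul] at this
    have e : (v - z) / (v - u) * u + (z - u) / (v - u) * v = z := by field_simp; ring
    rw [e] at this
    refine le_trans (le_of_eq ?_) this
    rw [hvs]; field_simp; ring
  classical
  -- Replacing `g` by its chord on `(u, v)` keeps concavity and the values at the data. If `g` were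
  -- above the chord somewhere, it would be so on all of `(u, v)`, the mass would drop strictly, and
  -- normalising would improve the likelihood.
  set χ : ℝ → ℝ := fun z => if z ∈ Ioo u v then g u + s * (z - u) else g z with hχ
  have hχin : ∀ z ∈ Ioo u v, χ z = g u + s * (z - u) := fun z hz => if_pos hz
  have hχout : ∀ z ∉ Ioo u v, χ z = g z := fun z hz => if_neg hz
  have hχline : ∀ z ∈ Icc a b, χ z ≤ g u + s * (z - u) := by
    intro z hz
    by_cases hzu : z ∈ Ioo u v
    · exact (hχin z hzu).le
    · rw [hχout z hzu]
      exact h.concaveOn.le_line hu hv hz huv hvs hzu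
  have hχg : ∀ z, χ z ≤ g z := by
    intro z
    by_cases hzu : z ∈ Ioo u v
    · rw [hχin z hzu]; exact hlow z ⟨hzu.1.le, hzu.2.le⟩
    · exact (hχout z hzu).le
  have hχc : ConcaveOn ℝ (Icc a b) χ := by
    refine ⟨convex_Icc a b, fun p hp q hq α β hα hβ hαβ => ?_⟩
    by_cases hr : α • p + β • q ∈ Ioo u v
    · rw [hχin _ hr]
      have h1 := mul_le_mul_of_nonneg_left (hχline p hp) hα
      have h2 := mul_le_mul_of_nonneg_left (hχline q hq) hβ
      simp only [smul_eq_mul]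
      have h3 : α * (g u + s * (p - u)) + β * (g u + s * (q - u)) =
          g u + s * (α * p + β * q - u) := by linear_combination (g u - s * u) * hαβ
      linarith
    · rw [hχout _ hr]
      refine le_trans ?_ (h.concaveOn.2 hp hq hα hβ hαβ)
      exact add_le_add (mul_le_mul_of_nonneg_left (hχg p) hα)
        (mul_le_mul_of_nonneg_left (hχg q) hβ)
  have havg : empMean x χ = empMean x g := empMean_congr fun i => hχout _ (hdata i)
  have h1 := h.le χ hχc
  have hpos := hχc.setIntegral_exp_pos h.lt
  have h2 : 1 ≤ ∫ z in Icc a b, Real.exp (χ z) := by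
    rw [← Real.log_nonneg_iff hpos]; linarith
  refine ⟨s, fun w hw => ?_⟩
  by_contra hne
  have hlt : g u + s * (w - u) < g w := lt_of_le_of_ne (hlow w hw) (Ne.symm hne)
  have hwu : u < w := hw.1.lt_of_ne fun e => by subst e; simp at hlt
  have hwv : w < v := hw.2.lt_of_ne fun e => by subst e; linarith
  have hwab : w ∈ Icc a b := ⟨hu.1.trans hw.1, hw.2.trans hv.2⟩
  have hstrict : ∀ z ∈ Ioo u v, χ z < g z := by
    intro z hz
    rw [hχin z hz]
    have hzab : z ∈ Icc a b := ⟨hu.1.trans hz.1.le, hz.2.le.trans hv.2⟩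
    by_contra! hc
    have hzeq : g z = g u + s * (z - u) := le_antisymm hc (hlow z ⟨hz.1.le, hz.2.le⟩)
    rcases lt_trichotomy z w with hzw | rfl | hzw
    · have := h.concaveOn.le_line hu hzab hwab hz.1 hzeq fun h => by linarith [h.2]
      linarith
    · linarith
    · have := h.concaveOn.le_line hzab hv hwab hz.2 (s := s) (by rw [hzeq, hvs]; ring)
        fun h => by linarith [h.1]
      rw [hzeq] at this
      linarith
  have hint : IntegrableOn (fun z => Real.exp (g z) - Real.exp (χ z)) (Icc a b) :=
    h.concaveOn.integrableOn_exp.sub hχc.integrableOn_exp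
  have h3 : 0 < ∫ z in Icc a b, (Real.exp (g z) - Real.exp (χ z)) := by
    rw [setIntegral_pos_iff_support_of_nonneg_ae
      (ae_of_all _ fun z => sub_nonneg.2 (Real.exp_le_exp.2 (hχg z))) hint]
    refine lt_of_lt_of_le ?_ (measure_mono (s := Ioo u v) fun z hz => ⟨?_, ?_⟩)
    · simpa using huv
    · exact (sub_pos.2 (Real.exp_lt_exp.2 (hstrict z hz))).ne'
    · exact ⟨hu.1.trans hz.1.le, hz.2.le.trans hv.2⟩
  rw [integral_sub h.concaveOn.integrableOn_exp hχc.integrableOn_exp, h.setIntegral_exp] at h3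
  linarith

/-- To the left of any point `β` there is a last knot in `[c, β]`, or the estimator is affine from
`c` until slightly beyond `β`. -/
lemma exists_knot (h : IsMLEOn x a b g) {c β : ℝ} (hac : a ≤ c) (hcβ : c ≤ β) (hβb : β < b) :
    ∃ q τ s : ℝ, β < q ∧ q ≤ b ∧ c ≤ τ ∧ τ ≤ β ∧ (∀ z ∈ Icc τ q, g z = g τ + s * (z - τ)) ∧
      (τ = c ∨ IsKnot a b g τ) := by
  have right : ∀ p, p < b → ∃ q, p < q ∧ q ≤ b ∧ ∀ i, x i ∉ Ioo p q := by
    intro p hp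
    obtain ⟨q, hq, hpq⟩ := ((eventually_notMem_Ioc x p).and (Ioc_mem_nhdsGT hp)).exists
    exact ⟨q, hpq.1, hpq.2, fun i hi => hq i ⟨hi.1, hi.2.le⟩⟩
  obtain ⟨q, hβq, hqb, hq⟩ := right β hβb
  have hβab : β ∈ Icc a b := ⟨hac.trans hcβ, hβb.le⟩
  have hqab : q ∈ Icc a b := ⟨hβab.1.trans hβq.le, hqb⟩
  obtain ⟨s, hs⟩ := h.exists_slope hβab hqab hβq hq
  -- The affine piece around `β` is extended to the left as far as possible within `[c, β]`.
  set A : Set ℝ := {p | p ∈ Icc c β ∧ ∀ z ∈ Icc p q, g z = g β + s * (z - β)} with hA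
  have hβA : β ∈ A := ⟨⟨hcβ, le_rfl⟩, hs⟩
  have hbdd : BddBelow A := ⟨c, fun p hp => hp.1.1⟩
  set τ := sInf A with hτ
  have hcτ : c ≤ τ := le_csInf ⟨β, hβA⟩ fun p hp => hp.1.1
  have hτβ : τ ≤ β := csInf_le hbdd hβA
  have hτab : τ ∈ Icc a b := ⟨hac.trans hcτ, hτβ.trans hβb.le⟩
  have hopen : ∀ z ∈ Ioc τ q, g z = g β + s * (z - β) := by
    intro z hz
    obtain ⟨p, hp, hpz⟩ := exists_lt_of_csInf_lt ⟨β, hβA⟩ hz.1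
    exact hp.2 z ⟨hpz.le, hz.2⟩
  have hτq : τ < q := hτβ.trans_lt hβq
  -- The infimum belongs to the piece: `g` is affine just to the right of `τ` including `τ` itself,
  -- and agrees there with the line at two further points.
  have hτA : g τ = g β + s * (τ - β) := by
    obtain ⟨r, hτr, hrb, hr⟩ := right τ (hτβ.trans_lt hβb)
    set r' := min r q
    have hτr' : τ < r' := lt_min hτr hτq
    obtain ⟨s', hs'⟩ := h.exists_slope hτab ⟨hτab.1.trans hτr.le, hrb⟩ hτr hr
    have h1 := hs' r' ⟨hτr'.le, min_le_left _ _⟩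
    have h2 := hs' ((τ + r') / 2) ⟨by linarith, by linarith [min_le_left r q]⟩
    rw [hopen r' ⟨hτr', min_le_right _ _⟩] at h1
    rw [hopen ((τ + r') / 2) ⟨by linarith, by linarith [min_le_right r q]⟩] at h2
    linarith
  have hline : ∀ z ∈ Icc τ q, g z = g τ + s * (z - τ) := by
    intro z hz
    rcases hz.1.eq_or_lt with rfl | hz1
    · simp
    · rw [hopen z ⟨hz1, hz.2⟩, hτA]; ring
  refine ⟨q, τ, s, hβq, hqb, hcτ, hτβ, hline, ?_⟩
  rcases hcτ.eq_or_lt with hc | hc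
  · exact Or.inl hc.symm
  right
  obtain ⟨p, hp, hpτ⟩ := ((eventually_notMem_Ico x τ).and (Ioo_mem_nhdsLT hc)).exists
  have hpab : p ∈ Icc a b := ⟨hac.trans hpτ.1.le, hpτ.2.le.trans hτab.2⟩
  obtain ⟨s₁, hs₁⟩ := h.exists_slope hpab hτab hpτ.2 fun i hi => hp i ⟨hi.1.le, hi.2⟩
  have hs₁' : ∀ z ∈ Icc p τ, g z = g τ + s₁ * (z - τ) := by
    intro z hz
    rw [hs₁ z hz, hs₁ τ ⟨hpτ.2.le, le_rfl⟩]; ring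
  refine isKnot_of_slope_lt h.concaveOn hpab hqab hpτ.2 hτq hs₁' hline ?_
  have h1 := h.concaveOn.le_line hpab hτab hqab hpτ.2 (hs₁ τ ⟨hpτ.2.le, le_rfl⟩)
    fun h => by linarith [h.2]
  rw [hline q ⟨hτq.le, le_rfl⟩] at h1
  have h2 := hs₁ τ ⟨hpτ.2.le, le_rfl⟩
  have h3 : s ≤ s₁ := by
    have : s * (q - τ) ≤ s₁ * (q - τ) := by linarith
    exact le_of_mul_le_mul_right this (sub_pos.2 hτq)
  refine h3.lt_of_ne fun he => ?_
  -- With equal slopes the piece would extend beyond `τ`, against minimality.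
  have hpA : p ∈ A := by
    refine ⟨⟨hpτ.1.le, hpτ.2.le.trans hτβ⟩, fun z hz => ?_⟩
    rcases le_total z τ with hzτ | hzτ
    · rw [hs₁' z ⟨hz.1, hzτ⟩, ← he, hτA]; ring
    · rw [hline z ⟨hzτ, hz.2⟩, hτA]; ring
  exact absurd (csInf_le hbdd hpA) (not_le.2 hpτ.2)

end IsMLEOn
end

/-! ### Probability tending to one, laws of large numbers and an exponential inequality -/

section
open Set

variable {Ω : Type*} [MeasurableSpace Ω]

/-- The filter of the sequences of events whose (outer) probabilities tend to one. -/
def withHighProb (μ : Measure Ω) : Filter (ℕ × Ω) where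
  sets := {S | Tendsto (fun n => μ {ω | (n, ω) ∉ S}) atTop (𝓝 0)}
  univ_sets := by simp
  sets_of_superset := fun {S T} hS hST =>
    tendsto_of_tendsto_of_tendsto_of_le_of_le tendsto_const_nhds hS (fun _ => zero_le)
      fun n => measure_mono fun ω hω h => hω (hST h)
  inter_sets := fun {S T} hS hT => by
    have := Tendsto.add hS hT
    rw [add_zero] at this
    refine tendsto_of_tendsto_of_tendsto_of_le_of_le tendsto_const_nhds this
      (fun _ => zero_le) fun n => ?_
    refine (measure_mono fun ω hω => ?_).trans (measure_union_le _ _)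
    simp only [mem_inter_iff, not_and_or, mem_ofPred_eq] at hω
    exact hω

lemma eventually_withHighProb {μ : Measure Ω} {Q : ℕ × Ω → Prop} :
    (∀ᶠ p in withHighProb μ, Q p) ↔ Tendsto (fun n => μ {ω | ¬ Q (n, ω)}) atTop (𝓝 0) := Iff.rfl

lemma tendsto_fst_withHighProb (μ : Measure Ω) : Tendsto Prod.fst (withHighProb μ) atTop := by
  intro S hS
  refine tendsto_const_nhds.congr' ?_
  filter_upwards [hS] with n hn
  simp [hn]

lemma eventually_withHighProb_of_ae {μ : Measure Ω} {Q : ℕ → Ω → Prop}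
    (h : ∀ n, ∀ᵐ ω ∂μ, Q n ω) : ∀ᶠ p in withHighProb μ, Q p.1 p.2 := by
  rw [eventually_withHighProb]
  have : (fun n => μ {ω | ¬ Q n ω}) = fun _ => 0 := funext fun n => ae_iff.1 (h n)
  simp only [this]
  exact tendsto_const_nhds

/-- `X 0, X 1, …` are independent with distribution `P`. -/
structure IsIIDSample (μ : Measure Ω) (X : ℕ → Ω → ℝ) (P : Measure ℝ) : Prop where
  indep : iIndepFun X μ
  law : ∀ i, HasLaw (X i) P μ

/-- The first `n` observations. -/
def obs {Ω : Type*} (X : ℕ → Ω → ℝ) (p : ℕ × Ω) (i : Fin p.1) : ℝ := X i p.2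

lemma empMean_obs {Ω : Type*} (X : ℕ → Ω → ℝ) (p : ℕ × Ω) (h : ℝ → ℝ) :
    empMean (obs X p) h = (∑ i ∈ Finset.range p.1, h (X i p.2)) / p.1 := by
  simp only [empMean, obs, Fin.sum_univ_eq_sum_range fun i => h (X i p.2)]

namespace IsIIDSample

variable {μ : Measure Ω} {X : ℕ → Ω → ℝ} {P : Measure ℝ}

lemma isProbabilityMeasure [IsProbabilityMeasure μ] (hX : IsIIDSample μ X P) :
    IsProbabilityMeasure P :=
  (hX.law 0).isProbabilityMeasure_iff.1 inferInstance

lemma ae_mem (hX : IsIIDSample μ X P) {S : Set ℝ} (hS : MeasurableSet S) (h : P Sᶜ = 0) :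
    ∀ᶠ p in withHighProb μ, ∀ i, obs X p i ∈ S := by
  have : ∀ i, ∀ᵐ ω ∂μ, X i ω ∈ S := fun i => by
    rw [ae_iff, (hX.law i).measure_eq (p := fun x => ¬ x ∈ S) hS.compl]
    exact h
  refine eventually_withHighProb_of_ae (Q := fun n ω => ∀ i : Fin n, obs X (n, ω) i ∈ S)
    fun n => ?_
  filter_upwards [ae_all_iff.2 this] with ω hω i
  exact hω i

lemma tendsto_empMean [IsProbabilityMeasure μ] (hX : IsIIDSample μ X P) {h : ℝ → ℝ}
    (hm : Measurable h) (hint : Integrable h P) :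
    Tendsto (fun p => empMean (obs X p) h) (withHighProb μ) (𝓝 (∫ z, h z ∂P)) := by
  have hident : ∀ i, IdentDistrib (X i) (X 0) μ μ := fun i =>
    ⟨(hX.law i).aemeasurable, (hX.law 0).aemeasurable, by rw [(hX.law i).map_eq, (hX.law 0).map_eq]⟩
  have hint0 : Integrable (fun ω => h (X 0 ω)) μ := by
    rw [← (hX.law 0).map_eq] at hint
    exact hint.comp_aemeasurable (hX.law 0).aemeasurable
  have hmean : ∫ ω, h (X 0 ω) ∂μ = ∫ z, h z ∂P :=
    (hX.law 0).integral_comp hint.aestronglyMeasurable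
  have h1 := strong_law_ae_real (fun i ω => h (X i ω)) hint0
    (fun i j hij => (hX.indep.indepFun hij).comp hm hm) fun i => (hident i).comp hm
  simp only [hmean] at h1
  have h2 := tendstoInMeasure_of_tendsto_ae
    (f := fun n ω => (∑ i ∈ Finset.range n, h (X i ω)) / n) (g := fun _ => ∫ z, h z ∂P)
    (fun n => by
      refine AEMeasurable.aestronglyMeasurable ?_
      refine AEMeasurable.div_const (Finset.aemeasurable_fun_sum _ fun i _ =>
        hm.comp_aemeasurable (hX.law i).aemeasurable) _) h1
  rw [EMetric.tendsto_nhds]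
  intro ε hε
  rw [eventually_withHighProb]
  refine (h2 ε hε).congr fun n => ?_
  simp only [empMean_obs, not_lt]

/-- For `|t| ≤ 1` and `Y ∈ [0, 1]` one has `e^(tY) ≤ 1 + tY + t²Y` because `Y² ≤ Y`. The
second-order term thus involves the mean of `Y` instead of a range bound, which is decisive for rare
events near the endpoint. -/
lemma mgf_sum_le [IsProbabilityMeasure μ] (hX : IsIIDSample μ X P) {Y : ℝ → ℝ}
    (hm : Measurable Y) (hY : ∀ z, Y z ∈ Icc 0 1) (n : ℕ) {t : ℝ} (ht : |t| ≤ 1) :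
    Integrable (fun ω => Real.exp (t * ∑ i ∈ Finset.range n, Y (X i ω))) μ ∧
    mgf (fun ω => ∑ i ∈ Finset.range n, Y (X i ω)) μ t ≤
      Real.exp (n * (t * (∫ z, Y z ∂P) + t ^ 2 * ∫ z, Y z ∂P)) := by
  have hae : ∀ i, AEMeasurable (fun ω => Y (X i ω)) μ := fun i =>
    hm.comp_aemeasurable (hX.law i).aemeasurable
  have hP : IsProbabilityMeasure P := hX.isProbabilityMeasure
  have hintY : Integrable Y P :=
    Integrable.of_bound hm.aestronglyMeasurable 1 (ae_of_all _ fun z => by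
      rw [Real.norm_eq_abs, abs_of_nonneg (hY z).1]; exact (hY z).2)
  have hintE : Integrable (fun z => Real.exp (t * Y z)) P :=
    Integrable.of_bound (by fun_prop) (Real.exp 1) (ae_of_all _ fun z => by
      rw [Real.norm_eq_abs, Real.abs_exp]
      refine Real.exp_le_exp.2 ((le_abs_self _).trans ?_)
      rw [abs_mul, abs_of_nonneg (hY z).1]
      exact mul_le_one₀ ht (hY z).1 (hY z).2)
  have hindep : iIndepFun (fun i ω => Y (X i ω)) μ := hX.indep.comp _ fun _ => hm
  refine ⟨?_, ?_⟩
  · refine Integrable.of_bound (C := Real.exp n) ?_ (ae_of_all _ fun ω => ?_)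
    · exact (Real.measurable_exp.comp_aemeasurable
        ((Finset.aemeasurable_fun_sum _ fun i _ => hae i).const_mul t)).aestronglyMeasurable
    · rw [Real.norm_eq_abs, Real.abs_exp]
      refine Real.exp_le_exp.2 ((le_abs_self _).trans ?_)
      have h1 : 0 ≤ ∑ i ∈ Finset.range n, Y (X i ω) := Finset.sum_nonneg fun i _ => (hY _).1
      have h2 : ∑ i ∈ Finset.range n, Y (X i ω) ≤ ∑ i ∈ Finset.range n, 1 :=
        Finset.sum_le_sum fun i _ => (hY _).2
      rw [abs_mul, abs_of_nonneg h1]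
      simp only [Finset.sum_const, Finset.card_range, nsmul_eq_mul, mul_one] at h2
      nlinarith [abs_nonneg t]
  have hsum : (fun ω => ∑ i ∈ Finset.range n, Y (X i ω)) =
      ∑ i ∈ Finset.range n, fun ω => Y (X i ω) := by ext ω; simp
  rw [hsum, hindep.mgf_sum₀ hae]
  have hone : ∀ i, mgf (fun ω => Y (X i ω)) μ t ≤
      Real.exp (t * (∫ z, Y z ∂P) + t ^ 2 * ∫ z, Y z ∂P) := by
    intro i
    have h1 : mgf (fun ω => Y (X i ω)) μ t = ∫ z, Real.exp (t * Y z) ∂P :=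
      (hX.law i).integral_comp (f := fun z => Real.exp (t * Y z)) hintE.aestronglyMeasurable
    rw [h1]
    calc ∫ z, Real.exp (t * Y z) ∂P ≤ ∫ z, (1 + (t + t ^ 2) * Y z) ∂P := by
          refine integral_mono hintE ((integrable_const _).add (hintY.const_mul _)) fun z => ?_
          have hb : |t * Y z| ≤ 1 := by
            rw [abs_mul, abs_of_nonneg (hY z).1]
            exact mul_le_one₀ ht (hY z).1 (hY z).2
          have h2 := (abs_le.1 (Real.abs_exp_sub_one_sub_id_le hb)).2
          have h3 : Y z ^ 2 ≤ Y z := by nlinarith [(hY z).1, (hY z).2]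
          have h4 : (t * Y z) ^ 2 ≤ t ^ 2 * Y z := by
            rw [mul_pow]; exact mul_le_mul_of_nonneg_left h3 (sq_nonneg _)
          simp only
          linarith
      _ = (t * (∫ z, Y z ∂P) + t ^ 2 * ∫ z, Y z ∂P) + 1 := by
          rw [integral_add (integrable_const _) (hintY.const_mul _), integral_const_mul]
          simp
          ring
      _ ≤ _ := Real.add_one_le_exp _
  calc ∏ i ∈ Finset.range n, mgf (fun ω => Y (X i ω)) μ t
      ≤ ∏ i ∈ Finset.range n, Real.exp (t * (∫ z, Y z ∂P) + t ^ 2 * ∫ z, Y z ∂P) :=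
        Finset.prod_le_prod (fun i _ => mgf_nonneg) fun i _ => hone i
    _ = _ := by rw [Finset.prod_const, Finset.card_range, ← Real.exp_nat_mul]

/-- A Bernstein type inequality for the means of random variables in `[0, 1]`. -/
lemma measure_abs_sub_ge_le [IsProbabilityMeasure μ] (hX : IsIIDSample μ X P) {Y : ℝ → ℝ}
    (hm : Measurable Y) (hY : ∀ z, Y z ∈ Icc 0 1) {n : ℕ} (hn : n ≠ 0) {σ t : ℝ} (hσ : 0 < σ)
    (hYσ : ∫ z, Y z ∂P ≤ σ) (ht : 0 ≤ t) (htσ : t ≤ 2 * σ) :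
    μ {ω | t ≤ |empMean (obs X (n, ω)) Y - ∫ z, Y z ∂P|} ≤
      ENNReal.ofReal (2 * Real.exp (-(n * t ^ 2 / (4 * σ)))) := by
  set m := ∫ z, Y z ∂P with hmdef
  have hn' : (0 : ℝ) < n := by exact_mod_cast Nat.pos_of_ne_zero hn
  -- This minimises `l² σ - l t`, with value `-t² / (4σ)`. The assumption `t ≤ 2σ` ensures `l ≤ 1`.
  set l : ℝ := t / (2 * σ) with hl
  have hl0 : 0 ≤ l := by positivity
  have hl1 : l ≤ 1 := (div_le_one (by positivity)).2 htσ
  have hexp : n * (l ^ 2 * m) - n * (l * t) ≤ -(n * t ^ 2 / (4 * σ)) := by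
    have h1 : n * (l ^ 2 * m) ≤ n * (l ^ 2 * σ) :=
      mul_le_mul_of_nonneg_left (mul_le_mul_of_nonneg_left hYσ (sq_nonneg _)) hn'.le
    have h2 : n * (l ^ 2 * σ) - n * (l * t) = -(n * t ^ 2 / (4 * σ)) := by
      rw [hl]; field_simp; ring
    linarith
  obtain ⟨i1, b1⟩ := hX.mgf_sum_le hm hY n (t := l) (by rw [abs_of_nonneg hl0]; exact hl1)
  obtain ⟨i2, b2⟩ := hX.mgf_sum_le hm hY n (t := -l) (by rw [abs_neg, abs_of_nonneg hl0]; exact hl1)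
  have u1 := (measure_ge_le_exp_mul_mgf (n * (m + t)) hl0 i1).trans
    (mul_le_mul_of_nonneg_left b1 (Real.exp_pos _).le)
  have u2 := (measure_le_le_exp_mul_mgf (n * (m - t)) (neg_nonpos.2 hl0) i2).trans
    (mul_le_mul_of_nonneg_left b2 (Real.exp_pos _).le)
  rw [← Real.exp_add] at u1 u2
  have v1 := u1.trans (Real.exp_le_exp.2 ((le_of_eq (by ring)).trans hexp))
  have v2 := u2.trans (Real.exp_le_exp.2 ((le_of_eq (by ring)).trans hexp))
  have hsub : {ω | t ≤ |empMean (obs X (n, ω)) Y - m|} ⊆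
      {ω | n * (m + t) ≤ ∑ i ∈ Finset.range n, Y (X i ω)} ∪
        {ω | ∑ i ∈ Finset.range n, Y (X i ω) ≤ n * (m - t)} := by
    intro ω hω
    simp only [mem_ofPred_eq, empMean_obs] at hω
    rcases le_abs.1 hω with h | h
    · left
      have : m + t ≤ (∑ i ∈ Finset.range n, Y (X i ω)) / n := by linarith
      rw [le_div_iff₀ hn'] at this
      simp only [mem_ofPred_eq]; linarith
    · right
      have : (∑ i ∈ Finset.range n, Y (X i ω)) / n ≤ m - t := by linarith
      rw [div_le_iff₀ hn'] at this
      simp only [mem_ofPred_eq]; linarith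
  rw [← ofReal_measureReal]
  refine ENNReal.ofReal_le_ofReal ?_
  have := (measureReal_mono hsub (by finiteness)).trans (measureReal_union_le (μ := μ) _ _)
  linarith

/-- Functions with common bounds are, up to `ε / 4`, step functions on a fixed finite partition, so
the law of large numbers for finitely many cells suffices. The bound holds simultaneously for all
`u`, hence also for data-dependent ones. -/
lemma eventually_empMean_uniform [IsProbabilityMeasure μ] (hX : IsIIDSample μ X P) {c d L B ε : ℝ}
    (hcd : c < d) (hL : 0 ≤ L) (hB : 0 ≤ B) (hε : 0 < ε) :
    ∀ᶠ p in withHighProb μ, ∀ u : ℝ → ℝ,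
      (∀ y ∈ Icc c d, ∀ z ∈ Icc c d, |u y - u z| ≤ L * |y - z|) → (∀ z ∈ Icc c d, |u z| ≤ B) →
      |empMean (obs X p) ((Icc c d).indicator u) - ∫ z in Icc c d, u z ∂P| ≤ ε := by
  have hP : IsProbabilityMeasure P := hX.isProbabilityMeasure
  obtain ⟨N, hN⟩ := exists_nat_gt (4 * (L * (d - c)) / ε + 1)
  have hcd' : 0 < d - c := sub_pos.2 hcd
  have hNpos : (0 : ℝ) < N := lt_trans (by positivity) hN
  have hη : L * ((d - c) / N) ≤ ε / 4 := by
    have : 4 * (L * (d - c)) / ε ≤ N := by linarith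
    rw [div_le_iff₀ hε] at this
    rw [← mul_div_assoc, div_le_iff₀ hNpos]
    linarith
  set k : ℝ → ℕ := fun z => ⌊(z - c) / ((d - c) / N)⌋₊ with hk
  set T : ℕ → ℝ := fun j => c + j * ((d - c) / N) with hT
  set C : ℕ → Set ℝ := fun j => Icc c d ∩ k ⁻¹' {j} with hC
  have hw : 0 < (d - c) / N := by positivity
  have hkmeas : Measurable k := Nat.measurable_floor.comp (by fun_prop)
  have hCmeas : ∀ j, MeasurableSet (C j) := fun j =>
    measurableSet_Icc.inter (hkmeas (measurableSet_singleton j))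
  have hTle : ∀ z ∈ Icc c d, T (k z) ≤ z ∧ z - T (k z) ≤ (d - c) / N := by
    intro z hz
    have h1 := Nat.floor_le (div_nonneg (sub_nonneg.2 hz.1) hw.le)
    have h2 := Nat.lt_floor_add_one ((z - c) / ((d - c) / N))
    rw [le_div_iff₀ hw] at h1
    rw [div_lt_iff₀ hw] at h2
    simp only [hT, hk]
    constructor <;> linarith
  have hTmem : ∀ z ∈ Icc c d, T (k z) ∈ Icc c d := fun z hz =>
    ⟨by simp only [hT]; nlinarith [Nat.cast_nonneg (α := ℝ) (k z)], (hTle z hz).1.trans hz.2⟩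
  -- The right endpoint `d` gets the index `N`, hence `N + 1` cells.
  have hkN : ∀ z ∈ Icc c d, k z ∈ Finset.range (N + 1) := by
    intro z hz
    rw [Finset.mem_range, Nat.lt_succ_iff]
    have h1 := (hTmem z hz).2
    simp only [hT] at h1
    have h2 : (k z : ℝ) * ((d - c) / N) ≤ N * ((d - c) / N) := by
      rw [mul_div_cancel₀ _ hNpos.ne']; linarith
    exact_mod_cast le_of_mul_le_mul_right h2 hw
  have hcells : ∀ᶠ p in withHighProb μ, ∀ j ∈ Finset.range (N + 1),
      |empMean (obs X p) ((C j).indicator 1) - P.real (C j)| ≤ ε / (4 * (N + 1) * (B + 1)) := by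
    rw [Finset.eventually_all]
    intro j _
    have h := hX.tendsto_empMean (h := (C j).indicator 1) (measurable_one.indicator (hCmeas j))
      ((integrable_const (1 : ℝ)).indicator (hCmeas j))
    rw [integral_indicator_one (hCmeas j)] at h
    have h2 := (Metric.tendsto_nhds.1 h) (ε / (4 * (N + 1) * (B + 1))) (by positivity)
    filter_upwards [h2] with p hp
    exact hp.le
  filter_upwards [hcells] with p hp u hu huB
  set s : ℝ → ℝ := fun z => ∑ j ∈ Finset.range (N + 1), u (T j) * (C j).indicator 1 z with hs
  have hclose : ∀ z, |(Icc c d).indicator u z - s z| ≤ ε / 4 := by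
    intro z
    by_cases hz : z ∈ Icc c d
    · have : s z = u (T (k z)) := by
        rw [hs]
        simp only
        rw [Finset.sum_eq_single_of_mem (k z) (hkN z hz)]
        · rw [indicator_of_mem (show z ∈ C (k z) from ⟨hz, rfl⟩)]; simp
        · intro j _ hj
          rw [indicator_of_notMem (fun h : z ∈ C j => hj h.2.symm), mul_zero]
      rw [this, indicator_of_mem hz]
      refine (hu z hz _ (hTmem z hz)).trans (le_trans (mul_le_mul_of_nonneg_left ?_ hL) hη)
      rw [abs_of_nonneg (sub_nonneg.2 (hTle z hz).1)]
      exact (hTle z hz).2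
    · have : s z = 0 := by
        rw [hs]
        exact Finset.sum_eq_zero fun j _ => by
          rw [indicator_of_notMem (fun h : z ∈ C j => hz h.1), mul_zero]
      rw [this, indicator_of_notMem hz, sub_zero, abs_zero]
      positivity
  have hucont : ContinuousOn u (Icc c d) := by
    refine LipschitzOnWith.continuousOn (K := L.toNNReal)
      (LipschitzOnWith.of_dist_le_mul fun y hy z hz => ?_)
    rw [Real.coe_toNNReal _ hL, Real.dist_eq, Real.dist_eq]
    exact hu y hy z hz
  have hintu : Integrable ((Icc c d).indicator u) P :=
    (integrable_indicator_iff measurableSet_Icc).2 (hucont.integrableOn_compact isCompact_Icc)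
  have hints : ∀ j ∈ Finset.range (N + 1),
      Integrable (fun z => u (T j) * (C j).indicator (1 : ℝ → ℝ) z) P := fun j _ =>
    ((integrable_const (1 : ℝ)).indicator (hCmeas j)).const_mul _
  have hints' : Integrable s P := integrable_finsetSum _ hints
  have e1 : |empMean (obs X p) ((Icc c d).indicator u) - empMean (obs X p) s| ≤ ε / 4 := by
    rw [← empMean_sub]
    rcases Nat.eq_zero_or_pos p.1 with h0 | h0
    · have : empMean (obs X p) (fun z => (Icc c d).indicator u z - s z) = 0 := by
        simp [empMean, h0]
      rw [this, abs_zero]; positivity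
    · have hc : ∀ c : ℝ, empMean (obs X p) (fun _ => c) = c := empMean_const h0.ne' _
      rw [abs_le]
      constructor
      · rw [← hc (-(ε / 4))]
        exact empMean_mono fun i => (abs_le.1 (hclose _)).1
      · exact (empMean_mono fun i => (abs_le.1 (hclose _)).2).trans (hc (ε / 4)).le
  have e2 : |(∫ z in Icc c d, u z ∂P) - ∫ z, s z ∂P| ≤ ε / 4 := by
    rw [← integral_indicator measurableSet_Icc, ← integral_sub hintu hints', ← Real.norm_eq_abs]
    have := norm_integral_le_of_norm_le_const (μ := P) (C := ε / 4)
      (f := fun z => (Icc c d).indicator u z - s z) (ae_of_all _ hclose)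
    simpa using this
  have e3 : |empMean (obs X p) s - ∫ z, s z ∂P| ≤ ε / 4 := by
    have h1 : empMean (obs X p) s =
        ∑ j ∈ Finset.range (N + 1), u (T j) * empMean (obs X p) ((C j).indicator 1) := by
      simp only [empMean, hs]
      rw [Finset.sum_comm, Finset.sum_div]
      refine Finset.sum_congr rfl fun j _ => ?_
      rw [← Finset.mul_sum, mul_div_assoc]
    have h2 : ∫ z, s z ∂P = ∑ j ∈ Finset.range (N + 1), u (T j) * P.real (C j) := by
      rw [hs, integral_finsetSum _ hints]
      refine Finset.sum_congr rfl fun j _ => ?_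
      rw [integral_const_mul, integral_indicator_one (hCmeas j)]
    rw [h1, h2, ← Finset.sum_sub_distrib]
    refine (Finset.abs_sum_le_sum_abs _ _).trans ?_
    calc _ ≤ ∑ j ∈ Finset.range (N + 1), B * (ε / (4 * (N + 1) * (B + 1))) := by
          refine Finset.sum_le_sum fun j hj => ?_
          rw [← mul_sub, abs_mul]
          by_cases hj' : T j ∈ Icc c d
          · exact mul_le_mul (huB _ hj') (hp j hj) (abs_nonneg _) hB
          · have hemp : C j = ∅ := by
              refine eq_empty_of_forall_notMem fun z hz => hj' ?_
              have := hTmem z hz.1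
              rwa [show k z = j from hz.2] at this
            simp only [hemp, indicator_empty, measureReal_empty, sub_zero]
            have : empMean (obs X p) (fun _ => (0 : ℝ)) = 0 := by simp [empMean]
            rw [this, abs_zero, mul_zero]
            positivity
      _ = B / (B + 1) * (ε / 4) := by
          rw [Finset.sum_const, Finset.card_range, nsmul_eq_mul]
          push_cast
          field_simp
      _ ≤ ε / 4 := mul_le_of_le_one_left (by positivity)
          ((div_le_one (by positivity)).2 (by linarith))
  rw [abs_le] at e1 e2 e3 ⊢
  constructor <;> linarith [e1.1, e1.2, e2.1, e2.2, e3.1, e3.2]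

end IsIIDSample
end

/-! ### The true distribution: support, quantiles, boundedness and entropy -/

section
open Set

/-- The standing assumptions on the true log-density. -/
structure IsLogConcaveModel (φ : ℝ → EReal) (aₒ : EReal) (bₒ : ℝ) : Prop where
  isLogDensity : IsLogDensity φ
  usc : UpperSemicontinuous φ
  support : ∀ x : ℝ, (0 < cdf (distOf φ) x ∧ cdf (distOf φ) x < 1) ↔ (aₒ < (x : EReal) ∧ x < bₒ)

namespace IsLogConcaveModel

variable {φ : ℝ → EReal} {aₒ : EReal} {bₒ : ℝ}

lemma measurable (h : IsLogConcaveModel φ aₒ bₒ) : Measurable φ := h.usc.measurable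

lemma measurable_toReal (h : IsLogConcaveModel φ aₒ bₒ) : Measurable fun z => (φ z).toReal :=
  measurable_ereal_toReal.comp h.measurable

lemma measurable_expFn (h : IsLogConcaveModel φ aₒ bₒ) : Measurable (expFn φ) :=
  EReal.exp_monotone.measurable.comp h.measurable

lemma expFn_lt_top (h : IsLogConcaveModel φ aₒ bₒ) (z : ℝ) : expFn φ z < ⊤ :=
  EReal.exp_lt_top_iff.2 (h.isLogDensity.1.1 z)

lemma expFn_toReal (h : IsLogConcaveModel φ aₒ bₒ) {z : ℝ} (hz : φ z ≠ ⊥) :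
    (expFn φ z).toReal = Real.exp (φ z).toReal := by
  rw [expFn, ← h.isLogDensity.1.coe_toReal hz, EReal.exp_coe,
    ENNReal.toReal_ofReal (Real.exp_pos _).le, EReal.toReal_coe]

lemma isProbabilityMeasure (h : IsLogConcaveModel φ aₒ bₒ) : IsProbabilityMeasure (distOf φ) :=
  ⟨by rw [distOf, withDensity_apply _ MeasurableSet.univ, Measure.restrict_univ]
      exact h.isLogDensity.2⟩

lemma integrable_expFn (h : IsLogConcaveModel φ aₒ bₒ) :
    Integrable fun z => (expFn φ z).toReal :=
  integrable_toReal_of_lintegral_ne_top h.measurable_expFn.aemeasurable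
    (by rw [h.isLogDensity.2]; exact ENNReal.one_ne_top)

lemma setIntegral_distOf (h : IsLogConcaveModel φ aₒ bₒ) {S : Set ℝ} (hS : MeasurableSet S)
    (hb : ∀ z ∈ S, φ z ≠ ⊥) (u : ℝ → ℝ) :
    ∫ z in S, u z ∂(distOf φ) = ∫ z in S, u z * Real.exp (φ z).toReal := by
  rw [distOf, setIntegral_withDensity_eq_setIntegral_toReal_smul h.measurable_expFn
    (ae_of_all _ fun z => h.expFn_lt_top z) _ hS]
  refine setIntegral_congr_fun hS fun z hz => ?_
  simp only [smul_eq_mul, h.expFn_toReal (hb z hz), mul_comm]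

lemma nullSingletonClass_distOf (φ : ℝ → EReal) : NullSingletonClass (distOf φ) := by
  unfold distOf; infer_instance

lemma cdf_eq (h : IsLogConcaveModel φ aₒ bₒ) (x : ℝ) :
    cdf (distOf φ) x = (distOf φ).real (Iic x) := by
  have := h.isProbabilityMeasure
  exact cdf_eq_real _ _

lemma one_sub_cdf_eq (h : IsLogConcaveModel φ aₒ bₒ) (x : ℝ) :
    1 - cdf (distOf φ) x = (distOf φ).real (Ioi x) := by
  have := h.isProbabilityMeasure
  rw [h.cdf_eq, ← probReal_compl_eq_one_sub measurableSet_Iic, compl_Iic]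

lemma real_Ici (h : IsLogConcaveModel φ aₒ bₒ) (x : ℝ) :
    (distOf φ).real (Ici x) = 1 - cdf (distOf φ) x := by
  have := nullSingletonClass_distOf φ
  rw [h.one_sub_cdf_eq, measureReal_def, measureReal_def, measure_congr Ioi_ae_eq_Ici]

lemma real_Iio (h : IsLogConcaveModel φ aₒ bₒ) (x : ℝ) :
    (distOf φ).real (Iio x) = cdf (distOf φ) x := by
  have := nullSingletonClass_distOf φ
  rw [h.cdf_eq, measureReal_def, measureReal_def, measure_congr Iio_ae_eq_Iic]

/-- Both sides of `x` carry mass, so `φ` is finite somewhere on each side, and concavity gives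
finiteness in between. -/
lemma ne_bot (h : IsLogConcaveModel φ aₒ bₒ) {x : ℝ} (hax : aₒ < x) (hxb : x < bₒ) : φ x ≠ ⊥ := by
  have hP := h.isProbabilityMeasure
  obtain ⟨h0, h1⟩ := (h.support x).2 ⟨hax, hxb⟩
  have key : ∀ S : Set ℝ, MeasurableSet S → 0 < (distOf φ).real S → ∃ y ∈ S, φ y ≠ ⊥ := by
    intro S hS hpos
    by_contra! hc
    have : distOf φ S = 0 := by
      rw [distOf, withDensity_apply _ hS, setLIntegral_eq_zero_iff hS h.measurable_expFn]
      exact ae_of_all _ fun y hy => by simp [expFn, hc y hy]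
    rw [measureReal_def, this] at hpos
    simp at hpos
  rw [h.cdf_eq] at h0
  rw [← sub_pos, h.one_sub_cdf_eq] at h1
  obtain ⟨y, hy, hyb⟩ := key _ measurableSet_Iic h0
  obtain ⟨z, hz, hzb⟩ := key _ measurableSet_Ioi h1
  exact h.isLogDensity.1.ne_bot_of_mem_Icc hyb hzb ⟨hy, le_of_lt hz⟩

lemma continuous_cdf (h : IsLogConcaveModel φ aₒ bₒ) : Continuous (cdf (distOf φ)) := by
  have hP := h.isProbabilityMeasure
  have key : ∀ x, cdf (distOf φ) x = cdf (distOf φ) 0 + ∫ z in (0 : ℝ)..x, (expFn φ z).toReal := by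
    intro x
    have : ∀ y, cdf (distOf φ) y = ∫ z in Iic y, (expFn φ z).toReal := by
      intro y
      rw [h.cdf_eq, measureReal_def, distOf, withDensity_apply _ measurableSet_Iic]
      exact (integral_toReal h.measurable_expFn.aemeasurable
        (ae_of_all _ fun z => h.expFn_lt_top z)).symm
    rw [← intervalIntegral.integral_Iic_sub_Iic h.integrable_expFn.integrableOn
      h.integrable_expFn.integrableOn, this, this]
    ring
  have h1 : Continuous fun x => cdf (distOf φ) 0 + ∫ z in (0 : ℝ)..x, (expFn φ z).toReal :=
    continuous_const.add (h.integrable_expFn.continuous_primitive 0)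
  exact h1.congr fun x => (key x).symm

lemma exists_cdf_eq (h : IsLogConcaveModel φ aₒ bₒ) {η : ℝ} (h0 : 0 < η) (h1 : η < 1) :
    ∃ c : ℝ, aₒ < c ∧ c < bₒ ∧ cdf (distOf φ) c = η := by
  obtain ⟨c, hc⟩ := mem_range_of_exists_le_of_exists_ge h.continuous_cdf
    ((tendsto_cdf_atBot (distOf φ)).eventually (ge_mem_nhds h0)).exists
    ((tendsto_cdf_atTop (distOf φ)).eventually (le_mem_nhds h1)).exists
  obtain ⟨h2, h3⟩ := (h.support c).1 (by rw [hc]; exact ⟨h0, h1⟩)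
  exact ⟨c, h2, h3, hc⟩

lemma exists_lt (h : IsLogConcaveModel φ aₒ bₒ) {c : ℝ} (hac : aₒ < c) (hcb : c < bₒ) :
    ∃ c' : ℝ, aₒ < c' ∧ c' < c := by
  obtain ⟨h0, h1⟩ := (h.support c).2 ⟨hac, hcb⟩
  obtain ⟨c', h2, h3, h4⟩ := h.exists_cdf_eq (half_pos h0) (by linarith)
  exact ⟨c', h2, (monotone_cdf (distOf φ)).reflect_lt (by rw [h4]; linarith)⟩

lemma cdf_right_end (h : IsLogConcaveModel φ aₒ bₒ) : cdf (distOf φ) bₒ = 1 := by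
  obtain ⟨c, hac, hcb, hc⟩ := h.exists_cdf_eq (η := 1 / 2) (by norm_num) (by norm_num)
  by_contra hne
  have h1 := (cdf_le_one (distOf φ) bₒ).lt_of_ne hne
  have h2 : cdf (distOf φ) c ≤ cdf (distOf φ) bₒ := monotone_cdf _ hcb.le
  have := ((h.support bₒ).1 ⟨by linarith, h1⟩).2
  exact lt_irrefl _ this

lemma distOf_bot (h : IsLogConcaveModel φ aₒ bₒ) :
    distOf φ {z | φ z ≠ ⊥ ∧ z ≤ bₒ}ᶜ = 0 := by
  have hP := h.isProbabilityMeasure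
  have h1 : distOf φ {z | φ z = ⊥} = 0 := by
    have hm : MeasurableSet {z | φ z = ⊥} := h.measurable (measurableSet_singleton ⊥)
    rw [distOf, withDensity_apply _ hm, setLIntegral_eq_zero_iff hm h.measurable_expFn]
    exact ae_of_all _ fun y hy => by simp [expFn, show φ y = ⊥ from hy]
  have h2 : distOf φ (Ioi bₒ) = 0 := by
    have := h.one_sub_cdf_eq bₒ
    rw [h.cdf_right_end, sub_self, eq_comm, measureReal_eq_zero_iff] at this
    exact this
  refine measure_mono_null (fun z hz => ?_) (measure_union_null h1 h2)
  by_cases hb : φ z = ⊥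
  · exact Or.inl hb
  · refine Or.inr (not_le.1 fun hle => hz ⟨hb, hle⟩)

/-- Any `z` is at distance at least `(q - p) / 2` from one of two fixed quantiles `p` and `q`. On
the half of the connecting segment next to `z`, `φ` is at least the average of the two end values,
and total mass one bounds this average. -/
lemma exists_le (h : IsLogConcaveModel φ aₒ bₒ) : ∃ M : ℝ, ∀ z, φ z ≠ ⊥ → (φ z).toReal ≤ M := by
  obtain ⟨p, hap, hpb, hp⟩ := h.exists_cdf_eq (η := 1 / 3) (by norm_num) (by norm_num)
  obtain ⟨q, haq, hqb, hq⟩ := h.exists_cdf_eq (η := 2 / 3) (by norm_num) (by norm_num)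
  have hpq : p < q := (monotone_cdf (distOf φ)).reflect_lt (by rw [hp, hq]; norm_num)
  set r : ℝ → ℝ := fun z => (φ z).toReal with hr
  have key : ∀ y z, φ y ≠ ⊥ → φ z ≠ ⊥ → (q - p) / 2 ≤ |z - y| → r y ≤ r z →
      (q - p) / 4 * Real.exp ((r y + r z) / 2) ≤ 1 := by
    intro y z hy hz hd hyz
    have hne : ∀ w ∈ Icc (min y z) (max y z), φ w ≠ ⊥ := by
      intro w hw
      refine h.isLogDensity.1.ne_bot_of_mem_Icc ?_ ?_ hw
      · rcases min_choice y z with e | e <;> rw [e] <;> assumption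
      · rcases max_choice y z with e | e <;> rw [e] <;> assumption
    have hc := h.isLogDensity.1.concaveOn_toReal (convex_Icc (min y z) (max y z)) hne
    have hym : y ∈ Icc (min y z) (max y z) := ⟨min_le_left _ _, le_max_left _ _⟩
    have hzm : z ∈ Icc (min y z) (max y z) := ⟨min_le_right _ _, le_max_right _ _⟩
    have hmm := hc.1 hym hzm (by norm_num : (0 : ℝ) ≤ 1 / 2) (by norm_num : (0 : ℝ) ≤ 1 / 2)
      (by norm_num)
    have hmid := hc.2 hym hzm (by norm_num : (0 : ℝ) ≤ 1 / 2) (by norm_num : (0 : ℝ) ≤ 1 / 2)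
      (by norm_num)
    simp only [smul_eq_mul] at hmm hmid
    have := (hc.mul_exp_le_setIntegral (c := (r y + r z) / 2) hmm hzm (by simp only [hr]; linarith)
      (by simp only [hr] at hyz ⊢; linarith)).trans (h.isLogDensity.setIntegral_exp_le hne)
    refine le_trans (mul_le_mul_of_nonneg_right ?_ (Real.exp_pos _).le) this
    have e : z - (1 / 2 * y + 1 / 2 * z) = (z - y) / 2 := by ring
    rw [e, abs_div, abs_two]
    linarith
  refine ⟨max (max (r p) (r q)) (2 * Real.log (4 / (q - p)) - min (r p) (r q)), fun z hz => ?_⟩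
  have hqp : 0 < q - p := sub_pos.2 hpq
  have fin : ∀ y, φ y ≠ ⊥ → (q - p) / 2 ≤ |z - y| → min (r p) (r q) ≤ r y → r y ≤ r z →
      r z ≤ 2 * Real.log (4 / (q - p)) - min (r p) (r q) := by
    intro y hy hd hm hyz
    have h1 := key y z hy hz hd hyz
    have h2 : Real.exp ((r y + r z) / 2) ≤ 4 / (q - p) := by
      rw [le_div_iff₀ hqp]; linarith
    have h3 := (Real.le_log_iff_exp_le (by positivity)).2 h2
    linarith
  by_cases hz1 : r p ≤ r z
  swap
  · exact (le_of_not_ge hz1).trans ((le_max_left _ _).trans (le_max_left _ _))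
  by_cases hz2 : r q ≤ r z
  swap
  · exact (le_of_not_ge hz2).trans ((le_max_right _ _).trans (le_max_left _ _))
  refine le_trans ?_ (le_max_right _ _)
  rcases le_total ((p + q) / 2) z with hz' | hz'
  · exact fin p (h.ne_bot hap hpb) (by rw [abs_of_nonneg] <;> linarith) (min_le_left _ _) hz1
  · exact fin q (h.ne_bot haq hqb) (by rw [abs_of_nonpos] <;> linarith) (min_le_right _ _) hz2

/-- Write `|t| e^t = (|t| e^(t/2)) e^(t/2)`. The first factor is bounded because `φ` is bounded
above, and by concavity `e^(φ(z)/2)` is at most a constant times the density at the midpoint of `z`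
and `p`, which is integrable in `z`. -/
lemma integrable_toReal (h : IsLogConcaveModel φ aₒ bₒ) :
    Integrable (fun z => (φ z).toReal) (distOf φ) := by
  rw [distOf, integrable_withDensity_iff h.measurable_expFn (ae_of_all _ fun z => h.expFn_lt_top z)]
  obtain ⟨p, hap, hpb, hp⟩ := h.exists_cdf_eq (η := 1 / 3) (by norm_num) (by norm_num)
  obtain ⟨M, hM⟩ := h.exists_le
  have hφp := h.ne_bot hap hpb
  set C : ℝ := (|M| * Real.exp (|M| / 2) + 2) * Real.exp (-(φ p).toReal / 2) with hC
  have hdom : Integrable fun z => C * (expFn φ ((z + p) / 2)).toReal := by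
    have := ((h.integrable_expFn.comp_div (R := 2) two_ne_zero).comp_add_right p).const_mul C
    exact this
  refine hdom.mono' (h.measurable_toReal.mul h.measurable_expFn.ennreal_toReal).aestronglyMeasurable
    (ae_of_all _ fun z => ?_)
  by_cases hz : φ z = ⊥
  · simp only [hz, expFn, EReal.exp_bot, EReal.toReal_bot, zero_mul, norm_zero]
    positivity
  have hmem : φ ((z + p) / 2) ≠ ⊥ := by
    rcases le_total z p with hzp | hzp
    · exact h.isLogDensity.1.ne_bot_of_mem_Icc hz hφp ⟨by linarith, by linarith⟩
    · exact h.isLogDensity.1.ne_bot_of_mem_Icc hφp hz ⟨by linarith, by linarith⟩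
  rw [h.expFn_toReal hz, h.expFn_toReal hmem]
  have hmid : ((φ z).toReal + (φ p).toReal) / 2 ≤ (φ ((z + p) / 2)).toReal := by
    have := h.isLogDensity.1.2 z p (1 / 2) (1 / 2) (by norm_num) (by norm_num) (by norm_num)
    have e : 1 / 2 * z + 1 / 2 * p = (z + p) / 2 := by ring
    rw [e, ← h.isLogDensity.1.coe_toReal hz, ← h.isLogDensity.1.coe_toReal hφp,
      ← h.isLogDensity.1.coe_toReal hmem] at this
    have h2 : 1 / 2 * (φ z).toReal + 1 / 2 * (φ p).toReal ≤ (φ ((z + p) / 2)).toReal := by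
      exact_mod_cast this
    linarith
  set t := (φ z).toReal with ht
  have htM : t ≤ M := hM z hz
  have h1 : |t| * Real.exp (t / 2) ≤ |M| * Real.exp (|M| / 2) + 2 := by
    rcases le_total 0 t with h0 | h0
    · have h2 : |t| ≤ |M| := abs_le_abs_of_nonneg h0 htM
      have h3 : Real.exp (t / 2) ≤ Real.exp (|M| / 2) :=
        Real.exp_le_exp.2 (by linarith [le_abs_self t])
      have := mul_le_mul h2 h3 (Real.exp_pos _).le (abs_nonneg _)
      linarith
    · rw [abs_of_nonpos h0]
      have h2 := Real.add_one_le_exp (-t / 2)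
      have h3 : Real.exp (-t / 2) * Real.exp (t / 2) = 1 := by
        rw [← Real.exp_add]; simp; ring
      have h4 : 0 < Real.exp (t / 2) := Real.exp_pos _
      have : 0 ≤ |M| * Real.exp (|M| / 2) := by positivity
      nlinarith
  have hmul : Real.exp (t / 2) ≤
      Real.exp (-(φ p).toReal / 2) * Real.exp ((φ ((z + p) / 2)).toReal) := by
    rw [← Real.exp_add]
    exact Real.exp_le_exp.2 (by linarith)
  rw [Real.norm_eq_abs, abs_mul, Real.abs_exp]
  calc |t| * Real.exp t = (|t| * Real.exp (t / 2)) * Real.exp (t / 2) := by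
        rw [mul_assoc, ← Real.exp_add, add_halves]
    _ ≤ (|M| * Real.exp (|M| / 2) + 2) *
        (Real.exp (-(φ p).toReal / 2) * Real.exp ((φ ((z + p) / 2)).toReal)) :=
        mul_le_mul h1 hmul (Real.exp_pos _).le (by positivity)
    _ = _ := by rw [hC]; ring

end IsLogConcaveModel
end

/-! ### Uniform bounds and Lipschitz constants for the estimator -/

section
open Set

/-- By concavity `g ≤ g t` on at least one entire side of `t`. That side carries a fraction `θ` of
the data, so a very small `g t` would contradict the bound `L` on the mean. -/
lemma IsMLEOn.lower_bound {n : ℕ} {x : Fin n → ℝ} {a b : ℝ} {g : ℝ → ℝ} (h : IsMLEOn x a b g)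
    {M L θ t : ℝ} (hM : ∀ z ∈ Icc a b, g z ≤ M) (hL : L ≤ empMean x g) (hθ : 0 < θ)
    (h₁ : θ ≤ empMean x ((Iic t).indicator 1)) (h₂ : θ ≤ empMean x ((Ici t).indicator 1))
    (ht : t ∈ Icc a b) : M - (M - L) / θ ≤ g t := by
  have key : ∀ s : Set ℝ, θ ≤ empMean x (s.indicator 1) →
      (∀ z ∈ Icc a b, z ∈ s → g z ≤ g t) → M - (M - L) / θ ≤ g t := by
    intro s hs hle
    have h3 : empMean x g ≤ empMean x fun z => M - (M - g t) * s.indicator 1 z := by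
      refine empMean_mono fun i => ?_
      by_cases hi : x i ∈ s
      · simpa [indicator_of_mem hi] using hle _ (h.mem i) hi
      · simpa [indicator_of_notMem hi] using hM _ (h.mem i)
    rw [empMean_sub, empMean_const h.ne_zero, empMean_const_mul] at h3
    have h4 := mul_le_mul_of_nonneg_left hs (sub_nonneg.2 (hM t ht))
    have h5 : M - g t ≤ (M - L) / θ := by rw [le_div_iff₀ hθ]; linarith
    linarith
  by_cases hc : ∃ z ∈ Icc a b, z ∈ Iic t ∧ g t < g z
  swap
  · push Not at hc
    exact key _ h₁ hc
  obtain ⟨y, hy, hyt, hgy⟩ := hc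
  refine key _ h₂ fun z hz hzt => ?_
  by_contra! hgz
  have := h.concaveOn.min_le_of_mem_Icc hy hz (z := t) ⟨hyt, hzt⟩
  exact absurd this (not_le.2 (lt_min hgy hgz))

/-- Slopes inside are squeezed between those of chords reaching out to `c'` and `d'`, which have
length at least `δ` and height at most `2B`. -/
lemma ConcaveOn.abs_sub_le_of_abs_le {S : Set ℝ} {g : ℝ → ℝ} (h : ConcaveOn ℝ S g)
    {c' c d d' B δ : ℝ} (hc : c' ∈ S) (hd : d' ∈ S) (hδ : 0 < δ) (hcc : c' + δ ≤ c)
    (hdd : d + δ ≤ d') (hB : ∀ z ∈ Icc c' d', |g z| ≤ B) {y z : ℝ} (hy : y ∈ Icc c d)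
    (hz : z ∈ Icc c d) : |g y - g z| ≤ 2 * B / δ * |y - z| := by
  wlog hyz : y ≤ z generalizing y z
  · rw [abs_sub_comm, abs_sub_comm y]
    exact this hz hy (le_of_not_ge hyz)
  rcases hyz.eq_or_lt with rfl | hyz
  · simp
  have hcd' : c' ≤ d' := by linarith [hy.1, hy.2]
  have hmem : ∀ w ∈ Icc c d, w ∈ S := fun w hw =>
    h.1.ordConnected.out hc hd ⟨by linarith [hw.1], by linarith [hw.2]⟩
  have hB0 : 0 ≤ B := (abs_nonneg _).trans (hB c' ⟨le_rfl, hcd'⟩)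
  have bc := abs_le.1 (hB c' ⟨le_rfl, hcd'⟩)
  have bd := abs_le.1 (hB d' ⟨hcd', le_rfl⟩)
  have by' := abs_le.1 (hB y ⟨by linarith [hy.1], by linarith [hy.2]⟩)
  have bz := abs_le.1 (hB z ⟨by linarith [hz.1], by linarith [hz.2]⟩)
  have s1 := h.slope_anti_adjacent hc (hmem z hz) (show c' < y by linarith [hy.1]) hyz
  have s2 := h.slope_anti_adjacent (hmem y hy) hd hyz (show z < d' by linarith [hz.2])
  have hyz' : 0 < z - y := sub_pos.2 hyz
  have u1 : (g y - g c') / (y - c') ≤ 2 * B / δ := by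
    refine div_le_div₀ (by positivity) (by linarith) hδ (by linarith [hy.1])
  have u2 : -(2 * B / δ) ≤ (g d' - g z) / (d' - z) := by
    rw [neg_le, ← neg_div]
    refine div_le_div₀ (by positivity) (by linarith) hδ (by linarith [hz.2])
  have v1 := s1.trans u1
  have v2 := u2.trans s2
  rw [div_le_iff₀ hyz'] at v1
  rw [le_div_iff₀ hyz'] at v2
  rw [abs_sub_comm y z, abs_of_pos hyz', abs_le]
  constructor <;> linarith

/-- Quantifies the strict convexity that makes the Kullback–Leibler integral detect deviations. -/
lemma exists_exp_sub_one_sub_ge {s : ℝ} (hs : 0 < s) :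
    ∃ η > 0, ∀ u : ℝ, s ≤ |u| → η ≤ Real.exp u - 1 - u := by
  refine ⟨min (s ^ 2 / 2) (Real.exp (-s) - 1 + s), lt_min (by positivity) ?_, fun u hu => ?_⟩
  · have := Real.add_one_lt_exp (x := -s) (by linarith)
    linarith
  rcases le_abs.1 hu with h | h
  · have h1 := Real.quadratic_le_exp_of_nonneg (hs.le.trans h)
    refine (min_le_left _ _).trans ?_
    nlinarith
  · refine (min_le_right _ _).trans ?_
    have h1 : Real.exp (-s) * Real.exp (s + u) = Real.exp u := by rw [← Real.exp_add]; ring_nf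
    have h2 := Real.add_one_le_exp (s + u)
    have h3 : Real.exp (-s) ≤ 1 := Real.exp_le_one_iff.2 (by linarith)
    have h4 : 0 < Real.exp (-s) := Real.exp_pos _
    nlinarith

namespace IsLogConcaveModel

variable {φ : ℝ → EReal} {aₒ : EReal} {bₒ : ℝ} {Ω : Type*} [MeasurableSpace Ω] {μ : Measure Ω}
  [IsProbabilityMeasure μ] {X : ℕ → Ω → ℝ}

lemma eventually_empMean_Iic (h : IsLogConcaveModel φ aₒ bₒ) (hX : IsIIDSample μ X (distOf φ))
    {t : ℝ} (hat : aₒ < t) (htb : t < bₒ) :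
    ∀ᶠ p in withHighProb μ, cdf (distOf φ) t / 2 ≤ empMean (obs X p) ((Iic t).indicator 1) := by
  have hP := h.isProbabilityMeasure
  have h1 := hX.tendsto_empMean (h := (Iic t).indicator 1)
    (measurable_one.indicator measurableSet_Iic)
    ((integrable_const (1 : ℝ)).indicator measurableSet_Iic)
  rw [integral_indicator_one measurableSet_Iic, ← h.cdf_eq] at h1
  exact h1.eventually (le_mem_nhds (half_lt_self ((h.support t).2 ⟨hat, htb⟩).1))

lemma eventually_empMean_Ici (h : IsLogConcaveModel φ aₒ bₒ) (hX : IsIIDSample μ X (distOf φ))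
    {t : ℝ} (hat : aₒ < t) (htb : t < bₒ) :
    ∀ᶠ p in withHighProb μ,
      (1 - cdf (distOf φ) t) / 2 ≤ empMean (obs X p) ((Ici t).indicator 1) := by
  have hP := h.isProbabilityMeasure
  have h1 := hX.tendsto_empMean (h := (Ici t).indicator 1)
    (measurable_one.indicator measurableSet_Ici)
    ((integrable_const (1 : ℝ)).indicator measurableSet_Ici)
  rw [integral_indicator_one measurableSet_Ici, h.real_Ici] at h1
  exact h1.eventually (le_mem_nhds (half_lt_self (sub_pos.2 ((h.support t).2 ⟨hat, htb⟩).2)))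

lemma exists_mem_of_empMean_pos {n : ℕ} {x : Fin n → ℝ} {s : Set ℝ}
    (hs : 0 < empMean x (s.indicator 1)) : ∃ i, x i ∈ s := by
  by_contra! hc
  have : empMean x (s.indicator 1) = 0 := by simp [empMean, hc]
  exact hs.ne' this

/-- The estimator on the range `[a, b]` of the observations, with its basic properties. -/
structure GoodMLE (φ : ℝ → EReal) (bₒ : ℝ) {n : ℕ} (x : Fin n → ℝ) (M a b : ℝ) (g : ℝ → ℝ) :
    Prop where
  isConcaveFn : IsConcaveFn (logConcaveMLE x)
  coe_eq : ∀ z ∈ Icc a b, logConcaveMLE x z = g z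
  isMLEOn : IsMLEOn x a b g
  ne_bot : ∀ z ∈ Icc a b, φ z ≠ ⊥
  le_right : b ≤ bₒ
  le : ∀ z ∈ Icc a b, g z ≤ M
  empMean_le : empMean x (fun z => (φ z).toReal) ≤ empMean x g

/-- With high probability the estimator exists, and is bounded from above by a constant. -/
lemma exists_bound (h : IsLogConcaveModel φ aₒ bₒ) (hX : IsIIDSample μ X (distOf φ)) :
    ∃ M L : ℝ, 0 ≤ M ∧ (∀ᶠ p in withHighProb μ, L ≤ empMean (obs X p) fun z => (φ z).toReal) ∧
      ∀ c d : ℝ, aₒ < c → c < d → d < bₒ → ∀ᶠ p in withHighProb μ,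
        ∃ a b g, a ≤ c ∧ d ≤ b ∧ GoodMLE φ bₒ (obs X p) M a b g := by
  obtain ⟨p', hap', hpb', hp'⟩ := h.exists_cdf_eq (η := 1 / 3) (by norm_num) (by norm_num)
  obtain ⟨q', haq', hqb', hq'⟩ := h.exists_cdf_eq (η := 2 / 3) (by norm_num) (by norm_num)
  have hpq : p' < q' := (monotone_cdf (distOf φ)).reflect_lt (by rw [hp', hq']; norm_num)
  set L := (∫ z, (φ z).toReal ∂(distOf φ)) - 1
  obtain ⟨M, hM0, hM⟩ := exists_upper_bound (1 / 6) (q' - p') L (by norm_num) (sub_pos.2 hpq)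
  have hLev : ∀ᶠ p in withHighProb μ, L ≤ empMean (obs X p) fun z => (φ z).toReal :=
    (hX.tendsto_empMean h.measurable_toReal h.integrable_toReal).eventually
      (le_mem_nhds (sub_one_lt _))
  refine ⟨M, L, hM0, hLev, fun c d hac hcd hdb => ?_⟩
  have hmeas : MeasurableSet {z | φ z ≠ ⊥ ∧ z ≤ bₒ} :=
    (h.measurable (measurableSet_singleton ⊥).compl).inter measurableSet_Iic
  have hcb := hcd.trans hdb
  have had : aₒ < (d : EReal) := hac.trans (EReal.coe_lt_coe_iff.2 hcd)
  have hc0 := ((h.support c).2 ⟨hac, hcb⟩).1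
  have hd1 := ((h.support d).2 ⟨had, hdb⟩).2
  filter_upwards [hLev, hX.ae_mem hmeas h.distOf_bot, h.eventually_empMean_Iic hX hap' hpb',
    h.eventually_empMean_Ici hX haq' hqb', h.eventually_empMean_Iic hX hac hcb,
    h.eventually_empMean_Ici hX had hdb] with p hpL hmem h1 h2 h3 h4
  obtain ⟨i, hi⟩ := exists_mem_of_empMean_pos (lt_of_lt_of_le (by linarith) h3)
  obtain ⟨j, hj⟩ := exists_mem_of_empMean_pos (lt_of_lt_of_le (by linarith) h4)
  have hi : obs X p i ≤ c := hi
  have hj : d ≤ obs X p j := hj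
  obtain ⟨hconc, a, b, hai, hjb, hne, hmle⟩ := exists_isMLEOn (hi.trans_lt (hcd.trans_le hj))
  obtain ⟨ia, hia⟩ := hmle.exists_left
  obtain ⟨ib, hib⟩ := hmle.exists_right
  have hφne : ∀ z ∈ Icc a b, φ z ≠ ⊥ := fun z hz =>
    h.isLogDensity.1.ne_bot_of_mem_Icc (hia ▸ (hmem ia).1) (hib ▸ (hmem ib).1) hz
  have hφc := h.isLogDensity.1.concaveOn_toReal (convex_Icc a b) hφne
  have hle : empMean (obs X p) (fun z => (φ z).toReal) ≤
      empMean (obs X p) fun z => (logConcaveMLE (obs X p) z).toReal := by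
    have h5 := hmle.le _ hφc
    have h6 := Real.log_nonpos (hφc.setIntegral_exp_pos hmle.lt).le
      (h.isLogDensity.setIntegral_exp_le hφne)
    linarith
  refine ⟨a, b, _, hai.trans hi, hj.trans hjb, hconc,
    fun z hz => (hconc.coe_toReal (hne z hz)).symm, hmle, hφne, hib ▸ (hmem ib).2, ?_, hle⟩
  refine hM _ _ a b _ p' q' hmle.concaveOn hmle.setIntegral_exp.le hmle.mem (by linarith)
    ?_ ?_ (hpL.trans hle)
  · rw [hp'] at h1; linarith
  · rw [hq'] at h2; linarith

/-- With high probability the estimator is Lipschitz on compact subintervals of the support. -/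
lemma exists_lipschitz (h : IsLogConcaveModel φ aₒ bₒ) (hX : IsIIDSample μ X (distOf φ))
    {M L : ℝ} (hM0 : 0 ≤ M)
    (hLev : ∀ᶠ p in withHighProb μ, L ≤ empMean (obs X p) fun z => (φ z).toReal)
    {c d : ℝ} (hac : aₒ < c) (hcd : c < d) (hdb : d < bₒ) :
    ∃ Λ B c' d' : ℝ, 0 ≤ Λ ∧ 0 ≤ B ∧ aₒ < c' ∧ c' < c ∧ d < d' ∧ d' < bₒ ∧
      (∀ y ∈ Icc c d, ∀ z ∈ Icc c d, |(φ y).toReal - (φ z).toReal| ≤ Λ * |y - z|) ∧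
      (∀ z ∈ Icc c d, |(φ z).toReal| ≤ B) ∧
      ∀ᶠ p in withHighProb μ, ∀ a b g, a ≤ c' → d' ≤ b → GoodMLE φ bₒ (obs X p) M a b g →
        (∀ y ∈ Icc c d, ∀ z ∈ Icc c d, |g y - g z| ≤ Λ * |y - z|) ∧
        ∀ z ∈ Icc c d, |g z| ≤ B := by
  have hcb := hcd.trans hdb
  have had : aₒ < (d : EReal) := hac.trans (EReal.coe_lt_coe_iff.2 hcd)
  obtain ⟨c', hac', hcc'⟩ := h.exists_lt hac hcb
  obtain ⟨d', hdd', hdb'⟩ := exists_between hdb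
  have hcd' : c' < d' := hcc'.trans (hcd.trans hdd')
  have hcb' : c' < bₒ := hcd'.trans hdb'
  have had' : aₒ < (d' : EReal) := had.trans (EReal.coe_lt_coe_iff.2 hdd')
  set δ := min (c - c') (d' - d) with hδ
  have hδ0 : 0 < δ := lt_min (sub_pos.2 hcc') (sub_pos.2 hdd')
  have hδc : c' + δ ≤ c := by linarith [min_le_left (c - c') (d' - d)]
  have hδd : d + δ ≤ d' := by linarith [min_le_right (c - c') (d' - d)]
  have hφc := h.isLogDensity.1.concaveOn_toReal (convex_Icc c' d') fun z hz =>
    h.isLogDensity.1.ne_bot_of_mem_Icc (h.ne_bot hac' hcb') (h.ne_bot had' hdb') hz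
  obtain ⟨B₁, hB₁⟩ := hφc.exists_abs_le
  obtain ⟨hc0, hc1⟩ := (h.support c').2 ⟨hac', hcb'⟩
  obtain ⟨hd0, hd1⟩ := (h.support d').2 ⟨had', hdb'⟩
  set θ := min (min (cdf (distOf φ) c') (1 - cdf (distOf φ) c'))
    (min (cdf (distOf φ) d') (1 - cdf (distOf φ) d')) / 2 with hθ
  have hθ0 : 0 < θ := half_pos (lt_min (lt_min hc0 (sub_pos.2 hc1)) (lt_min hd0 (sub_pos.2 hd1)))
  have hθ1 : θ ≤ cdf (distOf φ) c' / 2 :=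
    div_le_div_of_nonneg_right ((min_le_left _ _).trans (min_le_left _ _)) zero_le_two
  have hθ2 : θ ≤ (1 - cdf (distOf φ) c') / 2 :=
    div_le_div_of_nonneg_right ((min_le_left _ _).trans (min_le_right _ _)) zero_le_two
  have hθ3 : θ ≤ cdf (distOf φ) d' / 2 :=
    div_le_div_of_nonneg_right ((min_le_right _ _).trans (min_le_left _ _)) zero_le_two
  have hθ4 : θ ≤ (1 - cdf (distOf φ) d') / 2 :=
    div_le_div_of_nonneg_right ((min_le_right _ _).trans (min_le_right _ _)) zero_le_two
  set B := max B₁ (max M (-(M - (M - L) / θ))) with hB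
  have hB0 : 0 ≤ B := hM0.trans ((le_max_left _ _).trans (le_max_right _ _))
  have hsub : ∀ z ∈ Icc c d, z ∈ Icc c' d' := fun z hz =>
    ⟨hcc'.le.trans hz.1, hz.2.trans hdd'.le⟩
  have hφB : ∀ z ∈ Icc c' d', |(φ z).toReal| ≤ B := fun z hz => (hB₁ z hz).trans (le_max_left _ _)
  refine ⟨2 * B / δ, B, c', d', by positivity, hB0, hac', hcc', hdd', hdb', fun y hy z hz =>
    hφc.abs_sub_le_of_abs_le ⟨le_rfl, hcd'.le⟩ ⟨hcd'.le, le_rfl⟩ hδ0 hδc hδd hφB hy hz,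
    fun z hz => hφB z (hsub z hz), ?_⟩
  filter_upwards [hLev, h.eventually_empMean_Iic hX hac' hcb',
    h.eventually_empMean_Ici hX hac' hcb',
    h.eventually_empMean_Iic hX had' hdb', h.eventually_empMean_Ici hX had' hdb'] with
    p hpL h1 h2 h3 h4 a b g hac hdb hg
  have hL := hpL.trans hg.empMean_le
  have hc'mem : c' ∈ Icc a b := ⟨hac, hcd'.le.trans hdb⟩
  have hd'mem : d' ∈ Icc a b := ⟨hac.trans hcd'.le, hdb⟩
  have l1 := hg.isMLEOn.lower_bound hg.le hL hθ0 (hθ1.trans h1) (hθ2.trans h2) hc'mem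
  have l2 := hg.isMLEOn.lower_bound hg.le hL hθ0 (hθ3.trans h3) (hθ4.trans h4) hd'mem
  have hgB : ∀ z ∈ Icc c' d', |g z| ≤ B := by
    intro z hz
    have h5 := hg.isMLEOn.concaveOn.min_le_of_mem_Icc hc'mem hd'mem hz
    have h6 := hg.le z ⟨hc'mem.1.trans hz.1, hz.2.trans hd'mem.2⟩
    have h7 := (le_min l1 l2).trans h5
    refine abs_le'.2 ⟨h6.trans ((le_max_left _ _).trans (le_max_right _ _)), ?_⟩
    exact (neg_le_neg h7).trans ((le_max_right _ _).trans (le_max_right _ _))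
  exact ⟨fun y hy z hz => hg.isMLEOn.concaveOn.abs_sub_le_of_abs_le hc'mem hd'mem hδ0 hδc hδd hgB
    hy hz, fun z hz => hgB z (hsub z hz)⟩

end IsLogConcaveModel
end

/-! ### Consistency in the interior of the support -/

section
open Set

lemma continuousOn_of_abs_sub_le {S : Set ℝ} {u : ℝ → ℝ} {Λ : ℝ} (hΛ : 0 ≤ Λ)
    (hu : ∀ y ∈ S, ∀ z ∈ S, |u y - u z| ≤ Λ * |y - z|) : ContinuousOn u S := by
  refine LipschitzOnWith.continuousOn (K := Λ.toNNReal)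
    (LipschitzOnWith.of_dist_le_mul fun y hy z hz => ?_)
  rw [Real.coe_toNNReal _ hΛ, Real.dist_eq, Real.dist_eq]
  exact hu y hy z hz

namespace IsLogConcaveModel

variable {φ : ℝ → EReal} {aₒ : EReal} {bₒ : ℝ}

/-- Use the quantiles at `1 / (k + 2)` and `1 - 1 / (k + 2)`: the outside mass tends to zero, and
integrability of `φ` handles the second integral. -/
lemma exists_Icc (h : IsLogConcaveModel φ aₒ bₒ) {c d M γ : ℝ} (hac : aₒ < c) (hcd : c < d)
    (hdb : d < bₒ) (hγ : 0 < γ) :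
    ∃ c' d' : ℝ, aₒ < c' ∧ c' < c ∧ d < d' ∧ d' < bₒ ∧
      (distOf φ).real (Icc c' d')ᶜ * (1 + M) < γ ∧
      |∫ z in (Icc c' d')ᶜ, (φ z).toReal ∂(distOf φ)| < γ := by
  have hP := h.isProbabilityMeasure
  have had : aₒ < (d : EReal) := hac.trans (EReal.coe_lt_coe_iff.2 hcd)
  have hc0 := ((h.support c).2 ⟨hac, hcd.trans hdb⟩).1
  have hd1 := ((h.support d).2 ⟨had, hdb⟩).2
  have hk : ∀ k : ℕ, (0 : ℝ) < 1 / (k + 2) ∧ (1 : ℝ) / (k + 2) < 1 := fun k => by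
    have : (0 : ℝ) ≤ k := k.cast_nonneg
    exact ⟨by positivity, by rw [div_lt_one] <;> linarith⟩
  choose C hC1 hC2 hC3 using fun k : ℕ => h.exists_cdf_eq (hk k).1 (hk k).2
  choose D hD1 hD2 hD3 using fun k : ℕ =>
    h.exists_cdf_eq (η := 1 - 1 / (k + 2 : ℝ)) (by linarith [(hk k).2]) (by linarith [(hk k).1])
  have hlim : Tendsto (fun k : ℕ => (1 : ℝ) / (k + 2)) atTop (𝓝 0) := by
    have := (tendsto_one_div_add_atTop_nhds_zero_nat (𝕜 := ℝ)).comp (tendsto_add_atTop_nat 1)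
    refine this.congr fun k => ?_
    simp only [Function.comp]
    push_cast
    ring
  have hout : ∀ k, (distOf φ).real (Icc (C k) (D k))ᶜ ≤ 2 * (1 / (k + 2 : ℝ)) := by
    intro k
    have hsub : (Icc (C k) (D k))ᶜ ⊆ Iio (C k) ∪ Ioi (D k) := by
      intro z hz
      simp only [mem_compl_iff, mem_Icc, not_and_or, not_le] at hz
      exact hz
    have h1 := (measureReal_mono (μ := distOf φ) hsub).trans (measureReal_union_le _ _)
    rw [h.real_Iio, ← h.one_sub_cdf_eq, hC3, hD3] at h1
    linarith
  have hlim2 : Tendsto (fun k => (distOf φ).real (Icc (C k) (D k))ᶜ) atTop (𝓝 0) := by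
    have := hlim.const_mul 2
    rw [mul_zero] at this
    exact squeeze_zero (fun _ => measureReal_nonneg) hout this
  have hlim3 : Tendsto (fun k => ∫ z in (Icc (C k) (D k))ᶜ, (φ z).toReal ∂(distOf φ)) atTop
      (𝓝 0) := by
    refine h.integrable_toReal.tendsto_setIntegral_nhds_zero ?_
    have := ENNReal.tendsto_ofReal hlim2
    simpa [Function.comp_def] using this
  have hlim4 := hlim2.mul_const (1 + M)
  rw [zero_mul] at hlim4
  have hlim5 := hlim3.abs
  rw [abs_zero] at hlim5
  obtain ⟨k, k1, k2, k3, k4⟩ := ((hlim4.eventually (gt_mem_nhds hγ)).and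
    ((hlim5.eventually (gt_mem_nhds hγ)).and ((hlim.eventually (gt_mem_nhds hc0)).and
      (hlim.eventually (gt_mem_nhds (sub_pos.2 hd1)))))).exists
  refine ⟨C k, D k, hC1 k, ?_, ?_, hD2 k, k1, k2⟩
  · exact (monotone_cdf (distOf φ)).reflect_lt (by rw [hC3]; exact k3)
  · exact (monotone_cdf (distOf φ)).reflect_lt (by rw [hD3]; linarith)

/-- Lower bound for the Kullback–Leibler type integral in terms of the deviation at one point. -/
lemma exists_integral_lower_bound (h : IsLogConcaveModel φ aₒ bₒ) {c d Λ B ε : ℝ}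
    (hac : aₒ < c) (hcd : c < d) (hdb : d < bₒ) (hΛ : 0 ≤ Λ) (hε : 0 < ε)
    (hB : ∀ z ∈ Icc c d, |(φ z).toReal| ≤ B) :
    ∃ γ > 0, ∀ (u : ℝ → ℝ) (S : Set ℝ), Icc c d ⊆ S →
      (∀ y ∈ Icc c d, ∀ z ∈ Icc c d, |u y - u z| ≤ Λ * |y - z|) →
      IntegrableOn (fun z => Real.exp (u z) - 1 - u z) S (distOf φ) →
      (∃ z ∈ Icc c d, ε < |u z|) →
      γ ≤ ∫ z in S, (Real.exp (u z) - 1 - u z) ∂(distOf φ) := by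
  have hP := h.isProbabilityMeasure
  obtain ⟨η, hη0, hη⟩ := exists_exp_sub_one_sub_ge (half_pos hε)
  have had : aₒ < (d : EReal) := hac.trans (EReal.coe_lt_coe_iff.2 hcd)
  have hne : ∀ z ∈ Icc c d, φ z ≠ ⊥ := fun z hz =>
    h.isLogDensity.1.ne_bot_of_mem_Icc (h.ne_bot hac (hcd.trans hdb)) (h.ne_bot had hdb) hz
  -- Length of an interval around the bad point which still fits into `[c, d]` and on which the
  -- Lipschitz bound keeps `|u|` above `ε / 2`.
  set κ := min ((d - c) / 2) (ε / (2 * (Λ + 1))) with hκ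
  have hκ0 : 0 < κ := lt_min (by linarith) (by positivity)
  have hκ1 : κ ≤ (d - c) / 2 := min_le_left _ _
  have hκ2 : Λ * κ ≤ ε / 2 := by
    have : κ ≤ ε / (2 * (Λ + 1)) := min_le_right _ _
    rw [le_div_iff₀ (by positivity)] at this
    nlinarith
  refine ⟨η * (Real.exp (-B) * κ), by positivity, fun u S hS hu hint ⟨t, ht, htε⟩ => ?_⟩
  obtain ⟨v, hv1, hv2, htv⟩ : ∃ v, c ≤ v ∧ v + κ ≤ d ∧ t ∈ Icc v (v + κ) := by
    rcases le_total t ((c + d) / 2) with h1 | h1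
    · exact ⟨t, ht.1, by linarith, le_rfl, by linarith⟩
    · exact ⟨t - κ, by linarith, by linarith [ht.2], by linarith, by linarith⟩
  have hJ : Icc v (v + κ) ⊆ Icc c d := Icc_subset_Icc hv1 hv2
  have hJu : ∀ z ∈ Icc v (v + κ), ε / 2 ≤ |u z| := by
    intro z hz
    have h1 := hu t ht z (hJ hz)
    have h2 : |t - z| ≤ κ := by
      rw [abs_le]; constructor <;> linarith [htv.1, htv.2, hz.1, hz.2]
    have h3 := mul_le_mul_of_nonneg_left h2 hΛ
    have h4 := abs_sub_abs_le_abs_sub (u t) (u z)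
    linarith
  have hPJ : Real.exp (-B) * κ ≤ (distOf φ).real (Icc v (v + κ)) := by
    have h1 := h.setIntegral_distOf measurableSet_Icc (fun z hz => hne z (hJ hz)) fun _ => 1
    simp only [one_mul, setIntegral_const, smul_eq_mul, mul_one] at h1
    rw [h1]
    calc Real.exp (-B) * κ = ∫ _ in Icc v (v + κ), Real.exp (-B) := by
          simp [hκ0.le, mul_comm]
      _ ≤ _ := by
          refine setIntegral_mono_on (by simp) ((h.isLogDensity.1.concaveOn_toReal
            (convex_Icc v (v + κ)) fun z hz => hne z (hJ hz)).integrableOn_exp)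
            measurableSet_Icc fun z hz => Real.exp_le_exp.2 ?_
          linarith [(abs_le.1 (hB z (hJ hz))).1]
  calc η * (Real.exp (-B) * κ) ≤ η * (distOf φ).real (Icc v (v + κ)) :=
        mul_le_mul_of_nonneg_left hPJ hη0.le
    _ = ∫ _ in Icc v (v + κ), η ∂(distOf φ) := by
        simp [mul_comm]
    _ ≤ ∫ z in Icc v (v + κ), (Real.exp (u z) - 1 - u z) ∂(distOf φ) :=
        setIntegral_mono_on (by simp) (hint.mono_set (hJ.trans hS)) measurableSet_Icc
          fun z hz => hη _ (hJu z hz)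
    _ ≤ _ := setIntegral_mono_set hint
        (ae_of_all _ fun z => by
          have := Real.add_one_le_exp (u z)
          simp only [Pi.zero_apply]
          linarith) (hJ.trans hS).eventuallyLE

variable {Ω : Type*} [MeasurableSpace Ω] {μ : Measure Ω}
  [IsProbabilityMeasure μ] {X : ℕ → Ω → ℝ}

/-- Consistency of the estimator on compact subintervals of the interior of the support. -/
theorem exists_uniform (h : IsLogConcaveModel φ aₒ bₒ) (hX : IsIIDSample μ X (distOf φ)) :
    ∃ M : ℝ, ∀ c d ε : ℝ, aₒ < c → c < d → d < bₒ → 0 < ε → ∀ᶠ p in withHighProb μ,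
      ∃ a b g, a < c ∧ d < b ∧ GoodMLE φ bₒ (obs X p) M a b g ∧
        ∀ z ∈ Icc c d, |g z - (φ z).toReal| ≤ ε := by
  have hP := h.isProbabilityMeasure
  obtain ⟨M, L, hM0, hLev, hM⟩ := h.exists_bound hX
  refine ⟨M, fun c d ε hac hcd hdb hε => ?_⟩
  obtain ⟨Λ, B, c₁, d₁, hΛ, hB, hac₁, hcc₁, hdd₁, hdb₁, hφΛ, hφB, hev₁⟩ :=
    h.exists_lipschitz hX hM0 hLev hac hcd hdb
  obtain ⟨γ, hγ, hlow⟩ := h.exists_integral_lower_bound (Λ := 2 * Λ) hac hcd hdb (by positivity)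
    hε hφB
  have hcd₁ : c₁ < d₁ := hcc₁.trans (hcd.trans hdd₁)
  -- The larger interval is chosen after `γ`, since the contribution from outside must be small
  -- relative to `γ`. It has its own Lipschitz constants, while `γ` depends only on those for `[c,
  -- d]`.
  obtain ⟨c₂, d₂, hac₂, hcc₂, hdd₂, hdb₂, hout1, hout2⟩ :=
    h.exists_Icc (M := M) (γ := γ / 8) hac₁ hcd₁ hdb₁ (by positivity)
  have hcd₂ : c₂ < d₂ := hcc₂.trans (hcd₁.trans hdd₂)
  obtain ⟨Λ₂, B₂, c₃, d₃, hΛ₂, hB₂, hac₃, hcc₃, hdd₃, hdb₃, hφΛ₂, hφB₂, hev₂⟩ :=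
    h.exists_lipschitz hX hM0 hLev hac₂ hcd₂ hdb₂
  set I := Icc c₂ d₂ with hI
  have hIm : MeasurableSet I := measurableSet_Icc
  have hIcm : MeasurableSet Iᶜ := hIm.compl
  have hu := hX.eventually_empMean_uniform (L := 2 * Λ₂) (B := 2 * B₂) (ε := γ / 8) hcd₂
    (by positivity) (by positivity) (by positivity)
  have hm1 := hX.tendsto_empMean (h := (Iᶜ).indicator 1) (measurable_one.indicator hIcm)
    ((integrable_const (1 : ℝ)).indicator hIcm)
  rw [integral_indicator_one hIcm] at hm1
  have hm2 := hX.tendsto_empMean (h := (Iᶜ).indicator fun z => (φ z).toReal)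
    (h.measurable_toReal.indicator hIcm) (h.integrable_toReal.indicator hIcm)
  rw [integral_indicator hIcm] at hm2
  filter_upwards [hev₁, hev₂, hu, hM c₃ d₃ hac₃ (hcc₃.trans (hcd₂.trans hdd₃)) hdb₃,
    hm1.eventually (gt_mem_nhds (lt_add_of_pos_right _ (show 0 < γ / (8 * (M + 1)) by positivity))),
    hm2.eventually (lt_mem_nhds (sub_lt_self _ (show 0 < γ / 8 by positivity)))]
    with p hp1 hp2 hpu hpM hpm1 hpm2
  obtain ⟨a, b, g, hac', hdb', hg⟩ := hpM
  obtain ⟨hgΛ, hgB⟩ := hp1 a b g (by linarith) (by linarith) hg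
  obtain ⟨hgΛ₂, hgB₂⟩ := hp2 a b g (by linarith) (by linarith) hg
  refine ⟨a, b, g, by linarith, by linarith, hg, ?_⟩
  by_contra! hbad
  set r : ℝ → ℝ := fun z => (φ z).toReal with hr
  set u : ℝ → ℝ := fun z => g z - r z with hudef
  have hlipu : ∀ {S : Set ℝ} {Λ : ℝ}, (∀ y ∈ S, ∀ z ∈ S, |g y - g z| ≤ Λ * |y - z|) →
      (∀ y ∈ S, ∀ z ∈ S, |r y - r z| ≤ Λ * |y - z|) →
      ∀ y ∈ S, ∀ z ∈ S, |u y - u z| ≤ 2 * Λ * |y - z| := by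
    intro S Λ h1 h2 y hy z hz
    have e : u y - u z = (g y - g z) - (r y - r z) := by simp only [hudef]; ring
    rw [e]
    refine (abs_sub _ _).trans ?_
    linarith [h1 y hy z hz, h2 y hy z hz]
  have huI := hlipu hgΛ₂ hφΛ₂
  have hucont : ContinuousOn u I := continuousOn_of_abs_sub_le (by positivity) huI
  have hcI : Icc c d ⊆ I := Icc_subset_Icc (by linarith) (by linarith)
  have hIab : I ⊆ Icc a b := Icc_subset_Icc (by linarith) (by linarith)
  have i1 : IntegrableOn u I (distOf φ) := hucont.integrableOn_compact isCompact_Icc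
  have i2 : IntegrableOn (fun z => Real.exp (u z)) I (distOf φ) :=
    (Real.continuous_exp.comp_continuousOn hucont).integrableOn_compact isCompact_Icc
  have i3 : IntegrableOn (fun _ : ℝ => (1 : ℝ)) I (distOf φ) := by simp
  have hge := hlow u I hcI (hlipu hgΛ hφΛ) ((i2.sub i3).sub i1) hbad
  have hsplit : ∫ z in I, (Real.exp (u z) - 1 - u z) ∂(distOf φ) =
      (∫ z in I, Real.exp (u z) ∂(distOf φ)) - (distOf φ).real I - ∫ z in I, u z ∂(distOf φ) := by
    rw [integral_sub (f := fun z => Real.exp (u z) - 1) (i2.sub i3) i1, integral_sub i2 i3]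
    simp
  -- Here `e^u` times the true density is the fitted density, of total mass one.
  have hexp : ∫ z in I, Real.exp (u z) ∂(distOf φ) ≤ 1 := by
    rw [h.setIntegral_distOf hIm fun z hz => hg.ne_bot z (hIab hz)]
    have : (fun z => Real.exp (u z) * Real.exp (φ z).toReal) = fun z => Real.exp (g z) := by
      ext z
      rw [← Real.exp_add]
      simp [hudef, hr]
    rw [this, ← hg.isMLEOn.setIntegral_exp]
    exact setIntegral_mono_set hg.isMLEOn.concaveOn.integrableOn_exp
      (ae_of_all _ fun _ => (Real.exp_pos _).le) hIab.eventuallyLE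
  have hcompl : (distOf φ).real I = 1 - (distOf φ).real Iᶜ := by
    rw [probReal_compl_eq_one_sub hIm]; ring
  have huB : ∀ z ∈ I, |u z| ≤ 2 * B₂ := by
    intro z hz
    refine (abs_sub _ _).trans ?_
    linarith [hgB₂ z hz, hφB₂ z hz]
  have hul := (abs_le.1 (hpu u huI huB)).2
  -- The estimator has at least the likelihood of `φ`, so the mean of `u` over `I` can be negative
  -- only through observations outside `I`, where `g ≤ M`. The resulting error terms add up to at
  -- most `5γ / 8`, a contradiction to `hge`.
  have hemp : empMean (obs X p) (fun z => -(M * (Iᶜ).indicator 1 z) + (Iᶜ).indicator r z) ≤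
      empMean (obs X p) (I.indicator u) - (empMean (obs X p) g - empMean (obs X p) r) := by
    rw [← empMean_sub, ← empMean_sub]
    refine empMean_mono fun i => ?_
    by_cases hi : obs X p i ∈ I
    · have hi' : obs X p i ∉ Iᶜ := fun h => h hi
      simp [indicator_of_mem hi, indicator_of_notMem hi', hudef]
    · have hi' : obs X p i ∈ Iᶜ := hi
      have := hg.le _ (hg.isMLEOn.mem i)
      simp only [indicator_of_notMem hi, indicator_of_mem hi', Pi.one_apply]
      linarith
  have hneg : empMean (obs X p) (fun z => -(M * (Iᶜ).indicator 1 z) + (Iᶜ).indicator r z) =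
      -(M * empMean (obs X p) ((Iᶜ).indicator 1)) + empMean (obs X p) ((Iᶜ).indicator r) := by
    rw [empMean_add]
    congr 1
    simp only [← neg_mul]
    rw [empMean_const_mul]
  rw [hneg] at hemp
  have hle := hg.empMean_le
  have h5 : M * empMean (obs X p) ((Iᶜ).indicator 1) ≤
      M * ((distOf φ).real Iᶜ + γ / (8 * (M + 1))) := mul_le_mul_of_nonneg_left hpm1.le hM0
  have h6 : M * (γ / (8 * (M + 1))) ≤ γ / 8 := by
    rw [← mul_div_assoc, div_le_div_iff₀ (by positivity) (by positivity)]
    nlinarith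
  have h7 := (abs_lt.1 hout2).1
  rw [hsplit, hcompl] at hge
  linarith

end IsLogConcaveModel
end

/-! ### Density vanishing at the right endpoint: part (a) -/

section
open Set

lemma EReal.abs_coe_sub_coe (x y : ℝ) :
    ((x : EReal) - (y : EReal)).abs = ENNReal.ofReal |x - y| := by
  rw [← EReal.coe_sub, EReal.abs_def]

lemma EReal.abs_coe_ennreal_sub_le {u v : ℝ≥0∞} (hu : u ≠ ⊤) (hv : v ≠ ⊤) {c : ℝ}
    (h : |u.toReal - v.toReal| ≤ c) : ((u : EReal) - (v : EReal)).abs ≤ ENNReal.ofReal c := by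
  rw [← EReal.coe_ennreal_toReal hu, ← EReal.coe_ennreal_toReal hv, EReal.abs_coe_sub_coe]
  exact ENNReal.ofReal_le_ofReal h

lemma rightDeriv_eq_of_affine {ψ : ℝ → EReal} {t q s y : ℝ} (htq : t < q)
    (h : ∀ z ∈ Icc t q, ψ z = ((y + s * (z - t) : ℝ) : EReal)) : rightDeriv ψ t = s := by
  rw [rightDeriv]
  have : (fun z : ℝ => (ψ z - ψ t) / ((z - t : ℝ) : EReal)) =ᶠ[𝓝[>] t] fun _ => (s : EReal) := by
    filter_upwards [Ioc_mem_nhdsGT htq] with z hz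
    have hzt : z - t ≠ 0 := (sub_pos.2 hz.1).ne'
    rw [h z ⟨hz.1.le, hz.2⟩, h t ⟨le_rfl, htq.le⟩, ← EReal.coe_sub, ← EReal.coe_div]
    congr 1
    field_simp
    ring
  rw [limsup_congr this, limsup_const]

namespace IsLogConcaveModel

variable {φ : ℝ → EReal} {aₒ : EReal} {bₒ : ℝ}

lemma GoodMLE.mleRightDeriv_eq {n : ℕ} {x : Fin n → ℝ} {M a b t q s : ℝ} {g : ℝ → ℝ}
    (hg : GoodMLE φ bₒ x M a b g) (hat : a ≤ t) (htq : t < q) (hqb : q ≤ b)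
    (h : ∀ z ∈ Icc t q, g z = g t + s * (z - t)) : mleRightDeriv x t = s := by
  obtain ⟨i, hi⟩ := hg.isMLEOn.exists_right
  rw [mleRightDeriv, if_neg (fun hc => absurd (hc i) (by rw [hi]; linarith))]
  refine rightDeriv_eq_of_affine htq (y := g t) fun z hz => ?_
  rw [hg.coe_eq z ⟨hat.trans hz.1, hz.2.trans hqb⟩, h z hz]

lemma GoodMLE.mleRightDeriv_eq_bot {n : ℕ} {x : Fin n → ℝ} {M a b t : ℝ} {g : ℝ → ℝ}
    (hg : GoodMLE φ bₒ x M a b g) (hbt : b ≤ t) : mleRightDeriv x t = ⊥ := by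
  rw [mleRightDeriv, if_pos fun i => (hg.isMLEOn.mem i).2.trans hbt]

/-- The right-sided derivative is at most any slope further to the left. -/
lemma GoodMLE.mleRightDeriv_le {n : ℕ} {x : Fin n → ℝ} {M a b c d t : ℝ} {g : ℝ → ℝ}
    (hg : GoodMLE φ bₒ x M a b g) (hac : a ≤ c) (hcd : c < d) (hdt : d ≤ t) :
    mleRightDeriv x t ≤ (((g d - g c) / (d - c) : ℝ) : EReal) := by
  rcases le_or_gt b t with hbt | htb
  · rw [hg.mleRightDeriv_eq_bot hbt]; exact bot_le
  obtain ⟨q, τ, s, htq, hqb, h1, h2, haff, -⟩ :=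
    hg.isMLEOn.exists_knot (hac.trans (hcd.le.trans hdt)) le_rfl htb
  obtain rfl : τ = t := le_antisymm h2 h1
  rw [hg.mleRightDeriv_eq (by linarith) htq hqb haff, EReal.coe_le_coe_iff]
  have hcm : c ∈ Icc a b := ⟨hac, by linarith⟩
  have hqm : q ∈ Icc a b := ⟨by linarith, hqb⟩
  have hdm : d ∈ Icc a b := ⟨by linarith, by linarith⟩
  have hs : (g q - g τ) / (q - τ) = s := by
    rw [haff q ⟨htq.le, le_rfl⟩]
    field_simp [(sub_pos.2 htq).ne']
    ring
  rcases hdt.eq_or_lt with rfl | hdt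
  · rw [← hs]
    exact hg.isMLEOn.concaveOn.slope_anti_adjacent hcm hqm hcd htq
  · have s1 := hg.isMLEOn.concaveOn.slope_anti_adjacent hdm hqm hdt htq
    have s2 := hg.isMLEOn.concaveOn.slope_anti_adjacent hcm (y := d) (z := τ)
      ⟨by linarith, by linarith⟩ hcd hdt
    rw [← hs]
    exact s1.trans s2

/-- Every difference quotient equals `⊥`, even where `φ y = ⊥`, because `⊥ - y = ⊥` for all extended
reals `y`. -/
lemma leftDeriv_eq_bot (hb : φ bₒ = ⊥) : leftDeriv φ bₒ = ⊥ := by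
  have : (fun y : ℝ => (φ bₒ - φ y) / ((bₒ - y : ℝ) : EReal)) =ᶠ[𝓝[<] bₒ] fun _ => ⊥ := by
    filter_upwards [self_mem_nhdsWithin] with y hy
    have hy : 0 < bₒ - y := sub_pos.2 hy
    rw [hb, EReal.bot_sub]
    exact EReal.bot_div_of_pos_ne_top (by exact_mod_cast hy) (EReal.coe_ne_top _)
  rw [leftDeriv, limsup_congr this, limsup_const]

lemma exists_toReal_lt (h : IsLogConcaveModel φ aₒ bₒ) (hb : φ bₒ = ⊥) {c : ℝ} (hac : aₒ < c)
    (hcb : c < bₒ) (K : ℝ) : ∃ d, c < d ∧ d < bₒ ∧ (φ d).toReal < K := by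
  have h1 : ∀ᶠ x in 𝓝 bₒ, φ x < K := h.usc bₒ K (show φ bₒ < K by rw [hb]; exact EReal.bot_lt_coe K)
  obtain ⟨d, hd, hcd⟩ :=
    ((h1.filter_mono nhdsWithin_le_nhds).and (Ioo_mem_nhdsLT hcb)).exists
  refine ⟨d, hcd.1, hcd.2, ?_⟩
  have hne := h.ne_bot (hac.trans (EReal.coe_lt_coe_iff.2 hcd.1)) hcd.2
  rw [← h.isLogDensity.1.coe_toReal hne] at hd
  exact_mod_cast hd

variable {Ω : Type*} [MeasurableSpace Ω] {μ : Measure Ω}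
  [IsProbabilityMeasure μ] {X : ℕ → Ω → ℝ}

theorem tendsto_mleRightDeriv_bot (h : IsLogConcaveModel φ aₒ bₒ)
    (hX : IsIIDSample μ X (distOf φ)) (hb : φ bₒ = ⊥) {t : ℕ → ℝ} (ht : Tendsto t atTop (𝓝 bₒ)) :
    Tendsto (fun p : ℕ × Ω => mleRightDeriv (obs X p) (t p.1)) (withHighProb μ) (𝓝 ⊥) := by
  obtain ⟨M, hM⟩ := h.exists_uniform hX
  obtain ⟨c, hac, hcb, -⟩ := h.exists_cdf_eq (η := 1 / 3) (by norm_num) (by norm_num)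
  rw [EReal.tendsto_nhds_bot_iff_real]
  intro K
  -- The drop of `φ` from `c` to `d` exceeds `|K| (bₒ - c)` by more than `2`, the total error
  -- allowed at `c` and `d`. The chord of the estimator then has slope below `K`.
  obtain ⟨d, hcd, hdb, hd⟩ :=
    h.exists_toReal_lt hb hac hcb ((φ c).toReal - 2 - |K| * (bₒ - c) - 1)
  filter_upwards [hM c d 1 hac hcd hdb one_pos, (tendsto_fst_withHighProb μ).eventually
    (ht.eventually (lt_mem_nhds hdb))] with p ⟨a, b, g, ha, hb', hg, hgφ⟩ htp
  refine (hg.mleRightDeriv_le ha.le hcd htp.le).trans_lt ?_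
  rw [EReal.coe_lt_coe_iff, div_lt_iff₀ (sub_pos.2 hcd)]
  have h1 := abs_le.1 (hgφ c ⟨le_rfl, hcd.le⟩)
  have h2 := abs_le.1 (hgφ d ⟨hcd.le, le_rfl⟩)
  have h3 := neg_abs_le K
  have h4 := abs_nonneg K
  nlinarith

theorem tendsto_supDist_expFn (h : IsLogConcaveModel φ aₒ bₒ) (hX : IsIIDSample μ X (distOf φ))
    (hb : φ bₒ = ⊥) {c : ℝ} (hac : aₒ < c) (hcb : c < bₒ) :
    Tendsto (fun p : ℕ × Ω => supDist (Set.Ici c)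
      (fun x => (expFn (logConcaveMLE (obs X p)) x : EReal))
      (fun x => (expFn φ x : EReal))) (withHighProb μ) (𝓝 0) := by
  obtain ⟨M, hM⟩ := h.exists_uniform hX
  obtain ⟨M', hM'⟩ := h.exists_le
  rw [ENNReal.tendsto_nhds_zero]
  intro ε hε
  obtain ⟨ε', hε'0, hε'⟩ : ∃ ε' : ℝ, 0 < ε' ∧ ENNReal.ofReal ε' ≤ ε := by
    rcases eq_or_ne ε ⊤ with rfl | hne
    · exact ⟨1, one_pos, le_top⟩
    · exact ⟨ε.toReal, ENNReal.toReal_pos hε.ne' hne, (ENNReal.ofReal_toReal hne).le⟩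
  -- The first bound makes both log-densities decreasing from `c` to `d` despite an error of one at
  -- each end. The second puts both below `log ε'` at `d`.
  obtain ⟨d, hcd, hdb, hd⟩ :=
    h.exists_toReal_lt hb hac hcb (min ((φ c).toReal - 2) (Real.log ε' - 1))
  have hd1 := hd.trans_le (min_le_left _ _)
  have hd2 := hd.trans_le (min_le_right _ _)
  have had : aₒ < (d : EReal) := hac.trans (EReal.coe_lt_coe_iff.2 hcd)
  set δ := min 1 (ε' / (2 * Real.exp M')) with hδ
  have hδ0 : 0 < δ := by positivity
  have hδ1 : δ ≤ 1 := min_le_left _ _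
  have hδ2 : Real.exp M' * (2 * δ) ≤ ε' := by
    have : δ ≤ ε' / (2 * Real.exp M') := min_le_right _ _
    rw [le_div_iff₀ (by positivity)] at this
    linarith
  filter_upwards [hM c d δ hac hcd hdb hδ0] with p ⟨a, b, g, ha, hb', hg, hgφ⟩
  refine le_trans (iSup₂_le fun x hx => ?_) hε'
  have hx : c ≤ x := hx
  have hcf : ∀ {ψ : ℝ → EReal}, IsConcaveFn ψ → expFn ψ x ≠ ⊤ := fun hψ => by
    rw [expFn, Ne, EReal.exp_eq_top_iff]; exact (hψ.1 x).ne
  refine EReal.abs_coe_ennreal_sub_le (hcf hg.isConcaveFn) (hcf h.isLogDensity.1) ?_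
  rcases le_total x d with hxd | hxd
  · have hxm : x ∈ Icc a b := ⟨by linarith, by linarith⟩
    have hne := hg.ne_bot x hxm
    have hδx := hgφ x ⟨hx, hxd⟩
    have h1 := Real.abs_exp_sub_one_le (hδx.trans hδ1)
    rw [h.expFn_toReal hne, expFn, hg.coe_eq x hxm, EReal.exp_coe,
      ENNReal.toReal_ofReal (Real.exp_pos _).le]
    have e : Real.exp (g x) - Real.exp (φ x).toReal =
        Real.exp (φ x).toReal * (Real.exp (g x - (φ x).toReal) - 1) := by
      rw [mul_sub, ← Real.exp_add]; simp
    rw [e, abs_mul, Real.abs_exp]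
    refine le_trans (mul_le_mul (Real.exp_le_exp.2 (hM' x hne)) (h1.trans
      (mul_le_mul_of_nonneg_left hδx zero_le_two)) (abs_nonneg _) (Real.exp_pos _).le) hδ2
  -- Beyond `d` both densities are at most `ε'`, and two numbers in `[0, ε']` differ by at most
  -- `ε'`. Extrapolation also covers points outside the range of the data.
  · have key : ∀ {ψ : ℝ → EReal} {gc gd : ℝ}, IsConcaveFn ψ → ψ c = gc → ψ d = gd → gd ≤ gc →
        gd ≤ Real.log ε' → (expFn ψ x).toReal ≤ ε' := by
      intro ψ gc gd hψ h1 h2 h3 h4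
      have h5 := hψ.le_extrapolation h1 h2 hcd hxd
      have h6 : gd + (x - d) * ((gd - gc) / (d - c)) ≤ Real.log ε' := by
        have : (x - d) * ((gd - gc) / (d - c)) ≤ 0 :=
          mul_nonpos_of_nonneg_of_nonpos (sub_nonneg.2 hxd)
            (div_nonpos_of_nonpos_of_nonneg (by linarith) (by linarith))
        linarith
      have h7 : expFn ψ x ≤ ENNReal.ofReal ε' := by
        rw [expFn, ← Real.exp_log hε'0, ← EReal.exp_coe]
        exact EReal.exp_monotone (h5.trans (EReal.coe_le_coe_iff.2 h6))
      exact ENNReal.toReal_le_of_le_ofReal hε'0.le h7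
    have h1 := abs_le.1 (hgφ c ⟨le_rfl, hcd.le⟩)
    have h2 := abs_le.1 (hgφ d ⟨hcd.le, le_rfl⟩)
    have k1 := key hg.isConcaveFn (hg.coe_eq c ⟨ha.le, by linarith⟩)
      (hg.coe_eq d ⟨by linarith, hb'.le⟩) (by linarith) (by linarith)
    have k2 := key h.isLogDensity.1 (h.isLogDensity.1.coe_toReal (h.ne_bot hac hcb)).symm
      (h.isLogDensity.1.coe_toReal (h.ne_bot had hdb)).symm (by linarith) (by linarith)
    rw [abs_le]
    constructor <;> linarith [ENNReal.toReal_nonneg (a := expFn φ x),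
      ENNReal.toReal_nonneg (a := expFn (logConcaveMLE (obs X p)) x)]

end IsLogConcaveModel
end

/-! ### Mean excess and an upper bound near an endpoint with positive density -/

section
open Set

lemma setIntegral_sub_Icc {p q : ℝ} (hpq : p ≤ q) (τ : ℝ) :
    ∫ z in Icc p q, (z - τ) = ((q - τ) ^ 2 - (p - τ) ^ 2) / 2 := by
  rw [integral_Icc_eq_integral_Ioc, ← intervalIntegral.integral_of_le hpq,
    intervalIntegral.integral_sub (by simp) (by simp), integral_id]
  simp
  ring

/-- Upper bound for `∫ (z - τ)⁺ w(z) dz` when `w ≤ A` to the left and `w ≤ B` to the right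
of `m`. -/
lemma setIntegral_max_sub_mul_le {a b τ m e A B : ℝ} {w : ℝ → ℝ} (hτm : τ ≤ m)
    (hme : m ≤ e) (hbe : b ≤ e) (hA : 0 ≤ A) (hB : 0 ≤ B)
    (hint : IntegrableOn (fun z => max (z - τ) 0 * w z) (Icc a b))
    (h₁ : ∀ z ∈ Icc a b, τ ≤ z → z ≤ m → w z ≤ A) (h₂ : ∀ z ∈ Icc a b, m ≤ z → w z ≤ B) :
    ∫ z in Icc a b, max (z - τ) 0 * w z ≤
      A * ((m - τ) ^ 2 / 2) + B * (((e - τ) ^ 2 - (m - τ) ^ 2) / 2) := by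
  have hAint : Integrable ((Icc τ m).indicator fun z => A * (z - τ)) :=
    (integrable_indicator_iff measurableSet_Icc).2
      (ContinuousOn.integrableOn_compact isCompact_Icc (by fun_prop))
  have hBint : Integrable ((Icc m e).indicator fun z => B * (z - τ)) :=
    (integrable_indicator_iff measurableSet_Icc).2
      (ContinuousOn.integrableOn_compact isCompact_Icc (by fun_prop))
  have hA0 : ∀ z, 0 ≤ (Icc τ m).indicator (fun z => A * (z - τ)) z := fun z =>
    indicator_nonneg (fun z hz => mul_nonneg hA (sub_nonneg.2 hz.1)) z
  have hB0 : ∀ z, 0 ≤ (Icc m e).indicator (fun z => B * (z - τ)) z := fun z =>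
    indicator_nonneg (fun z hz => mul_nonneg hB (by linarith [hz.1])) z
  calc ∫ z in Icc a b, max (z - τ) 0 * w z
      ≤ ∫ z in Icc a b, ((Icc τ m).indicator (fun z => A * (z - τ)) z +
          (Icc m e).indicator (fun z => B * (z - τ)) z) := by
        refine setIntegral_mono_on hint (hAint.add hBint).integrableOn measurableSet_Icc
          fun z hz => ?_
        rcases le_or_gt z τ with hzτ | hzτ
        · rw [max_eq_right (by linarith), zero_mul]
          exact add_nonneg (hA0 z) (hB0 z)
        rw [max_eq_left (by linarith)]
        have hpos : 0 ≤ z - τ := by linarith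
        rcases le_total z m with hzm | hzm
        · have h3 := mul_le_mul_of_nonneg_left (h₁ z hz hzτ.le hzm) hpos
          rw [indicator_of_mem (show z ∈ Icc τ m from ⟨hzτ.le, hzm⟩)]
          linarith [hB0 z]
        · have h3 := mul_le_mul_of_nonneg_left (h₂ z hz hzm) hpos
          rw [indicator_of_mem (show z ∈ Icc m e from ⟨hzm, hz.2.trans hbe⟩)]
          linarith [hA0 z]
    _ ≤ ∫ z, ((Icc τ m).indicator (fun z => A * (z - τ)) z +
          (Icc m e).indicator (fun z => B * (z - τ)) z) :=
        setIntegral_le_integral (hAint.add hBint) (ae_of_all _ fun z => add_nonneg (hA0 z) (hB0 z))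
    _ = _ := by
        rw [integral_add hAint hBint, integral_indicator measurableSet_Icc,
          integral_indicator measurableSet_Icc, integral_const_mul, integral_const_mul,
          setIntegral_sub_Icc hτm, setIntegral_sub_Icc hme]
        simp

namespace IsLogConcaveModel

variable {φ : ℝ → EReal} {aₒ : EReal} {bₒ : ℝ}

lemma ne_bot_of_le (h : IsLogConcaveModel φ aₒ bₒ) (hb : φ bₒ ≠ ⊥) {x : ℝ} (hax : aₒ < x)
    (hxb : x ≤ bₒ) : φ x ≠ ⊥ := by
  rcases hxb.eq_or_lt with rfl | hxb
  · exact hb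
  · exact h.ne_bot hax hxb

lemma concaveOn_Icc (h : IsLogConcaveModel φ aₒ bₒ) (hb : φ bₒ ≠ ⊥) {c : ℝ} (hac : aₒ < c) :
    ConcaveOn ℝ (Icc c bₒ) fun z => (φ z).toReal :=
  h.isLogDensity.1.concaveOn_toReal (convex_Icc c bₒ) fun _ hz =>
    h.ne_bot_of_le hb (hac.trans_le (EReal.coe_le_coe_iff.2 hz.1)) hz.2

/-- Left-continuity of the log-density at the right endpoint of its support. -/
lemma eventually_abs_sub_le (h : IsLogConcaveModel φ aₒ bₒ) (hb : φ bₒ ≠ ⊥) {δ : ℝ}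
    (hδ : 0 < δ) : ∀ᶠ d in 𝓝[<] bₒ, ∀ z ∈ Icc d bₒ, |(φ z).toReal - (φ bₒ).toReal| ≤ δ := by
  obtain ⟨c, hac, hcb, -⟩ := h.exists_cdf_eq (η := 1 / 3) (by norm_num) (by norm_num)
  have hbc : 0 < bₒ - c := sub_pos.2 hcb
  set v := (φ bₒ).toReal with hv
  set r : ℝ → ℝ := fun z => (φ z).toReal with hr
  have h1 : ∀ᶠ x in 𝓝 bₒ, φ x < ((v + δ : ℝ) : EReal) := h.usc bₒ _ (show φ bₒ < _ by
    rw [← h.isLogDensity.1.coe_toReal hb, EReal.coe_lt_coe_iff]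
    exact lt_add_of_pos_right _ hδ)
  obtain ⟨l, hl, hlsub⟩ := (mem_nhdsLT_iff_exists_Ioo_subset (a := bₒ)).1
    (h1.filter_mono (nhdsWithin_le_nhds (s := Iio bₒ)))
  have hl : l < bₒ := hl
  have h2 : ∀ᶠ d in 𝓝[<] bₒ, (bₒ - d) / (bₒ - c) * |v - r c| < δ := by
    refine Filter.Eventually.filter_mono nhdsWithin_le_nhds ?_
    have : Tendsto (fun d => (bₒ - d) / (bₒ - c) * |v - r c|) (𝓝 bₒ)
        (𝓝 ((bₒ - bₒ) / (bₒ - c) * |v - r c|)) := by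
      refine Continuous.tendsto (f := fun d => (bₒ - d) / (bₒ - c) * |v - r c|) ?_ bₒ
      fun_prop
    rw [sub_self, zero_div, zero_mul] at this
    exact this.eventually (gt_mem_nhds hδ)
  filter_upwards [h2, Ioo_mem_nhdsLT hl, Ioo_mem_nhdsLT hcb] with d hd hld hcd z hz
  have hne := h.ne_bot_of_le hb (hac.trans (EReal.coe_lt_coe_iff.2 (hcd.1.trans_le hz.1))) hz.2
  rw [abs_le]
  -- Below, `φ` is controlled by its chord from `c` to `bₒ`; above, by upper semicontinuity at `bₒ`.
  constructor
  · have hc := (h.concaveOn_Icc hb hac).2 (left_mem_Icc.2 hcb.le) (right_mem_Icc.2 hcb.le)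
      (show 0 ≤ (bₒ - z) / (bₒ - c) from div_nonneg (sub_nonneg.2 hz.2) hbc.le)
      (show 0 ≤ (z - c) / (bₒ - c) from div_nonneg (by linarith [hcd.1, hz.1]) hbc.le)
      (by field_simp; ring)
    simp only [smul_eq_mul] at hc
    have e1 : (bₒ - z) / (bₒ - c) * c + (z - c) / (bₒ - c) * bₒ = z := by field_simp; ring
    rw [e1] at hc
    have e2 : (z - c) / (bₒ - c) = 1 - (bₒ - z) / (bₒ - c) := by field_simp; ring
    rw [e2] at hc
    have h3 : (bₒ - z) / (bₒ - c) * (v - r c) ≤ (bₒ - d) / (bₒ - c) * |v - r c| := by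
      have h4 : (bₒ - z) / (bₒ - c) ≤ (bₒ - d) / (bₒ - c) :=
        div_le_div_of_nonneg_right (by linarith [hz.1]) hbc.le
      calc _ ≤ (bₒ - z) / (bₒ - c) * |v - r c| :=
            mul_le_mul_of_nonneg_left (le_abs_self _) (div_nonneg (sub_nonneg.2 hz.2) hbc.le)
        _ ≤ _ := mul_le_mul_of_nonneg_right h4 (abs_nonneg _)
    simp only [hr, hv] at hc h3 hd ⊢
    linarith
  · rcases hz.2.eq_or_lt with rfl | hzb
    · simp [hv, hδ.le]
    · have h3 : φ z < ((v + δ : ℝ) : EReal) := hlsub ⟨hld.1.trans_le hz.1, hzb⟩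
      rw [← h.isLogDensity.1.coe_toReal hne, EReal.coe_lt_coe_iff] at h3
      linarith

/-- The mean of `(z - τ)⁺` under the true distribution. -/
noncomputable def meanExcess (φ : ℝ → EReal) (τ : ℝ) : ℝ := ∫ z, max (z - τ) 0 ∂(distOf φ)

lemma integral_eq_setIntegral (h : IsLogConcaveModel φ aₒ bₒ) (hb : φ bₒ ≠ ⊥) {τ : ℝ}
    (haτ : aₒ < τ) (u : ℝ → ℝ) (hu : ∀ z < τ, u z = 0) :
    ∫ z, u z ∂(distOf φ) = ∫ z in Icc τ bₒ, u z * Real.exp (φ z).toReal := by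
  have hne : ∀ z ∈ Icc τ bₒ, φ z ≠ ⊥ := fun z hz =>
    h.ne_bot_of_le hb (haτ.trans_le (EReal.coe_le_coe_iff.2 hz.1)) hz.2
  rw [← h.setIntegral_distOf measurableSet_Icc hne, setIntegral_eq_integral_of_ae_compl_eq_zero]
  have h1 : ∀ᵐ z ∂(distOf φ), z ∈ {z | φ z ≠ ⊥ ∧ z ≤ bₒ} := by
    rw [ae_iff]; exact h.distOf_bot
  filter_upwards [h1] with z hz hzI
  rw [mem_Icc, not_and_or, not_le] at hzI
  rcases hzI with h2 | h2
  · exact hu z h2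
  · exact absurd hz.2 h2

lemma meanExcess_eq (h : IsLogConcaveModel φ aₒ bₒ) (hb : φ bₒ ≠ ⊥) {τ : ℝ} (haτ : aₒ < τ) :
    meanExcess φ τ = ∫ z in Icc τ bₒ, (z - τ) * Real.exp (φ z).toReal := by
  rw [meanExcess, h.integral_eq_setIntegral hb haτ _ fun z hz => max_eq_right (by linarith)]
  refine setIntegral_congr_fun measurableSet_Icc fun z hz => ?_
  simp only [max_eq_left (sub_nonneg.2 hz.1)]

lemma one_sub_cdf_eq_setIntegral (h : IsLogConcaveModel φ aₒ bₒ) (hb : φ bₒ ≠ ⊥) {τ : ℝ}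
    (haτ : aₒ < τ) : 1 - cdf (distOf φ) τ = ∫ z in Icc τ bₒ, Real.exp (φ z).toReal := by
  have hP := h.isProbabilityMeasure
  rw [← h.real_Ici, ← integral_indicator_one measurableSet_Ici, h.integral_eq_setIntegral hb haτ]
  · refine setIntegral_congr_fun measurableSet_Icc fun z hz => ?_
    simp [indicator_of_mem (show z ∈ Ici τ from hz.1)]
  · intro z hz
    exact indicator_of_notMem (by simpa using hz) _

/-- Bounds for the mean excess in terms of bounds for the log-density. -/
lemma meanExcess_mem (h : IsLogConcaveModel φ aₒ bₒ) (hb : φ bₒ ≠ ⊥) {τ v δ : ℝ} (haτ : aₒ < τ)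
    (hτb : τ ≤ bₒ) (hv : ∀ z ∈ Icc τ bₒ, |(φ z).toReal - v| ≤ δ) :
    Real.exp (v - δ) * ((bₒ - τ) ^ 2 / 2) ≤ meanExcess φ τ ∧
      meanExcess φ τ ≤ Real.exp (v + δ) * ((bₒ - τ) ^ 2 / 2) := by
  have e : ∀ C : ℝ, C * ((bₒ - τ) ^ 2 / 2) = ∫ z in Icc τ bₒ, (z - τ) * C := by
    intro C
    rw [integral_mul_const, setIntegral_sub_Icc hτb]
    ring
  have hi : ∀ C : ℝ, IntegrableOn (fun z => (z - τ) * C) (Icc τ bₒ) := fun C =>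
    ContinuousOn.integrableOn_compact isCompact_Icc (by fun_prop)
  have hi2 : IntegrableOn (fun z => (z - τ) * Real.exp (φ z).toReal) (Icc τ bₒ) :=
    (h.concaveOn_Icc hb haτ).integrableOn_exp.continuousOn_mul (by fun_prop) isCompact_Icc
  rw [h.meanExcess_eq hb haτ, e, e]
  constructor
  · refine setIntegral_mono_on (hi _) hi2 measurableSet_Icc fun z hz => ?_
    refine mul_le_mul_of_nonneg_left (Real.exp_le_exp.2 ?_) (sub_nonneg.2 hz.1)
    linarith [(abs_le.1 (hv z hz)).1]
  · refine setIntegral_mono_on hi2 (hi _) measurableSet_Icc fun z hz => ?_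
    refine mul_le_mul_of_nonneg_left (Real.exp_le_exp.2 ?_) (sub_nonneg.2 hz.1)
    linarith [(abs_le.1 (hv z hz)).2]

lemma one_sub_cdf_mem (h : IsLogConcaveModel φ aₒ bₒ) (hb : φ bₒ ≠ ⊥) {τ v δ : ℝ} (haτ : aₒ < τ)
    (hτb : τ ≤ bₒ) (hv : ∀ z ∈ Icc τ bₒ, |(φ z).toReal - v| ≤ δ) :
    Real.exp (v - δ) * (bₒ - τ) ≤ 1 - cdf (distOf φ) τ ∧
      1 - cdf (distOf φ) τ ≤ Real.exp (v + δ) * (bₒ - τ) := by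
  have e : ∀ C : ℝ, C * (bₒ - τ) = ∫ _ in Icc τ bₒ, C := by
    intro C
    simp [hτb, mul_comm]
  have hi2 := (h.concaveOn_Icc hb haτ).integrableOn_exp
  rw [h.one_sub_cdf_eq_setIntegral hb haτ, e, e]
  constructor
  · refine setIntegral_mono_on (by simp) hi2 measurableSet_Icc fun z hz => Real.exp_le_exp.2 ?_
    linarith [(abs_le.1 (hv z hz)).1]
  · refine setIntegral_mono_on hi2 (by simp) measurableSet_Icc fun z hz => Real.exp_le_exp.2 ?_
    linarith [(abs_le.1 (hv z hz)).2]

/-- The range is determined by the extreme observations. Different high-probability statements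
therefore concern the same function, and consistency can be stated for all such `g`. -/
lemma GoodMLE.eq_of_eq {n : ℕ} {x : Fin n → ℝ} {M a b a' b' : ℝ} {g g' : ℝ → ℝ}
    (h₁ : GoodMLE φ bₒ x M a b g) (h₂ : GoodMLE φ bₒ x M a' b' g') :
    a = a' ∧ b = b' ∧ ∀ z ∈ Icc a b, g z = g' z := by
  obtain ⟨i, hi⟩ := h₁.isMLEOn.exists_left
  obtain ⟨j, hj⟩ := h₁.isMLEOn.exists_right
  obtain ⟨i', hi'⟩ := h₂.isMLEOn.exists_left
  obtain ⟨j', hj'⟩ := h₂.isMLEOn.exists_right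
  have ha : a = a' := le_antisymm (hi' ▸ (h₁.isMLEOn.mem i').1) (hi ▸ (h₂.isMLEOn.mem i).1)
  have hb : b = b' := le_antisymm (hj ▸ (h₂.isMLEOn.mem j).2) (hj' ▸ (h₁.isMLEOn.mem j').2)
  subst ha hb
  refine ⟨rfl, rfl, fun z hz => ?_⟩
  have := (h₁.coe_eq z hz).symm.trans (h₂.coe_eq z hz)
  exact_mod_cast this

variable {Ω : Type*} [MeasurableSpace Ω] {μ : Measure Ω} {X : ℕ → Ω → ℝ}

/-- Consistency on compact subintervals of the interior of the support, for estimators which are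
bounded by `M`. -/
def IsConsistent (φ : ℝ → EReal) (aₒ : EReal) (bₒ : ℝ) (μ : Measure Ω) (X : ℕ → Ω → ℝ) (M : ℝ) :
    Prop :=
  ∀ c d ε : ℝ, aₒ < c → c < d → d < bₒ → 0 < ε → ∀ᶠ p in withHighProb μ,
    (∃ a b g, GoodMLE φ bₒ (obs X p) M a b g) ∧
    ∀ a b g, GoodMLE φ bₒ (obs X p) M a b g →
      a < c ∧ d < b ∧ ∀ z ∈ Icc c d, |g z - (φ z).toReal| ≤ ε

lemma exists_isConsistent [IsProbabilityMeasure μ] (h : IsLogConcaveModel φ aₒ bₒ)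
    (hX : IsIIDSample μ X (distOf φ)) : ∃ M, IsConsistent φ aₒ bₒ μ X M := by
  obtain ⟨M, hM⟩ := h.exists_uniform hX
  refine ⟨M, fun c d ε hac hcd hdb hε => ?_⟩
  filter_upwards [hM c d ε hac hcd hdb hε] with p ⟨a, b, g, ha, hb, hg, hgφ⟩
  refine ⟨⟨a, b, g, hg⟩, fun a' b' g' hg' => ?_⟩
  obtain ⟨rfl, rfl, he⟩ := hg'.eq_of_eq hg
  exact ⟨ha, hb, fun z hz => by
    rw [he z ⟨ha.le.trans hz.1, hz.2.trans hb.le⟩]; exact hgφ z hz⟩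

/-- Near a right endpoint with positive density, the estimator is not much larger than the
log-density there. -/
lemma IsConsistent.exists_upper {M : ℝ} (hM : IsConsistent φ aₒ bₒ μ X M)
    (h : IsLogConcaveModel φ aₒ bₒ) (hb : φ bₒ ≠ ⊥) {c δ : ℝ}
    (hac : aₒ < c) (hcb : c < bₒ) (hδ : 0 < δ) :
    ∃ d, c < d ∧ d < bₒ ∧ (∀ z ∈ Icc d bₒ, |(φ z).toReal - (φ bₒ).toReal| ≤ δ) ∧
      ∀ᶠ p in withHighProb μ, ∀ a b g, GoodMLE φ bₒ (obs X p) M a b g →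
        a < c ∧ d < b ∧ ∀ z ∈ Icc d b, g z ≤ (φ bₒ).toReal + δ := by
  set v := (φ bₒ).toReal with hv
  set r : ℝ → ℝ := fun z => (φ z).toReal with hr
  -- The chord of the estimator over `[c, d]` rises by at most `|v - φ(c)| + 3`, the `3` collecting
  -- three errors of at most one. Extrapolating it over the remaining length `bₒ - d` costs little
  -- when `d` is close to `bₒ`.
  have hlim : Tendsto (fun d => (bₒ - d) * ((|v - r c| + 3) / (d - c))) (𝓝[<] bₒ) (𝓝 0) := by
    have : Tendsto (fun d => (bₒ - d) * ((|v - r c| + 3) / (d - c))) (𝓝 bₒ)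
        (𝓝 ((bₒ - bₒ) * ((|v - r c| + 3) / (bₒ - c)))) := by
      refine ContinuousAt.tendsto (f := fun d => (bₒ - d) * ((|v - r c| + 3) / (d - c))) ?_
      have : bₒ - c ≠ 0 := (sub_pos.2 hcb).ne'
      fun_prop (disch := assumption)
    rw [sub_self, zero_mul] at this
    exact this.mono_left nhdsWithin_le_nhds
  set δ' := min 1 (δ / 3) with hδ'
  have hδ'0 : 0 < δ' := by positivity
  have hδ'1 : δ' ≤ 1 := min_le_left _ _
  have hδ'2 : δ' ≤ δ / 3 := min_le_right _ _
  obtain ⟨d, hd1, hd2, hd3⟩ := ((h.eventually_abs_sub_le hb hδ'0).and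
    ((hlim.eventually (gt_mem_nhds (show 0 < δ / 3 by positivity))).and
      (Ioo_mem_nhdsLT hcb))).exists
  refine ⟨d, hd3.1, hd3.2, fun z hz => (hd1 z hz).trans (by linarith), ?_⟩
  filter_upwards [hM c d δ' hac hd3.1 hd3.2 hδ'0] with p ⟨_, hp⟩ a b g hg
  obtain ⟨ha, hb', hgφ⟩ := hp a b g hg
  refine ⟨ha, hb', fun z hz => ?_⟩
  have h1 := hg.isMLEOn.concaveOn.le_extrapolation (c := c) (d := d) (x := z)
    ⟨ha.le, hd3.1.le.trans hb'.le⟩ ⟨by linarith [hd3.1, hz.1], hz.2⟩ hd3.1 hz.1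
  have h2 := abs_le.1 (hgφ c ⟨le_rfl, hd3.1.le⟩)
  have h3 := abs_le.1 (hgφ d ⟨hd3.1.le, le_rfl⟩)
  have h4 := abs_le.1 (hd1 d ⟨le_rfl, hd3.2.le⟩)
  have h5 : g d - g c ≤ |v - r c| + 3 := by
    have := le_abs_self (v - r c)
    simp only [hr, hv] at this ⊢
    linarith
  have hdc : 0 < d - c := sub_pos.2 hd3.1
  have h6 : (z - d) * ((g d - g c) / (d - c)) ≤ (bₒ - d) * ((|v - r c| + 3) / (d - c)) := by
    refine (mul_le_mul_of_nonneg_left (div_le_div_of_nonneg_right h5 hdc.le)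
      (sub_nonneg.2 hz.1)).trans ?_
    refine mul_le_mul_of_nonneg_right (by linarith [hg.le_right, hz.2]) (by positivity)
  linarith

end IsLogConcaveModel
end

/-! ### Lower bound near an endpoint with positive density: part (b) -/

section
open Set

/-- At a knot `τ`, a low value of the estimator at a point `β` of the next affine piece makes
the mean excess over `τ` small. -/
lemma IsMLEOn.empMean_max_sub_le_of_lt {n : ℕ} {x : Fin n → ℝ} {a b : ℝ} {g : ℝ → ℝ}
    (h : IsMLEOn x a b g) {τ β e v δ ε s : ℝ} (hτ : IsKnot a b g τ) (haτ : a ≤ τ) (hτβ : τ ≤ β)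
    (hβb : β ≤ b) (hbe : b ≤ e) (hδ : 0 ≤ δ) (hε : 0 ≤ ε)
    (haff : ∀ z ∈ Icc τ β, g z = g τ + s * (z - τ)) (hup : ∀ z ∈ Icc τ b, g z ≤ v + δ)
    (hlow : g β < v - ε) {y : ℝ} (hy : y ∈ Icc a τ) (hyβ : g β < g y) :
    empMean x (fun z => max (z - τ) 0) ≤
      Real.exp (v + δ) * ((e - τ) ^ 2 / 8) * (1 + 3 * Real.exp (-ε / 2)) := by
  have hyab : y ∈ Icc a b := ⟨hy.1, hy.2.trans (hτβ.trans hβb)⟩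
  have hβab : β ∈ Icc a b := ⟨haτ.trans hτβ, hβb⟩
  have hgτ : g β ≤ g τ := by
    have := h.concaveOn.min_le_of_mem_Icc hyab hβab (z := τ) ⟨hy.2, hτβ⟩
    rwa [min_eq_right hyβ.le] at this
  refine (h.empMean_max_sub_le hτ).trans ?_
  -- Split at the midpoint of `[τ, e]`. The right half carries three quarters of the weight `z - τ`,
  -- and there `g ≤ v + δ - ε / 2`: before `β` by averaging along the affine piece, after `β`
  -- because `g` decreases.
  refine (setIntegral_max_sub_mul_le (m := (τ + e) / 2) (e := e) (A := Real.exp (v + δ))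
    (B := Real.exp (v + δ) * Real.exp (-ε / 2)) (by linarith) (by linarith) hbe
    (Real.exp_pos _).le (by positivity) (h.integrableOn_max_sub_mul_exp τ) ?_ ?_).trans
    (le_of_eq (by ring))
  · exact fun z hz hτz _ => Real.exp_le_exp.2 (hup z ⟨hτz, hz.2⟩)
  · intro z hz hmz
    rw [← Real.exp_add]
    refine Real.exp_le_exp.2 ?_
    rcases le_total β z with hβz | hβz
    · have : g z ≤ g β := by
        by_contra! hc
        have := h.concaveOn.min_le_of_mem_Icc hyab hz (z := β) ⟨hy.2.trans hτβ, hβz⟩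
        exact absurd this (not_le.2 (lt_min hyβ hc))
      linarith
    · have hτz : τ ≤ z := by linarith
      have h1 := haff z ⟨hτz, hβz⟩
      have h2 := haff β ⟨hτβ, le_rfl⟩
      have h3 := hup τ ⟨le_rfl, hτβ.trans hβb⟩
      rcases hτβ.eq_or_lt with rfl | hlt
      · obtain rfl : z = τ := le_antisymm hβz hτz
        linarith
      have hs : s ≤ 0 := by
        by_contra! hs
        nlinarith
      nlinarith

namespace IsLogConcaveModel

variable {φ : ℝ → EReal} {aₒ : EReal} {bₒ : ℝ} {Ω : Type*} [MeasurableSpace Ω] {μ : Measure Ω}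
  {X : ℕ → Ω → ℝ}

/-- The excess over `y`, scaled and truncated to take values in `[0, 1]`. -/
noncomputable def scaledExcess (y e z : ℝ) : ℝ := min 1 (max (z - y) 0 / (e - y))

lemma scaledExcess_mem (y e z : ℝ) (hye : y < e) : scaledExcess y e z ∈ Icc 0 1 :=
  ⟨le_min zero_le_one (div_nonneg (le_max_right _ _) (sub_nonneg.2 hye.le)), min_le_left _ _⟩

lemma measurable_scaledExcess (y e : ℝ) : Measurable (scaledExcess y e) := by
  unfold scaledExcess; fun_prop

lemma scaledExcess_eq {y e z : ℝ} (hye : y < e) (hz : z ≤ e) :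
    scaledExcess y e z = (e - y)⁻¹ * max (z - y) 0 := by
  rw [scaledExcess, min_eq_right, div_eq_inv_mul]
  rw [div_le_one (sub_pos.2 hye)]
  exact max_le (by linarith) (sub_nonneg.2 hye.le)

lemma integral_scaledExcess (h : IsLogConcaveModel φ aₒ bₒ) {y : ℝ} (hyb : y < bₒ) :
    ∫ z, scaledExcess y bₒ z ∂(distOf φ) = (bₒ - y)⁻¹ * meanExcess φ y := by
  rw [meanExcess, ← integral_const_mul]
  refine integral_congr_ae ?_
  have h1 : ∀ᵐ z ∂(distOf φ), z ∈ {z | φ z ≠ ⊥ ∧ z ≤ bₒ} := by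
    rw [ae_iff]; exact h.distOf_bot
  filter_upwards [h1] with z hz
  exact scaledExcess_eq hyb hz.2

/-- The truncated excess agrees with the scaled excess on the support, and its mean is at most of
the order of `bₒ - y`, so the exponential inequality is adapted to the distance from the endpoint.
-/
lemma measure_scaledExcess_le [IsProbabilityMeasure μ] (h : IsLogConcaveModel φ aₒ bₒ)
    (hX : IsIIDSample μ X (distOf φ)) (hb : φ bₒ ≠ ⊥) {y v δ t : ℝ} (hay : aₒ < y) (hyb : y < bₒ)
    (hv : ∀ z ∈ Icc y bₒ, |(φ z).toReal - v| ≤ δ) {n : ℕ} (hn : n ≠ 0) (ht : 0 ≤ t)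
    (ht' : t ≤ 2 * (Real.exp (v + δ) * (bₒ - y))) :
    μ {ω | t ≤ |empMean (obs X (n, ω)) (scaledExcess y bₒ) - (bₒ - y)⁻¹ * meanExcess φ y|} ≤
      ENNReal.ofReal (2 * Real.exp (-(n * t ^ 2 / (4 * (Real.exp (v + δ) * (bₒ - y)))))) := by
  have hpos : 0 < bₒ - y := sub_pos.2 hyb
  have hm := (h.meanExcess_mem hb hay hyb.le hv).2
  rw [← h.integral_scaledExcess hyb]
  refine hX.measure_abs_sub_ge_le (measurable_scaledExcess y bₒ)
    (fun z => scaledExcess_mem y bₒ z hyb) hn (by positivity) ?_ ht ht'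
  rw [h.integral_scaledExcess hyb, inv_mul_le_iff₀ hpos]
  have : 0 < Real.exp (v + δ) * (bₒ - y) ^ 2 := by positivity
  nlinarith

lemma eventually_le_right [IsProbabilityMeasure μ] (h : IsLogConcaveModel φ aₒ bₒ)
    (hX : IsIIDSample μ X (distOf φ)) : ∀ᶠ p in withHighProb μ, ∀ i, obs X p i ≤ bₒ := by
  have hmeas : MeasurableSet {z | φ z ≠ ⊥ ∧ z ≤ bₒ} :=
    (h.measurable (measurableSet_singleton ⊥).compl).inter measurableSet_Iic
  filter_upwards [hX.ae_mem hmeas h.distOf_bot] with p hp i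
  exact (hp i).2

lemma empMean_max_sub_anti {n : ℕ} (x : Fin n → ℝ) {y y' : ℝ} (hy : y ≤ y') :
    empMean x (fun z => max (z - y') 0) ≤ empMean x (fun z => max (z - y) 0) :=
  empMean_mono fun _ => max_le_max (by linarith) le_rfl

lemma empMean_max_sub_eq {n : ℕ} {x : Fin n → ℝ} (hx : ∀ i, x i ≤ bₒ) {y : ℝ} (hy : y < bₒ) :
    empMean x (fun z => max (z - y) 0) = (bₒ - y) * empMean x (scaledExcess y bₒ) := by
  rw [← empMean_const_mul]
  refine empMean_congr fun i => ?_
  rw [scaledExcess_eq hy (hx i), mul_inv_cancel_left₀ (sub_pos.2 hy).ne']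

/-- A lower bound for the empirical mean excess, uniformly over an interval which approaches the
right endpoint of the support. -/
lemma eventually_empMean_max_sub_ge [IsProbabilityMeasure μ] (h : IsLogConcaveModel φ aₒ bₒ)
    (hX : IsIIDSample μ X (distOf φ)) (hb : φ bₒ ≠ ⊥) {d v δ : ℝ} (had : aₒ < d)
    (hδ0 : 0 < δ) (hδ1 : δ < 1) (hv : ∀ z ∈ Icc d bₒ, |(φ z).toReal - v| ≤ δ) {t : ℕ → ℝ}
    (ht : ∀ n, t n < bₒ) (hlim : Tendsto (fun n : ℕ => n * (bₒ - t n)) atTop atTop) :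
    ∀ᶠ p in withHighProb μ, ∀ τ ∈ Icc d (t p.1),
      (1 - δ) / (1 + δ) ^ 2 * (Real.exp (v - δ) * ((bₒ - τ) ^ 2 / 2)) ≤
        empMean (obs X p) fun z => max (z - τ) 0 := by
  set ρ : ℝ := (1 + δ)⁻¹ with hρ
  have hρ0 : 0 < ρ := by positivity
  have hρ1 : ρ < 1 := inv_lt_one_of_one_lt₀ (by linarith)
  set C : ℝ := δ ^ 2 * Real.exp (v - 3 * δ) / 16 with hC
  have hC0 : 0 < C := by positivity
  -- Distances to `bₒ` grow geometrically along this grid, so the failure probabilities form a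
  -- geometric series with sum of order `1 / (n (bₒ - t n))`.
  set y : ℕ → ℕ → ℝ := fun n k => bₒ - (bₒ - t n) * (1 + δ) ^ k with hy
  have hyb : ∀ n k, 0 < bₒ - y n k := fun n k => by
    have := sub_pos.2 (ht n)
    simp only [hy, sub_sub_cancel]
    positivity
  have hm0 : ∀ n k, d ≤ y n k → Real.exp (v - δ) * ((bₒ - y n k) / 2) ≤
      (bₒ - y n k)⁻¹ * meanExcess φ (y n k) := by
    intro n k hk
    have h1 := (h.meanExcess_mem hb (had.trans_le (EReal.coe_le_coe_iff.2 hk))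
      (sub_pos.1 (hyb n k)).le fun z hz => hv z ⟨hk.trans hz.1, hz.2⟩).1
    rw [le_inv_mul_iff₀ (hyb n k)]
    linarith
  have hgrid : ∀ᶠ p in withHighProb μ, ∀ k, d ≤ y p.1 k →
      |empMean (obs X p) (scaledExcess (y p.1 k) bₒ) -
        (bₒ - y p.1 k)⁻¹ * meanExcess φ (y p.1 k)| <
        δ * ((bₒ - y p.1 k)⁻¹ * meanExcess φ (y p.1 k)) := by
    rw [eventually_withHighProb]
    have hzero : Tendsto (fun n : ℕ => ENNReal.ofReal (2 / C * (n * (bₒ - t n))⁻¹ * (1 - ρ)⁻¹))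
        atTop (𝓝 0) := by
      have := ((tendsto_inv_atTop_zero.comp hlim).const_mul (2 / C)).mul_const ((1 - ρ)⁻¹)
      rw [mul_zero, zero_mul] at this
      simpa using ENNReal.tendsto_ofReal this
    refine tendsto_of_tendsto_of_tendsto_of_le_of_le' tendsto_const_nhds hzero
      (Eventually.of_forall fun _ => zero_le) ?_
    filter_upwards [eventually_ne_atTop 0] with n hn
    have hn0 : (0 : ℝ) < n := by exact_mod_cast Nat.pos_of_ne_zero hn
    have hη := sub_pos.2 (ht n)
    set bad : ℕ → Set Ω := fun k => {ω | d ≤ y n k ∧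
      δ * ((bₒ - y n k)⁻¹ * meanExcess φ (y n k)) ≤
        |empMean (obs X (n, ω)) (scaledExcess (y n k) bₒ) -
          (bₒ - y n k)⁻¹ * meanExcess φ (y n k)|} with hbad
    have hsub : {ω | ¬ ∀ k, d ≤ y n k →
        |empMean (obs X (n, ω)) (scaledExcess (y n k) bₒ) -
          (bₒ - y n k)⁻¹ * meanExcess φ (y n k)| <
          δ * ((bₒ - y n k)⁻¹ * meanExcess φ (y n k))} ⊆ ⋃ k, bad k := by
      intro ω hω
      simp only [mem_ofPred_eq, not_forall, not_lt] at hω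
      obtain ⟨k, hk1, hk2⟩ := hω
      exact mem_iUnion.2 ⟨k, hk1, hk2⟩
    have hone : ∀ k, μ (bad k) ≤ ENNReal.ofReal (2 / C * (n * (bₒ - t n))⁻¹ * ρ ^ k) := by
      intro k
      by_cases hk : d ≤ y n k
      swap
      · have : bad k = ∅ := eq_empty_of_forall_notMem fun ω hω => hk hω.1
        rw [this, measure_empty]
        exact zero_le
      set H := bₒ - y n k with hH
      have hHpos : 0 < H := hyb n k
      set m := H⁻¹ * meanExcess φ (y n k) with hmdef
      have hm := hm0 n k hk
      have hmpos : 0 < m := lt_of_lt_of_le (by positivity) hm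
      have hay := had.trans_le (EReal.coe_le_coe_iff.2 hk)
      have hvy : ∀ z ∈ Icc (y n k) bₒ, |(φ z).toReal - v| ≤ δ := fun z hz =>
        hv z ⟨hk.trans hz.1, hz.2⟩
      have hmle : m ≤ Real.exp (v + δ) * H := by
        have h1 := (h.meanExcess_mem hb hay (sub_pos.1 (hyb n k)).le hvy).2
        rw [hmdef, inv_mul_le_iff₀ hHpos]
        have : 0 < Real.exp (v + δ) * H ^ 2 := by positivity
        simp only [← hH] at h1
        nlinarith
      have hμ := h.measure_scaledExcess_le hX hb hay (sub_pos.1 (hyb n k)) hvy hn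
        (t := δ * m) (by positivity) (by nlinarith)
      refine (measure_mono fun ω hω => hω.2).trans (hμ.trans (ENNReal.ofReal_le_ofReal ?_))
      have hHeq : H = (bₒ - t n) * (1 + δ) ^ k := by simp only [hH, hy, sub_sub_cancel]
      have hexp : C * (n * H) ≤ n * (δ * m) ^ 2 / (4 * (Real.exp (v + δ) * H)) := by
        rw [le_div_iff₀ (by positivity)]
        have h2 : (Real.exp (v - δ) * (H / 2)) ^ 2 ≤ m ^ 2 :=
          pow_le_pow_left₀ (by positivity) hm 2
        have h3 : Real.exp (v - 3 * δ) * Real.exp (v + δ) = Real.exp (v - δ) ^ 2 := by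
          rw [← Real.exp_add, ← Real.exp_nat_mul]; congr 1; push_cast; ring
        calc C * (n * H) * (4 * (Real.exp (v + δ) * H)) =
            n * δ ^ 2 * (Real.exp (v - 3 * δ) * Real.exp (v + δ)) * (H / 2) ^ 2 := by
              rw [hC]; ring
          _ = n * δ ^ 2 * (Real.exp (v - δ) * (H / 2)) ^ 2 := by rw [h3]; ring
          _ ≤ n * δ ^ 2 * m ^ 2 := mul_le_mul_of_nonneg_left h2 (by positivity)
          _ = _ := by ring
      have hCpos : 0 < C * (n * H) := by positivity
      calc 2 * Real.exp (-(n * (δ * m) ^ 2 / (4 * (Real.exp (v + δ) * H))))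
          ≤ 2 * Real.exp (-(C * (n * H))) := by
            refine mul_le_mul_of_nonneg_left (Real.exp_le_exp.2 (neg_le_neg hexp)) zero_le_two
        -- The crude bound `e^(-x) ≤ 1 / x` is enough, because `H` grows geometrically in `k`.
        _ ≤ 2 * (C * (n * H))⁻¹ := by
            rw [Real.exp_neg]
            refine mul_le_mul_of_nonneg_left (inv_anti₀ hCpos ?_) zero_le_two
            linarith [Real.add_one_le_exp (C * (n * H))]
        _ = _ := by
            rw [hHeq, hρ, inv_pow]
            field_simp
    calc _ ≤ μ (⋃ k, bad k) := measure_mono hsub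
      _ ≤ ∑' k, μ (bad k) := measure_iUnion_le _
      _ ≤ ∑' k, ENNReal.ofReal (2 / C * (n * (bₒ - t n))⁻¹ * ρ ^ k) := ENNReal.tsum_le_tsum hone
      _ = ENNReal.ofReal (∑' k, 2 / C * (n * (bₒ - t n))⁻¹ * ρ ^ k) :=
          (ENNReal.ofReal_tsum_of_nonneg (fun k => by positivity)
            ((summable_geometric_of_lt_one hρ0.le hρ1).mul_left _)).symm
      _ = _ := by rw [tsum_mul_left, tsum_geometric_of_lt_one hρ0.le hρ1]
  filter_upwards [hgrid, h.eventually_le_right hX] with p hp hle τ hτ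
  have hη := sub_pos.2 (ht p.1)
  -- Replacing `τ` by a grid point to its right lowers the excess and changes the distance to `bₒ`
  -- by a factor of at most `1 + δ`, hence the factor `(1 + δ)²`.
  obtain ⟨k, hk1, hk2⟩ := exists_nat_pow_near (x := (bₒ - τ) / (bₒ - t p.1)) (y := 1 + δ)
    (by rw [one_le_div hη]; linarith [hτ.2]) (by linarith)
  rw [le_div_iff₀ hη] at hk1
  rw [div_lt_iff₀ hη] at hk2
  have hyτ : τ ≤ y p.1 k := by simp only [hy]; linarith
  have hdy : d ≤ y p.1 k := hτ.1.trans hyτ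
  set H := bₒ - y p.1 k with hH
  have hHpos : 0 < H := hyb _ _
  have hHeq : H = (bₒ - t p.1) * (1 + δ) ^ k := by simp only [hH, hy, sub_sub_cancel]
  have h1 := (abs_lt.1 (hp k hdy)).1
  have h2 := hm0 p.1 k hdy
  have h3 : bₒ - τ ≤ (1 + δ) * H := by rw [hHeq]; rw [pow_succ] at hk2; linarith
  have h4 : (bₒ - τ) ^ 2 ≤ (1 + δ) ^ 2 * H ^ 2 := by
    rw [← mul_pow]
    exact pow_le_pow_left₀ (by linarith [hτ.2]) h3 2
  refine le_trans ?_ (empMean_max_sub_anti (obs X p) hyτ)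
  rw [empMean_max_sub_eq hle (sub_pos.1 (hyb _ _))]
  calc (1 - δ) / (1 + δ) ^ 2 * (Real.exp (v - δ) * ((bₒ - τ) ^ 2 / 2))
      ≤ (1 - δ) / (1 + δ) ^ 2 * (Real.exp (v - δ) * ((1 + δ) ^ 2 * H ^ 2 / 2)) := by
        have : 0 ≤ 1 - δ := by linarith
        gcongr
    _ = H * ((1 - δ) * (Real.exp (v - δ) * (H / 2))) := by field_simp
    _ ≤ H * ((1 - δ) * (H⁻¹ * meanExcess φ (y p.1 k))) := by
        refine mul_le_mul_of_nonneg_left (mul_le_mul_of_nonneg_left h2 (by linarith)) hHpos.le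
    _ ≤ _ := mul_le_mul_of_nonneg_left (by linarith) hHpos.le

lemma lt_of_empMean_max_sub_pos {n : ℕ} {x : Fin n → ℝ} {a b t : ℝ} {g : ℝ → ℝ}
    (h : IsMLEOn x a b g) (hpos : 0 < empMean x fun z => max (z - t) 0) : t < b := by
  by_contra! hbt
  have : empMean x (fun z => max (z - t) 0) = 0 := by
    rw [empMean, Finset.sum_eq_zero fun i _ => max_eq_right (by linarith [(h.mem i).2]), zero_div]
  exact hpos.ne' this

/-- At `δ = 0` the claim reads `1 + 3 e^(-ε/2) < 4` up to the factor `e^v`, so continuity suffices.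
It makes the bound for the excess at a low estimator incompatible with the empirical lower bound. -/
lemma exists_small_const {ε : ℝ} (hε : 0 < ε) : ∃ δ : ℝ, 0 < δ ∧ δ < 1 ∧ 3 * δ ≤ ε ∧
    ∀ v : ℝ, Real.exp (v + δ) * (1 + 3 * Real.exp (-ε / 2)) <
      4 * ((1 - δ) / (1 + δ) ^ 2 * Real.exp (v - δ)) := by
  have h1 : ContinuousAt (fun δ : ℝ => Real.exp δ * (1 + 3 * Real.exp (-ε / 2)) -
      4 * ((1 - δ) / (1 + δ) ^ 2 * Real.exp (-δ))) 0 := by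
    have : ((1 : ℝ) + 0) ^ 2 ≠ 0 := by norm_num
    fun_prop (disch := assumption)
  have h2 : Real.exp (-ε / 2) < 1 := Real.exp_lt_one_iff.2 (by linarith)
  have h0 : Real.exp 0 * (1 + 3 * Real.exp (-ε / 2)) -
      4 * ((1 - 0) / (1 + 0) ^ 2 * Real.exp (-0)) < 0 := by
    rw [neg_zero, Real.exp_zero]
    norm_num
    linarith
  have h3 := (h1.tendsto.eventually (gt_mem_nhds h0)).filter_mono
    (nhdsWithin_le_nhds (s := Ioi 0))
  obtain ⟨δ, hδ1, hδ2⟩ :=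
    (h3.and (Ioo_mem_nhdsGT (show (0 : ℝ) < min 1 (ε / 3) by positivity))).exists
  refine ⟨δ, hδ2.1, hδ2.2.trans_le (min_le_left _ _),
    by linarith [hδ2.2.trans_le (min_le_right _ _)], fun v => ?_⟩
  rw [Real.exp_add, sub_eq_add_neg v, Real.exp_add]
  have := mul_lt_mul_of_pos_left (sub_neg.1 hδ1) (Real.exp_pos v)
  linarith

/-- With high probability the estimator at `t n` is not much smaller than the log-density at the
right endpoint. -/
lemma IsConsistent.exists_lower [IsProbabilityMeasure μ] {M : ℝ}
    (hM : IsConsistent φ aₒ bₒ μ X M) (h : IsLogConcaveModel φ aₒ bₒ)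
    (hX : IsIIDSample μ X (distOf φ)) (hb : φ bₒ ≠ ⊥) {c ε : ℝ} (hac : aₒ < c) (hcb : c < bₒ)
    (hε : 0 < ε) {t : ℕ → ℝ} (ht : ∀ n, t n < bₒ) (htlim : Tendsto t atTop (𝓝 bₒ))
    (hlim : Tendsto (fun n : ℕ => n * (bₒ - t n)) atTop atTop) :
    ∃ d, c < d ∧ d < bₒ ∧ (∀ z ∈ Icc d bₒ, |(φ z).toReal - (φ bₒ).toReal| ≤ ε) ∧
      ∀ᶠ p in withHighProb μ, ∀ a b g, GoodMLE φ bₒ (obs X p) M a b g →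
        a < c ∧ t p.1 < b ∧ ∀ z ∈ Icc d (t p.1), |g z - (φ bₒ).toReal| ≤ ε := by
  set v := (φ bₒ).toReal with hv
  obtain ⟨δ, hδ0, hδ1, hδε, hδ⟩ := exists_small_const hε
  obtain ⟨d, hcd, hdb, hnear, hup⟩ := hM.exists_upper h hb hac hcb hδ0
  have had : aₒ < (d : EReal) := hac.trans (EReal.coe_lt_coe_iff.2 hcd)
  -- The stretch beyond `e` is so short that an affine function with a drop of at most `4δ` over
  -- `[d, e]` loses at most `δ` more before reaching `bₒ`.
  set e := bₒ - δ * (bₒ - d) / 8 with he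
  have hbd : 0 < bₒ - d := sub_pos.2 hdb
  have heb : e < bₒ := by
    have : 0 < δ * (bₒ - d) / 8 := by positivity
    linarith
  have hed : (bₒ - d) / 2 ≤ e - d := by nlinarith
  have hde : d < e := by linarith
  have hbe : bₒ - e ≤ δ * (e - d) / 4 := by nlinarith
  refine ⟨d, hcd, hdb, fun z hz => (hnear z hz).trans (by linarith), ?_⟩
  filter_upwards [hup, hM d e δ had hde heb hδ0,
    h.eventually_empMean_max_sub_ge hX hb had hδ0 hδ1 hnear ht hlim,
    (tendsto_fst_withHighProb μ).eventually (htlim.eventually (lt_mem_nhds heb))]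
    with p hup ⟨_, hIC⟩ hexc hte a b g hg
  obtain ⟨hac', hdb', hgv⟩ := hup a b g hg
  obtain ⟨-, heb', hgφ⟩ := hIC a b g hg
  have hmle := hg.isMLEOn
  have htb : t p.1 < b := by
    refine lt_of_empMean_max_sub_pos hmle (lt_of_lt_of_le ?_ (hexc (t p.1)
      ⟨by linarith, le_rfl⟩))
    have h1 : 0 < 1 - δ := by linarith
    have h2 := sub_pos.2 (ht p.1)
    positivity
  have hgd := abs_le.1 (hgφ d ⟨le_rfl, hde.le⟩)
  have hge := abs_le.1 (hgφ e ⟨hde.le, le_rfl⟩)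
  have hrd := abs_le.1 (hnear d ⟨le_rfl, hdb.le⟩)
  have hre := abs_le.1 (hnear e ⟨hde.le, heb.le⟩)
  have hlow : v - ε ≤ g (t p.1) := by
    obtain ⟨q, τ, s, htq, hqb, hdτ, hτt, haff, hcase⟩ :=
      hmle.exists_knot (c := d) (β := t p.1) (by linarith) (by linarith) htb
    rcases hcase with rfl | hknot
    · have h1 := haff e ⟨hde.le, by linarith⟩
      have h2 := haff (t p.1) ⟨by linarith, htq.le⟩
      have h3 : -(4 * δ) ≤ s * (e - τ) := by linarith
      have h4 : -δ ≤ s * (t p.1 - e) := by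
        rcases le_or_gt 0 s with hs | hs
        · have := mul_nonneg hs (by linarith : 0 ≤ t p.1 - e)
          linarith
        · have h5 : t p.1 - e ≤ (e - τ) / 4 * δ := by linarith [ht p.1]
          have h6 : s * ((e - τ) / 4 * δ) ≤ s * (t p.1 - e) :=
            mul_le_mul_of_nonpos_left h5 hs.le
          nlinarith
      linarith
    -- The excess over the last knot is bounded above by the low value at `t` and below by the
    -- uniform law; `hδ` separates the two bounds.
    · by_contra! hlt
      have h1 := hmle.empMean_max_sub_le_of_lt (β := t p.1) (e := bₒ) (v := v) hknot
        (by linarith) hτt htb.le hg.le_right hδ0.le hε.le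
        (fun z hz => haff z ⟨hz.1, hz.2.trans htq.le⟩) (fun z hz => hgv z ⟨hdτ.trans hz.1, hz.2⟩)
        hlt (y := d) ⟨by linarith, hdτ⟩ (by linarith)
      have h2 := (hexc τ ⟨hdτ, hτt⟩).trans h1
      have h3 := mul_lt_mul_of_pos_right (hδ v) (show 0 < (bₒ - τ) ^ 2 / 8 by
        have := sub_pos.2 (hτt.trans_lt (ht p.1))
        positivity)
      have h4 : 4 * ((1 - δ) / (1 + δ) ^ 2 * Real.exp (v - δ)) * ((bₒ - τ) ^ 2 / 8) =
        (1 - δ) / (1 + δ) ^ 2 * (Real.exp (v - δ) * ((bₒ - τ) ^ 2 / 2)) := by ring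
      rw [h4] at h3
      linarith
  refine ⟨hac', htb, fun z hz => abs_le.2 ⟨?_, ?_⟩⟩
  · have := hmle.concaveOn.min_le_of_mem_Icc (x := d) (y := t p.1) (z := z)
      ⟨by linarith, hdb'.le⟩ ⟨by linarith, htb.le⟩ hz
    have h1 : v - ε ≤ min (g d) (g (t p.1)) := le_min (by linarith) hlow
    linarith
  · linarith [hgv z ⟨hz.1, hz.2.trans htb.le⟩]

/-- Near `bₒ` the density is bounded, so the tail probability is at most a constant times the
distance to `bₒ`. -/
lemma tendsto_nat_mul_sub (h : IsLogConcaveModel φ aₒ bₒ) (hb : φ bₒ ≠ ⊥) {t : ℕ → ℝ}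
    (ht : ∀ n, aₒ < t n ∧ t n < bₒ) (htlim : Tendsto t atTop (𝓝 bₒ))
    {w : ℕ → ℝ} (hw : ∀ n, 0 ≤ w n)
    (hlim : Tendsto (fun n : ℕ => w n * (1 - cdf (distOf φ) (t n))) atTop atTop) :
    Tendsto (fun n : ℕ => w n * (bₒ - t n)) atTop atTop := by
  set v := (φ bₒ).toReal
  have hnear :=
    (tendsto_nhdsWithin_iff.2 ⟨htlim, Eventually.of_forall fun n => (ht n).2⟩).eventually
    (h.eventually_abs_sub_le hb one_pos)
  have h1 : Tendsto (fun n : ℕ => Real.exp (-(v + 1)) * (w n * (1 - cdf (distOf φ) (t n))))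
      atTop atTop := hlim.const_mul_atTop (Real.exp_pos _)
  refine tendsto_atTop_mono' atTop ?_ h1
  filter_upwards [hnear] with n hn
  have h2 := (h.one_sub_cdf_mem hb (ht n).1 (ht n).2.le hn).2
  have h3 : Real.exp (-(v + 1)) * Real.exp (v + 1) = 1 := by rw [← Real.exp_add]; simp
  calc Real.exp (-(v + 1)) * (w n * (1 - cdf (distOf φ) (t n)))
      ≤ Real.exp (-(v + 1)) * (w n * (Real.exp (v + 1) * (bₒ - t n))) :=
        mul_le_mul_of_nonneg_left (mul_le_mul_of_nonneg_left h2 (hw n)) (Real.exp_pos _).le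
    _ = (Real.exp (-(v + 1)) * Real.exp (v + 1)) * (w n * (bₒ - t n)) := by ring
    _ = _ := by rw [h3, one_mul]

theorem tendsto_supDist [IsProbabilityMeasure μ] (h : IsLogConcaveModel φ aₒ bₒ)
    (hX : IsIIDSample μ X (distOf φ)) (hb : φ bₒ ≠ ⊥) {c : ℝ} (hac : aₒ < c) (hcb : c < bₒ)
    {t : ℕ → ℝ} (ht : ∀ n, aₒ < t n ∧ t n < bₒ) (htlim : Tendsto t atTop (𝓝 bₒ))
    (hlim : Tendsto (fun n : ℕ => n * (1 - cdf (distOf φ) (t n))) atTop atTop) :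
    Tendsto (fun p : ℕ × Ω => supDist (Icc c (t p.1)) (logConcaveMLE (obs X p)) φ)
      (withHighProb μ) (𝓝 0) := by
  obtain ⟨M, hM⟩ := h.exists_isConsistent hX
  rw [ENNReal.tendsto_nhds_zero]
  intro ε hε
  obtain ⟨ε', hε'0, hε'⟩ : ∃ ε' : ℝ, 0 < ε' ∧ ENNReal.ofReal ε' ≤ ε := by
    rcases eq_or_ne ε ⊤ with rfl | hne
    · exact ⟨1, one_pos, le_top⟩
    · exact ⟨ε.toReal, ENNReal.toReal_pos hε.ne' hne, (ENNReal.ofReal_toReal hne).le⟩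
  obtain ⟨d, hcd, hdb, hnear, hev⟩ := hM.exists_lower h hX hb hac hcb (half_pos hε'0)
    (fun n => (ht n).2) htlim (h.tendsto_nat_mul_sub hb ht htlim (fun n => n.cast_nonneg) hlim)
  filter_upwards [hev, hM c d ε' hac hcd hdb hε'0] with p hp ⟨⟨a, b, g, hg⟩, hIC⟩
  obtain ⟨hac', htb, hgv⟩ := hp a b g hg
  obtain ⟨-, hdb', hgφ⟩ := hIC a b g hg
  refine le_trans (iSup₂_le fun x hx => ?_) hε'
  have hxm : x ∈ Icc a b := ⟨by linarith [hx.1], by linarith [hx.2]⟩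
  rw [hg.coe_eq x hxm, ← h.isLogDensity.1.coe_toReal (hg.ne_bot x hxm), EReal.abs_coe_sub_coe]
  refine ENNReal.ofReal_le_ofReal ?_
  rcases le_total x d with hxd | hxd
  · exact hgφ x ⟨hx.1, hxd⟩
  · have h1 := hgv x ⟨hxd, hx.2⟩
    have h2 := hnear x ⟨hxd, hxm.2.trans hg.le_right⟩
    have e : g x - (φ x).toReal = (g x - (φ bₒ).toReal) - ((φ x).toReal - (φ bₒ).toReal) := by ring
    rw [e]
    exact (abs_sub _ _).trans (by linarith)

end IsLogConcaveModel
end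

/-! ### Deviation bounds near the endpoint at rate `log n / n` -/

section
open Set

namespace IsLogConcaveModel

variable {φ : ℝ → EReal} {aₒ : EReal} {bₒ : ℝ} {Ω : Type*} [MeasurableSpace Ω] {μ : Measure Ω}
  {X : ℕ → Ω → ℝ}

lemma measure_tail_le [IsProbabilityMeasure μ] (h : IsLogConcaveModel φ aₒ bₒ)
    (hX : IsIIDSample μ X (distOf φ)) (hb : φ bₒ ≠ ⊥) {y v δ t : ℝ} (hay : aₒ < y) (hyb : y < bₒ)
    (hv : ∀ z ∈ Icc y bₒ, |(φ z).toReal - v| ≤ δ) {n : ℕ} (hn : n ≠ 0) (ht : 0 ≤ t)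
    (ht' : t ≤ 2 * (Real.exp (v + δ) * (bₒ - y))) :
    μ {ω | t ≤ |empMean (obs X (n, ω)) ((Ici y).indicator 1) - (1 - cdf (distOf φ) y)|} ≤
      ENNReal.ofReal (2 * Real.exp (-(n * t ^ 2 / (4 * (Real.exp (v + δ) * (bₒ - y)))))) := by
  have hpos : 0 < bₒ - y := sub_pos.2 hyb
  have hint : ∫ z, (Ici y).indicator (1 : ℝ → ℝ) z ∂(distOf φ) = 1 - cdf (distOf φ) y := by
    rw [integral_indicator_one measurableSet_Ici, h.real_Ici]
  rw [← hint]
  refine hX.measure_abs_sub_ge_le (measurable_one.indicator measurableSet_Ici)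
    (fun z => ?_) hn (by positivity) ?_ ht ht'
  · by_cases hz : z ∈ Ici y
    · simp [indicator_of_mem hz]
    · simp [indicator_of_notMem hz]
  · rw [hint]
    exact (h.one_sub_cdf_mem hb hay hyb.le hv).2

/-- Moving the threshold by `y - τ` changes the excess by at most `y - τ`, and only beyond `τ`. -/
lemma meanExcess_le_add (h : IsLogConcaveModel φ aₒ bₒ) (hb : φ bₒ ≠ ⊥) {τ y : ℝ} (haτ : aₒ < τ)
    (hτy : τ ≤ y) :
    meanExcess φ τ ≤ meanExcess φ y + (y - τ) * (1 - cdf (distOf φ) τ) := by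
  have hexp := (h.concaveOn_Icc hb haτ).integrableOn_exp
  have hi : ∀ s, IntegrableOn (fun z => max (z - s) 0 * Real.exp (φ z).toReal) (Icc τ bₒ) :=
    fun s => hexp.continuousOn_mul (by fun_prop) isCompact_Icc
  rw [h.one_sub_cdf_eq_setIntegral hb haτ, ← integral_const_mul, meanExcess, meanExcess,
    h.integral_eq_setIntegral hb haτ _ fun z hz => max_eq_right (by linarith),
    h.integral_eq_setIntegral hb haτ _ fun z hz => max_eq_right (by linarith),
    ← integral_add (hi y) (hexp.const_mul _)]
  refine setIntegral_mono_on (hi τ) ((hi y).add (hexp.const_mul _)) measurableSet_Icc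
    fun z hz => ?_
  rw [← add_mul]
  refine mul_le_mul_of_nonneg_right (max_le ?_ ?_) (Real.exp_pos _).le
  · linarith [le_max_left (z - y) 0]
  · linarith [le_max_right (z - y) 0]

lemma one_sub_cdf_le_add (h : IsLogConcaveModel φ aₒ bₒ) (hb : φ bₒ ≠ ⊥) {y τ v δ : ℝ}
    (hay : aₒ < y) (hyτ : y ≤ τ) (hτb : τ ≤ bₒ) (hv : ∀ z ∈ Icc y bₒ, |(φ z).toReal - v| ≤ δ) :
    1 - cdf (distOf φ) y ≤ 1 - cdf (distOf φ) τ + Real.exp (v + δ) * (τ - y) := by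
  have hexp := (h.concaveOn_Icc hb hay).integrableOn_exp
  rw [h.one_sub_cdf_eq_setIntegral hb hay, ← Icc_union_Icc_eq_Icc hyτ hτb, add_comm]
  rw [h.one_sub_cdf_eq_setIntegral hb (hay.trans_le (EReal.coe_le_coe_iff.2 hyτ))]
  have h1 : IntegrableOn (fun z => Real.exp (φ z).toReal) (Ico y τ) :=
    hexp.mono_set (Ico_subset_Icc_self.trans (Icc_subset_Icc_right hτb))
  have h2 : IntegrableOn (fun z => Real.exp (φ z).toReal) (Icc τ bₒ) :=
    hexp.mono_set (Icc_subset_Icc_left hyτ)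
  rw [Icc_union_Icc_eq_Icc hyτ hτb, ← Ico_union_Icc_eq_Icc hyτ hτb,
    setIntegral_union (Set.disjoint_left.2 fun z hz hz' => absurd hz.2 (not_lt.2 hz'.1))
      measurableSet_Icc h1 h2]
  refine add_le_add_left ?_ _
  have e : Real.exp (v + δ) * (τ - y) = ∫ _ in Ico y τ, Real.exp (v + δ) := by
    simp [hyτ, mul_comm]
  rw [e]
  refine setIntegral_mono_on h1 (by simp) measurableSet_Ico fun z hz => Real.exp_le_exp.2 ?_
  linarith [(abs_le.1 (hv z ⟨hz.1, hz.2.le.trans hτb⟩)).2]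

/-- Uniform deviation bounds for tail counts and mean excesses over a grid of mesh `1 / n`. -/
lemma eventually_grid [IsProbabilityMeasure μ] (h : IsLogConcaveModel φ aₒ bₒ)
    (hX : IsIIDSample μ X (distOf φ)) (hb : φ bₒ ≠ ⊥) {d v δ : ℝ} (had : aₒ < d)
    (hdb : d < bₒ) (hv : ∀ z ∈ Icc d bₒ, |(φ z).toReal - v| ≤ δ) :
    ∀ᶠ p in withHighProb μ, ∀ k : ℕ, 0 < k → (k / p.1 : ℝ) ≤ bₒ - d →
      2 * (Real.log p.1 / p.1) ≤ Real.exp (v + δ) * (k / p.1) →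
      |empMean (obs X p) (scaledExcess (bₒ - k / p.1) bₒ) -
          (k / p.1 : ℝ)⁻¹ * meanExcess φ (bₒ - k / p.1)| <
        √(8 * Real.exp (v + δ) * (k / p.1 * (Real.log p.1 / p.1))) ∧
      |empMean (obs X p) ((Ici (bₒ - k / p.1 : ℝ)).indicator 1) -
          (1 - cdf (distOf φ) (bₒ - k / p.1))| <
        √(8 * Real.exp (v + δ) * (k / p.1 * (Real.log p.1 / p.1))) := by
  rw [eventually_withHighProb]
  set V := Real.exp (v + δ) with hV
  have hV0 : 0 < V := Real.exp_pos _
  have hW : 0 < bₒ - d := sub_pos.2 hdb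
  set W := bₒ - d with hWdef
  have hzero : Tendsto (fun n : ℕ => ENNReal.ofReal (4 * (W + 1) * (n : ℝ)⁻¹)) atTop (𝓝 0) := by
    have := (tendsto_inv_atTop_nhds_zero_nat (𝕜 := ℝ)).const_mul (4 * (W + 1))
    rw [mul_zero] at this
    simpa using ENNReal.tendsto_ofReal this
  refine tendsto_of_tendsto_of_tendsto_of_le_of_le' tendsto_const_nhds hzero
    (Eventually.of_forall fun _ => zero_le) ?_
  filter_upwards [eventually_ge_atTop 1] with n hn1
  have hn : n ≠ 0 := by omega
  have hn0 : (0 : ℝ) < n := by exact_mod_cast hn1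
  have hlog : 0 ≤ Real.log n := Real.log_natCast_nonneg n
  set ρ := Real.log n / n with hρ
  have hρ0 : 0 ≤ ρ := by positivity
  -- With this threshold the exponent is `2 log n`. Each grid point fails with probability at most
  -- `4 n⁻²`, and there are at most of order `n` grid points.
  set t : ℕ → ℝ := fun k => √(8 * V * (k / n * ρ)) with ht
  set bad : ℕ → Set Ω := fun k =>
    {ω | t k ≤ |empMean (obs X (n, ω)) (scaledExcess (bₒ - k / n) bₒ) -
          (k / n : ℝ)⁻¹ * meanExcess φ (bₒ - k / n)|} ∪
    {ω | t k ≤ |empMean (obs X (n, ω)) ((Ici (bₒ - k / n : ℝ)).indicator 1) -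
          (1 - cdf (distOf φ) (bₒ - k / n))|} with hbad
  set K : Finset ℕ := (Finset.range (⌊n * W⌋₊ + 1)).filter fun k =>
    0 < k ∧ (k / n : ℝ) ≤ W ∧ 2 * ρ ≤ V * (k / n) with hK
  have hone : ∀ k ∈ K, μ (bad k) ≤ ENNReal.ofReal (4 * ((n : ℝ)⁻¹) ^ 2) := by
    intro k hk
    obtain ⟨-, hk0, hkW, hkρ⟩ := Finset.mem_filter.1 hk
    have hk0 : (0 : ℝ) < k := by exact_mod_cast hk0
    have hH : bₒ - (bₒ - k / n) = (k : ℝ) / n := sub_sub_cancel _ _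
    have hH0 : (0 : ℝ) < k / n := by positivity
    have hdy : d ≤ bₒ - k / n := by linarith
    have hay := had.trans_le (EReal.coe_le_coe_iff.2 hdy)
    have hyb : bₒ - k / n < bₒ := by linarith
    have hvy : ∀ z ∈ Icc (bₒ - k / n) bₒ, |(φ z).toReal - v| ≤ δ := fun z hz =>
      hv z ⟨hdy.trans hz.1, hz.2⟩
    have ht0 : 0 ≤ t k := Real.sqrt_nonneg _
    have htsq : t k ^ 2 = 8 * V * (k / n * ρ) := Real.sq_sqrt (by positivity)
    -- This is where `2ρ ≤ V k / n` enters: it keeps the threshold in the range of the exponential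
    -- inequality.
    have ht' : t k ≤ 2 * (V * (bₒ - (bₒ - k / n))) := by
      rw [hH]
      refine Real.sqrt_le_iff.2 ⟨by positivity, ?_⟩
      have := mul_le_mul_of_nonneg_left hkρ (show 0 ≤ 4 * V * (k / n) by positivity)
      nlinarith
    have hb1 := h.measure_scaledExcess_le hX hb hay hyb hvy hn ht0 ht'
    have hb2 := h.measure_tail_le hX hb hay hyb hvy hn ht0 ht'
    have hval : 2 * Real.exp (-(n * t k ^ 2 / (4 * (V * (bₒ - (bₒ - k / n)))))) =
        2 * ((n : ℝ)⁻¹) ^ 2 := by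
      have e : n * t k ^ 2 / (4 * (V * (bₒ - (bₒ - k / n)))) = (2 : ℕ) * Real.log n := by
        rw [htsq, hH, hρ]
        push_cast
        field_simp
        ring
      rw [e, Real.exp_neg, Real.exp_nat_mul, Real.exp_log hn0, inv_pow]
    rw [hval] at hb1 hb2
    rw [hH] at hb1
    calc μ (bad k) ≤ _ := measure_union_le _ _
      _ ≤ _ := add_le_add hb1 hb2
      _ = ENNReal.ofReal (4 * ((n : ℝ)⁻¹) ^ 2) := by
        rw [← ENNReal.ofReal_add (by positivity) (by positivity)]
        ring_nf
  calc _ ≤ μ (⋃ k ∈ K, bad k) := by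
        refine measure_mono fun ω hω => ?_
        simp only [mem_ofPred_eq, not_forall, not_and_or, not_lt] at hω
        obtain ⟨k, hk0, hkW, hkρ, hor⟩ := hω
        refine mem_iUnion₂.2 ⟨k, Finset.mem_filter.2 ⟨Finset.mem_range.2 ?_, hk0, hkW, hkρ⟩, hor⟩
        rw [Nat.lt_succ_iff]
        refine Nat.le_floor ?_
        rw [div_le_iff₀ hn0] at hkW
        linarith
    _ ≤ ∑ k ∈ K, μ (bad k) := measure_biUnion_finset_le _ _
    _ ≤ ∑ _k ∈ K, ENNReal.ofReal (4 * ((n : ℝ)⁻¹) ^ 2) := Finset.sum_le_sum hone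
    _ = K.card * ENNReal.ofReal (4 * ((n : ℝ)⁻¹) ^ 2) := by rw [Finset.sum_const, nsmul_eq_mul]
    _ ≤ ENNReal.ofReal (n * (W + 1)) * ENNReal.ofReal (4 * ((n : ℝ)⁻¹) ^ 2) := by
        refine mul_le_mul_left ?_ _
        rw [← ENNReal.ofReal_natCast]
        refine ENNReal.ofReal_le_ofReal ?_
        have h1 : (K.card : ℝ) ≤ (⌊n * W⌋₊ + 1 : ℕ) := by
          exact_mod_cast (Finset.card_filter_le _ _).trans (Finset.card_range _).le
        have h2 := Nat.floor_le (show 0 ≤ n * W by positivity)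
        have h3 : (1 : ℝ) ≤ n := by exact_mod_cast hn1
        push_cast at h1
        linarith
    _ = _ := by
        rw [← ENNReal.ofReal_mul (by positivity)]
        congr 1
        field_simp

/-- The empirical mean excess and the empirical tail count are close to their expectations, with
an error adapted to the distance from the right endpoint of the support. -/
lemma eventually_empMean_near_right_end [IsProbabilityMeasure μ] (h : IsLogConcaveModel φ aₒ bₒ)
    (hX : IsIIDSample μ X (distOf φ)) (hb : φ bₒ ≠ ⊥) {d' d v δ : ℝ} (had : aₒ < d')
    (hdd : d' < d) (hdb : d < bₒ) (hv : ∀ z ∈ Icc d' bₒ, |(φ z).toReal - v| ≤ δ) {t : ℕ → ℝ}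
    (hlim : ∀ C : ℝ, ∀ᶠ n : ℕ in atTop, C * (Real.log n / n) ≤ bₒ - t n) :
    ∃ C : ℝ, 0 < C ∧ ∀ᶠ p in withHighProb μ, ∀ τ ∈ Icc d (t p.1),
      meanExcess φ τ - C * (bₒ - τ) * √((bₒ - τ) * (Real.log p.1 / p.1)) ≤
        empMean (obs X p) (fun z => max (z - τ) 0) ∧
      empMean (obs X p) ((Ici τ).indicator 1) ≤
        1 - cdf (distOf φ) τ + C * √((bₒ - τ) * (Real.log p.1 / p.1)) := by
  set V := Real.exp (v + δ) with hV
  have hV0 : 0 < V := Real.exp_pos _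
  set A := √(8 * V) with hA
  have hA0 : 0 < A := by positivity
  refine ⟨2 * A + V, by positivity, ?_⟩
  have hfst := tendsto_fst_withHighProb μ
  have hinv : ∀ᶠ n : ℕ in atTop, ((n : ℝ))⁻¹ < d - d' :=
    (tendsto_inv_atTop_nhds_zero_nat (𝕜 := ℝ)).eventually (gt_mem_nhds (sub_pos.2 hdd))
  filter_upwards [h.eventually_grid hX hb had (hdd.trans hdb) hv, h.eventually_le_right hX,
    hfst.eventually (eventually_ge_atTop 3), hfst.eventually (hlim (2 / V + 2)),
    hfst.eventually hinv] with p hp hle hn3 hη hinv τ hτ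
  have hn3 : (3 : ℝ) ≤ p.1 := by exact_mod_cast hn3
  set n : ℝ := (p.1 : ℝ) with hn
  have hn0 : 0 < n := by linarith
  have hlog : 1 ≤ Real.log n := by
    rw [Real.le_log_iff_exp_le hn0]
    linarith [Real.exp_one_lt_three]
  set ρ := Real.log n / n with hρ
  have hnρ : n⁻¹ ≤ ρ := by
    rw [hρ, inv_eq_one_div]
    exact div_le_div_of_nonneg_right hlog hn0.le
  have hρ0 : 0 < ρ := (inv_pos.2 hn0).trans_le hnρ
  set H := bₒ - τ with hH
  have hηH : bₒ - t p.1 ≤ H := by linarith [hτ.2]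
  have hρH : (2 / V + 2) * ρ ≤ H := hη.trans hηH
  have h2V : 0 < 2 / V * ρ := by positivity
  have hH0 : 0 < H := by linarith
  have hHW : H ≤ bₒ - d := by linarith [hτ.1]
  -- Since `1 / n ≤ ρ ≤ √(H ρ)`, the effect of rounding to the grid is absorbed in the stochastic
  -- error.
  have hsq : ρ ≤ √(H * ρ) := by
    refine Real.le_sqrt_of_sq_le ?_
    rw [pow_two]
    exact mul_le_mul_of_nonneg_right (by linarith) hρ0.le
  -- The grid point with index `k` lies to the right of `τ` and is used for the lower bound on the
  -- excess. Index `k + 1` lies to the left and is used for the upper bound on the tail count, with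
  -- `d' < d` leaving room for it.
  set k := ⌊n * H⌋₊ with hk
  have hk1 : (k : ℝ) ≤ n * H := Nat.floor_le (by positivity)
  have hk2 : n * H < k + 1 := Nat.lt_floor_add_one _
  have hkH : k / n ≤ H := by rwa [div_le_iff₀ hn0, mul_comm]
  have hkH' : H ≤ k / n + n⁻¹ := by
    rw [inv_eq_one_div, ← add_div, le_div_iff₀ hn0]
    linarith
  have hkρ : 2 * ρ ≤ V * (k / n) := by
    have h1 : 2 / V * ρ ≤ k / n := by linarith
    have h2 := mul_le_mul_of_nonneg_left h1 hV0.le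
    have h3 : V * (2 / V * ρ) = 2 * ρ := by field_simp
    linarith
  have hkpos : 0 < k / n := by
    have : 0 < V * (k / n) := by linarith
    exact pos_of_mul_pos_right this hV0.le
  have hk0 : 0 < k := by
    have : (0 : ℝ) < k := by
      rw [div_pos_iff_of_pos_right hn0] at hkpos
      exact hkpos
    exact_mod_cast this
  have hsqrt : ∀ B : ℝ, √(8 * V * (B * ρ)) = A * √(B * ρ) := fun B =>
    Real.sqrt_mul (by positivity) _
  have hτa : aₒ < (τ : EReal) := had.trans (EReal.coe_lt_coe_iff.2 (hdd.trans_le hτ.1))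
  constructor
  · have h1 := (abs_lt.1 (hp k hk0 (by linarith) hkρ).1).1
    rw [hsqrt] at h1
    have hyτ : τ ≤ bₒ - k / n := by linarith
    refine le_trans ?_ (empMean_max_sub_anti (obs X p) hyτ)
    rw [empMean_max_sub_eq hle (by linarith), sub_sub_cancel]
    have h2 := h.meanExcess_le_add hb hτa hyτ
    have h3 := (h.one_sub_cdf_mem hb hτa (by linarith)
      fun z hz => hv z ⟨by linarith [hz.1, hτ.1], hz.2⟩).2
    have h4 : (bₒ - k / n - τ) * (1 - cdf (distOf φ) τ) ≤ √(H * ρ) * (V * H) := by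
      refine mul_le_mul (by linarith) h3 (by linarith [cdf_le_one (distOf φ) τ])
        (Real.sqrt_nonneg _)
    have h5 : √(k / n * ρ) ≤ √(H * ρ) :=
      Real.sqrt_le_sqrt (mul_le_mul_of_nonneg_right hkH hρ0.le)
    have h6 : k / n * (A * √(k / n * ρ)) ≤ H * (A * √(H * ρ)) := by gcongr
    have h7 := mul_le_mul_of_nonneg_left h1.le hkpos.le
    rw [mul_sub, mul_inv_cancel_left₀ hkpos.ne'] at h7
    have h8 : 0 ≤ A * H * √(H * ρ) := by positivity
    linarith
  · have hc : ((k + 1 : ℕ) : ℝ) / n = k / n + n⁻¹ := by push_cast; rw [add_div, inv_eq_one_div]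
    have h1 := (abs_lt.1 (hp (k + 1) k.succ_pos (by rw [hc]; linarith) (by
      rw [hc]; nlinarith [inv_pos.2 hn0])).2).2
    rw [hsqrt, hc] at h1
    have hyτ : bₒ - (k / n + n⁻¹) ≤ τ := by linarith
    have hyd : d' ≤ bₒ - (k / n + n⁻¹) := by linarith
    have h2 := h.one_sub_cdf_le_add hb (had.trans_le (EReal.coe_le_coe_iff.2 hyd)) hyτ
      (by linarith) fun z hz => hv z ⟨by linarith [hz.1], hz.2⟩
    have h3 : empMean (obs X p) ((Ici τ).indicator 1) ≤
        empMean (obs X p) ((Ici (bₒ - (k / n + n⁻¹))).indicator 1) :=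
      empMean_mono fun i => indicator_le_indicator_of_subset (Ici_subset_Ici.2 hyτ)
        (fun _ => zero_le_one) _
    have h4 : √((k / n + n⁻¹) * ρ) ≤ 2 * √(H * ρ) := by
      rw [show (2 : ℝ) = √(2 ^ 2) from (Real.sqrt_sq zero_le_two).symm,
        ← Real.sqrt_mul (by norm_num)]
      refine Real.sqrt_le_sqrt ?_
      rw [← mul_assoc]
      exact mul_le_mul_of_nonneg_right (by linarith) hρ0.le
    have h5 := mul_le_mul_of_nonneg_left h4 hA0.le
    have h6 : V * (τ - (bₒ - (k / n + n⁻¹))) ≤ V * √(H * ρ) :=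
      mul_le_mul_of_nonneg_left (by linarith) hV0.le
    linarith

end IsLogConcaveModel
end

/-! ### Deterministic slope estimate beyond a knot and the left derivative at the endpoint -/

section
open Set

/-- Slopes of a concave function further right never exceed the slope `s` of the affine piece that
starts at `τ`. -/
lemma ConcaveOn.sub_le_mul_of_affine {S : Set ℝ} {g : ℝ → ℝ} (h : ConcaveOn ℝ S g)
    {τ q s y z : ℝ} (hτ : τ ∈ S) (hq : q ∈ S) (hy : y ∈ S) (hz : z ∈ S) (hτq : τ < q)
    (haff : ∀ w ∈ Icc τ q, g w = g τ + s * (w - τ)) (hτy : τ ≤ y) (hyz : y ≤ z) :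
    g z - g y ≤ s * (z - y) := by
  have hline : ∀ w ∈ S, τ ≤ w → g w ≤ g τ + s * (w - τ) := by
    intro w hw hτw
    by_cases hwq : w ≤ q
    · exact (haff w ⟨hτw, hwq⟩).le
    · exact h.le_line hτ hq hw hτq (haff q ⟨hτq.le, le_rfl⟩) fun hc => hwq hc.2.le
  rcases hyz.eq_or_lt with rfl | hyz
  · simp
  rcases hτy.eq_or_lt with rfl | hτy
  · linarith [hline z hz hyz.le]
  have h1 := h.slope_anti_adjacent hτ hz hτy hyz
  have h2 : (g y - g τ) / (y - τ) ≤ s := by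
    rw [div_le_iff₀ (sub_pos.2 hτy)]
    linarith [hline y hy hτy.le]
  have h3 := h1.trans h2
  rwa [div_le_iff₀ (sub_pos.2 hyz)] at h3

lemma setIntegral_max_sub_sq {τ m : ℝ} (hτm : τ ≤ m) :
    ∫ z in Icc τ m, (max (m - z) 0) ^ 2 = (m - τ) ^ 3 / 3 := by
  rw [setIntegral_congr_fun (g := fun z => (m - z) ^ 2) measurableSet_Icc fun z hz => by
    simp only [max_eq_left (sub_nonneg.2 hz.2)]]
  rw [integral_Icc_eq_integral_Ioc, ← intervalIntegral.integral_of_le hτm,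
    intervalIntegral.integral_comp_sub_left (fun z => z ^ 2) m, integral_pow]
  norm_num

namespace IsLogConcaveModel

variable {φ : ℝ → EReal} {aₒ : EReal} {bₒ : ℝ}

/-- Beyond a knot `τ`, the estimator cannot decrease much faster than the log-density, if the
empirical mean excess and the empirical tail count at `τ` are close to their expectations. -/
lemma mul_sq_le_of_isKnot (h : IsLogConcaveModel φ aₒ bₒ) (hb : φ bₒ ≠ ⊥) {n : ℕ} {x : Fin n → ℝ}
    {a b : ℝ} {g : ℝ → ℝ} (hg : IsMLEOn x a b g) {τ v δ ε κ : ℝ} (hτ : IsKnot a b g τ)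
    (haτ : a ≤ τ) (haτ' : aₒ < τ) (hτb : τ < bₒ) (hbb : b ≤ bₒ) (hε : 0 ≤ ε) (hκ : 0 ≤ κ)
    (hδ : Real.exp (2 * δ) ≤ 3 / 2) (hv : ∀ z ∈ Icc τ bₒ, |(φ z).toReal - v| ≤ δ)
    (htb : bₒ - (bₒ - τ) / 4 ≤ b) (hgv : ∀ z ∈ Icc τ (bₒ - (bₒ - τ) / 4), v - δ ≤ g z)
    (hu : ∀ y z, τ ≤ y → y ≤ z → z ≤ b →
      (g z - (φ z).toReal) - (g y - (φ y).toReal) ≤ -ε * (z - y))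
    (h₁ : meanExcess φ τ - κ * (bₒ - τ) ≤ empMean x fun z => max (z - τ) 0)
    (h₂ : empMean x ((Ici τ).indicator 1) ≤ 1 - cdf (distOf φ) τ + κ) :
    ε * Real.exp (v - 3 * δ) * (bₒ - τ) ^ 2 ≤ 384 * κ := by
  set r : ℝ → ℝ := fun z => (φ z).toReal with hr
  set H := bₒ - τ with hH
  have hH0 : 0 < H := sub_pos.2 hτb
  obtain ⟨hE1, hE2⟩ := h.meanExcess_mem hb haτ' hτb.le hv
  obtain ⟨hq1, hq2⟩ := h.one_sub_cdf_mem hb haτ' hτb.le hv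
  rw [← hH] at hE1 hE2 hq1 hq2
  set q₀ := 1 - cdf (distOf φ) τ with hq₀
  set E := meanExcess φ τ with hE
  set c := Real.exp (v - δ) with hc
  have hc0 : 0 < c := Real.exp_pos _
  have hq0 : 0 < q₀ := lt_of_lt_of_le (by positivity) hq1
  have hvc : Real.exp (v + δ) ≤ 3 / 2 * c := by
    have : Real.exp (v + δ) = Real.exp (2 * δ) * c := by rw [hc, ← Real.exp_add]; ring_nf
    rw [this]
    exact mul_le_mul_of_nonneg_right hδ hc0.le
  -- The conditional mean of the true distribution given values beyond `τ`. The near-constancy of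
  -- the density places it in the middle half of `[τ, bₒ]`, hence inside the range of the data.
  set m := τ + E / q₀ with hm
  have hmq : (m - τ) * q₀ = E := by rw [hm, add_sub_cancel_left, div_mul_cancel₀ _ hq0.ne']
  have hcH : 0 < c * H := by positivity
  have hm1 : H / 4 ≤ m - τ := by
    have hq3 : q₀ ≤ 3 / 2 * (c * H) := by
      have := mul_le_mul_of_nonneg_right hvc hH0.le
      linarith
    rw [hm, add_sub_cancel_left, le_div_iff₀ hq0]
    have h3 := mul_le_mul_of_nonneg_left hq3 (show 0 ≤ H / 4 by positivity)
    have h4 : 0 < c * H ^ 2 := by positivity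
    nlinarith
  have hm2 : m - τ ≤ 3 * H / 4 := by
    rw [hm, add_sub_cancel_left, div_le_iff₀ hq0]
    have h3 := mul_le_mul_of_nonneg_left hq1 (show 0 ≤ 3 * H / 4 by positivity)
    have h4 := mul_le_mul_of_nonneg_right hvc (show 0 ≤ H ^ 2 / 2 by positivity)
    linarith
  have hτm : τ ≤ m := by linarith
  have hmb : m ≤ b := by linarith
  have hτab : τ ∈ Icc a b := ⟨haτ, by linarith⟩
  have hsub : Icc τ b ⊆ Icc a b := Icc_subset_Icc_left haτ
  have hgi : IntegrableOn (fun z => Real.exp (g z)) (Icc τ b) :=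
    hg.concaveOn.integrableOn_exp.mono_set hsub
  have hri : IntegrableOn (fun z => Real.exp (r z)) (Icc τ bₒ) :=
    (h.concaveOn_Icc hb haτ').integrableOn_exp
  have hri' : IntegrableOn (fun z => (z - m) * Real.exp (r z)) (Icc τ bₒ) :=
    hri.continuousOn_mul (by fun_prop) isCompact_Icc
  have hgi' : ∀ s, IntegrableOn (fun z => (z - s) * Real.exp (g z)) (Icc τ b) := fun s =>
    hgi.continuousOn_mul (by fun_prop) isCompact_Icc
  have hsqi : IntegrableOn (fun z => (max (m - z) 0) ^ 2) (Icc τ b) :=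
    ContinuousOn.integrableOn_compact isCompact_Icc (by fun_prop)
  -- At a knot the fitted excess is at least the empirical one and the fitted tail mass at most the
  -- empirical one. One `κ H` comes from the excess, the other from the tail count times `m - τ ≤
  -- H`.
  have hlower : -(2 * (κ * H)) ≤ ∫ z in Icc τ b, (z - m) * Real.exp (g z) := by
    have e1 : ∫ z in Icc a b, max (z - τ) 0 * Real.exp (g z) =
        ∫ z in Icc τ b, (z - τ) * Real.exp (g z) := by
      rw [setIntegral_eq_of_subset_of_forall_sdiff_eq_zero measurableSet_Icc hsub]
      · refine setIntegral_congr_fun measurableSet_Icc fun z hz => ?_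
        simp only [max_eq_left (sub_nonneg.2 hz.1)]
      · intro z hz
        rw [max_eq_right, zero_mul]
        by_contra! hc
        exact hz.2 ⟨by linarith, hz.1.2⟩
    have h3 := hg.empMean_max_sub_le hτ
    have h4 := hg.setIntegral_exp_le_empMean hτ haτ
    rw [e1] at h3
    have e2 : ∫ z in Icc τ b, (z - m) * Real.exp (g z) =
        (∫ z in Icc τ b, (z - τ) * Real.exp (g z)) - (m - τ) * ∫ z in Icc τ b, Real.exp (g z) := by
      rw [← integral_const_mul, ← integral_sub (hgi' τ) (hgi.const_mul _)]
      congr 1 with z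
      ring
    rw [e2]
    have h5 := mul_le_mul_of_nonneg_left (h4.trans h₂) (sub_nonneg.2 hτm)
    have h6 : (m - τ) * κ ≤ H * κ := mul_le_mul_of_nonneg_right (by linarith) hκ
    linarith
  -- The integral up to `bₒ` vanishes by the choice of `m`, and the part omitted beyond `b` is
  -- nonnegative because `m ≤ b`.
  have hzero : ∫ z in Icc τ b, (z - m) * Real.exp (r z) ≤ 0 := by
    have h3 : ∫ z in Icc τ bₒ, (z - m) * Real.exp (r z) = 0 := by
      have e : ∀ z, (z - m) * Real.exp (r z) =
          (z - τ) * Real.exp (r z) - (m - τ) * Real.exp (r z) := fun z => by ring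
      simp only [e]
      rw [integral_sub (hri.continuousOn_mul (by fun_prop) isCompact_Icc) (hri.const_mul _),
        integral_const_mul, ← h.meanExcess_eq hb haτ', ← h.one_sub_cdf_eq_setIntegral hb haτ']
      linarith
    rw [← h3, ← integral_indicator measurableSet_Icc, ← integral_indicator measurableSet_Icc]
    refine integral_mono
      ((integrable_indicator_iff measurableSet_Icc).2 (hri'.mono_set (Icc_subset_Icc_right hbb)))
      ((integrable_indicator_iff measurableSet_Icc).2 hri') fun z => ?_
    by_cases hz : z ∈ Icc τ b
    · simp only [indicator_of_mem hz, indicator_of_mem (Icc_subset_Icc_right hbb hz), le_refl]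
    · rw [indicator_of_notMem hz]
      by_cases hz' : z ∈ Icc τ bₒ
      swap
      · rw [indicator_of_notMem hz']
      rw [indicator_of_mem hz']
      have hbz : b ≤ z := by
        by_contra! hc
        exact hz ⟨hz'.1, hc.le⟩
      exact mul_nonneg (by linarith) (Real.exp_pos _).le
  set U := Real.exp (g m - r m) with hU
  have hU1 : Real.exp (-(2 * δ)) ≤ U := by
    refine Real.exp_le_exp.2 ?_
    have h3 := hgv m ⟨hτm, by linarith⟩
    have h4 := (abs_le.1 (hv m ⟨hτm, by linarith⟩)).2
    simp only [hr]
    linarith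
  -- Relative to the true density, the fit is tilted by `e^u` with `u` decreasing at rate `ε`: at
  -- most `U` to the right of `m`, and at least `U (1 + ε (m - z))` to its left. Both shift mass to
  -- the left of `m`.
  have hupper : ∫ z in Icc τ b, (z - m) * Real.exp (g z) ≤
      U * (∫ z in Icc τ b, (z - m) * Real.exp (r z)) -
        U * (ε * c) * ∫ z in Icc τ b, (max (m - z) 0) ^ 2 := by
    rw [← integral_const_mul, ← integral_const_mul,
      ← integral_sub ((hri'.mono_set (Icc_subset_Icc_right hbb)).const_mul _)
        (hsqi.const_mul _)]
    refine setIntegral_mono_on (hgi' m)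
      (((hri'.mono_set (Icc_subset_Icc_right hbb)).const_mul _).sub (hsqi.const_mul _))
      measurableSet_Icc fun z hz => ?_
    have hgz : Real.exp (g z) = Real.exp (r z) * U * Real.exp ((g z - r z) - (g m - r m)) := by
      rw [hU, ← Real.exp_add, ← Real.exp_add]; ring_nf
    have hrU : 0 < Real.exp (r z) * U := mul_pos (Real.exp_pos _) (Real.exp_pos _)
    rcases le_total m z with hmz | hzm
    · rw [max_eq_right (by linarith), hgz]
      have h3 : Real.exp ((g z - r z) - (g m - r m)) ≤ 1 := by
        rw [Real.exp_le_one_iff]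
        have h4 := hu m z hτm hmz hz.2
        have h5 := mul_nonneg hε (sub_nonneg.2 hmz)
        simp only [hr]
        linarith
      have h4 := mul_le_mul_of_nonneg_left h3 (mul_nonneg (sub_nonneg.2 hmz) hrU.le)
      linarith
    · rw [max_eq_left (by linarith), hgz]
      have h3 : 1 + ε * (m - z) ≤ Real.exp ((g z - r z) - (g m - r m)) := by
        have h4 := hu z m hz.1 hzm hmb
        have h5 := Real.add_one_le_exp ((g z - r z) - (g m - r m))
        simp only [hr] at h5 ⊢
        linarith
      have h4 := mul_le_mul_of_nonneg_left h3 (mul_nonneg (sub_nonneg.2 hzm) hrU.le)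
      have h5 : c ≤ Real.exp (r z) := by
        refine Real.exp_le_exp.2 ?_
        have := (abs_le.1 (hv z ⟨hz.1, hz.2.trans hbb⟩)).1
        simp only [hr]
        linarith
      have h6 := mul_le_mul_of_nonneg_left h5
        (show 0 ≤ U * ε * (m - z) ^ 2 from
          mul_nonneg (mul_nonneg (Real.exp_pos _).le hε) (sq_nonneg _))
      linarith
  have hsq : (m - τ) ^ 3 / 3 ≤ ∫ z in Icc τ b, (max (m - z) 0) ^ 2 := by
    rw [← setIntegral_max_sub_sq hτm]
    exact setIntegral_mono_set hsqi (ae_of_all _ fun z => sq_nonneg _)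
      (Icc_subset_Icc_right hmb).eventuallyLE
  have hU0 : 0 < U := Real.exp_pos _
  have h3 : U * (∫ z in Icc τ b, (z - m) * Real.exp (r z)) ≤ 0 :=
    mul_nonpos_of_nonneg_of_nonpos hU0.le hzero
  have h4 : U * (ε * c) * ((m - τ) ^ 3 / 3) ≤ 2 * (κ * H) := by
    have := mul_le_mul_of_nonneg_left hsq (show 0 ≤ U * (ε * c) by positivity)
    linarith
  have h5 : (H / 4) ^ 3 ≤ (m - τ) ^ 3 := pow_le_pow_left₀ (by positivity) hm1 3
  have h6 : Real.exp (v - 3 * δ) ≤ U * c := by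
    have : Real.exp (v - 3 * δ) = Real.exp (-(2 * δ)) * c := by
      rw [hc, ← Real.exp_add]; ring_nf
    rw [this]
    exact mul_le_mul_of_nonneg_right hU1 hc0.le
  have h7 : ε * Real.exp (v - 3 * δ) * ((H / 4) ^ 3 / 3) ≤ U * (ε * c) * ((m - τ) ^ 3 / 3) := by
    have e : U * (ε * c) = ε * (U * c) := by ring
    rw [e]
    exact mul_le_mul (mul_le_mul_of_nonneg_left h6 hε) (by linarith) (by positivity)
      (mul_nonneg hε (by positivity))
  -- The constant is `2 · 3 · 4³ = 384`.
  have h8 : (ε * Real.exp (v - 3 * δ) * H ^ 2) * H ≤ (384 * κ) * H := by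
    have := h7.trans h4
    linarith
  exact le_of_mul_le_mul_right h8 hH0

/-- The left-sided derivative at the right endpoint is the limit of decreasing slopes. -/
lemma exists_leftDeriv_eq (h : IsLogConcaveModel φ aₒ bₒ) (hb : φ bₒ ≠ ⊥)
    (hD : ⊥ < leftDeriv φ bₒ) {c : ℝ} (hac : aₒ < c) (hcb : c < bₒ) :
    ∃ D : ℝ, leftDeriv φ bₒ = D ∧
      (∀ y ∈ Ioo c bₒ, D ≤ ((φ bₒ).toReal - (φ y).toReal) / (bₒ - y)) ∧
      Tendsto (fun y => ((φ bₒ).toReal - (φ y).toReal) / (bₒ - y)) (𝓝[<] bₒ) (𝓝 D) := by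
  set S : ℝ → ℝ := fun y => ((φ bₒ).toReal - (φ y).toReal) / (bₒ - y) with hS
  set f : ℝ → EReal := fun y => (φ bₒ - φ y) / ((bₒ - y : ℝ) : EReal) with hf
  have hfS : ∀ y ∈ Ioo c bₒ, f y = (S y : EReal) := by
    intro y hy
    have hne := h.ne_bot (hac.trans (EReal.coe_lt_coe_iff.2 hy.1)) hy.2
    simp only [hf, hS]
    rw [← h.isLogDensity.1.coe_toReal hne, ← h.isLogDensity.1.coe_toReal hb, ← EReal.coe_sub,
      ← EReal.coe_div, EReal.toReal_coe, EReal.toReal_coe]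
  have hconc := h.concaveOn_Icc hb hac
  -- Slopes of chords ending at `bₒ` decrease with the left end, so the upper limit is a limit and
  -- equals their infimum.
  have hanti : AntitoneOn f (Ioo c bₒ) := by
    intro y hy z hz hyz
    rw [hfS y hy, hfS z hz, EReal.coe_le_coe_iff]
    rcases hyz.eq_or_lt with rfl | hyz
    · exact le_rfl
    have h1 := hconc.slope_anti_adjacent ⟨hy.1.le, hy.2.le⟩ (right_mem_Icc.2 hcb.le) hyz hz.2
    have hz' : 0 < bₒ - z := sub_pos.2 hz.2
    have hzy : 0 < z - y := sub_pos.2 hyz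
    rw [div_le_div_iff₀ hz' hzy] at h1
    simp only [hS]
    rw [div_le_div_iff₀ hz' (by linarith)]
    nlinarith
  have hlim := hanti.tendsto_nhdsWithin_Ioo_left (nonempty_Ioo.2 hcb) (OrderBot.bddBelow _)
  have hL : leftDeriv φ bₒ = sInf (f '' Ioo c bₒ) := hlim.limsup_eq
  have hle : ∀ y ∈ Ioo c bₒ, leftDeriv φ bₒ ≤ S y := fun y hy => by
    rw [hL, ← hfS y hy]; exact sInf_le (mem_image_of_mem f hy)
  have hmid : (c + bₒ) / 2 ∈ Ioo c bₒ := ⟨by linarith, by linarith⟩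
  have hcoe : ((leftDeriv φ bₒ).toReal : EReal) = leftDeriv φ bₒ :=
    EReal.coe_toReal ((hle _ hmid).trans_lt (EReal.coe_lt_top _)).ne hD.ne'
  refine ⟨(leftDeriv φ bₒ).toReal, hcoe.symm, fun y hy => ?_, ?_⟩
  · rw [← EReal.coe_le_coe_iff, hcoe]
    exact hle y hy
  · rw [← EReal.tendsto_coe, hcoe, hL]
    refine hlim.congr' ?_
    filter_upwards [Ioo_mem_nhdsLT hcb] with y hy
    exact hfS y hy

end IsLogConcaveModel
end

/-! ### Convergence of the derivative: part (c) -/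

section
open Set

lemma eventually_mul_lt_pow_three {w ρ η : ℕ → ℝ} (hρ : ∀ᶠ n in atTop, 0 < ρ n)
    (hw : ∀ᶠ n in atTop, w n = (ρ n) ^ (-(1 / 3) : ℝ))
    (hlim : Tendsto (fun n => w n * η n) atTop atTop) (K : ℝ) :
    ∀ᶠ n in atTop, K * ρ n < η n ^ 3 := by
  filter_upwards [hρ, hw, hlim.eventually_gt_atTop (max 1 K)] with n hρn hwn hn
  have h1 : (1 : ℝ) ≤ max 1 K := le_max_left _ _
  have hw3 : w n ^ 3 * ρ n = 1 := by
    rw [hwn, ← Real.rpow_natCast, ← Real.rpow_mul hρn.le]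
    norm_num
    rw [Real.rpow_neg_one, inv_mul_cancel₀ hρn.ne']
  have h2 : max 1 K < (w n * η n) ^ 3 := by
    calc max 1 K < w n * η n := hn
      _ = (w n * η n) ^ 1 := (pow_one _).symm
      _ ≤ (w n * η n) ^ 3 := pow_le_pow_right₀ (h1.trans hn.le) (by norm_num)
  calc K * ρ n < (w n * η n) ^ 3 * ρ n :=
        mul_lt_mul_of_pos_right ((le_max_right _ _).trans_lt h2) hρn
    _ = η n ^ 3 * (w n ^ 3 * ρ n) := by ring
    _ = η n ^ 3 := by rw [hw3, mul_one]

namespace IsLogConcaveModel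

variable {φ : ℝ → EReal} {aₒ : EReal} {bₒ : ℝ} {Ω : Type*} [MeasurableSpace Ω] {μ : Measure Ω}
  {X : ℕ → Ω → ℝ}

/-- Some chord of `φ` ending at `bₒ` has slope below `u`. By left-continuity its right end can be
moved inside the support, where the estimator is consistent, and slopes further right are smaller
still. -/
lemma IsConsistent.eventually_mleRightDeriv_lt {M : ℝ}
    (hM : IsConsistent φ aₒ bₒ μ X M) (h : IsLogConcaveModel φ aₒ bₒ) (hb : φ bₒ ≠ ⊥)
    {c D u : ℝ} (hac : aₒ < c) (hcb : c < bₒ)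
    (hlim : Tendsto (fun y => ((φ bₒ).toReal - (φ y).toReal) / (bₒ - y)) (𝓝[<] bₒ) (𝓝 D))
    (hu : D < u) {t : ℕ → ℝ} (htlim : Tendsto t atTop (𝓝 bₒ)) :
    ∀ᶠ p in withHighProb μ, mleRightDeriv (obs X p) (t p.1) < u := by
  obtain ⟨y, hy, hcy⟩ := ((hlim.eventually (gt_mem_nhds hu)).and (Ioo_mem_nhdsLT hcb)).exists
  have hay : aₒ < (y : EReal) := hac.trans (EReal.coe_lt_coe_iff.2 hcy.1)
  have hr : Tendsto (fun z => (φ z).toReal) (𝓝[<] bₒ) (𝓝 (φ bₒ).toReal) := by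
    rw [Metric.tendsto_nhds]
    intro ε hε
    filter_upwards [h.eventually_abs_sub_le hb (half_pos hε), self_mem_nhdsWithin] with z hz hzb
    rw [Real.dist_eq]
    exact (hz z ⟨le_rfl, (show z < bₒ from hzb).le⟩).trans_lt (half_lt_self hε)
  have hslope : Tendsto (fun z => ((φ z).toReal - (φ y).toReal) / (z - y)) (𝓝[<] bₒ)
      (𝓝 (((φ bₒ).toReal - (φ y).toReal) / (bₒ - y))) :=
    (hr.sub_const _).div ((tendsto_id.mono_left nhdsWithin_le_nhds).sub_const _)
      (sub_pos.2 hcy.2).ne'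
  obtain ⟨z, hz, hyz⟩ := ((hslope.eventually (gt_mem_nhds hy)).and (Ioo_mem_nhdsLT hcy.2)).exists
  have hzy : 0 < z - y := sub_pos.2 hyz.1
  rw [div_lt_iff₀ hzy] at hz
  set ε := (u * (z - y) - ((φ z).toReal - (φ y).toReal)) / 4 with hε
  have hε0 : 0 < ε := by linarith
  filter_upwards [hM y z ε hay hyz.1 hyz.2 hε0, (tendsto_fst_withHighProb μ).eventually
    (htlim.eventually (lt_mem_nhds hyz.2))] with p ⟨⟨a, b, g, hg⟩, hp⟩ htp
  obtain ⟨ha, hb', hgφ⟩ := hp a b g hg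
  refine (hg.mleRightDeriv_le ha.le hyz.1 htp.le).trans_lt ?_
  rw [EReal.coe_lt_coe_iff, div_lt_iff₀ hzy]
  have h1 := abs_le.1 (hgφ y ⟨le_rfl, hyz.1.le⟩)
  have h2 := abs_le.1 (hgφ z ⟨hyz.1.le, le_rfl⟩)
  linarith

lemma sub_ge_of_le_slope (h : IsLogConcaveModel φ aₒ bₒ) (hb : φ bₒ ≠ ⊥) {c D : ℝ}
    (hac : aₒ < c) (hD : ∀ y ∈ Ioo c bₒ, D ≤ ((φ bₒ).toReal - (φ y).toReal) / (bₒ - y))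
    {y z : ℝ} (hcy : c < y) (hyz : y ≤ z) (hzb : z ≤ bₒ) :
    D * (z - y) ≤ (φ z).toReal - (φ y).toReal := by
  rcases hyz.eq_or_lt with rfl | hyz
  · simp
  rcases hzb.eq_or_lt with rfl | hzb
  · exact (le_div_iff₀ (sub_pos.2 hyz)).1 (hD y ⟨hcy, hyz⟩)
  have h1 := (h.concaveOn_Icc hb hac).slope_anti_adjacent ⟨hcy.le, (hyz.trans hzb).le⟩
    (right_mem_Icc.2 (hcy.le.trans (hyz.trans hzb).le)) hyz hzb
  exact (le_div_iff₀ (sub_pos.2 hyz)).1 ((hD z ⟨hcy.trans hyz, hzb⟩).trans h1)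

lemma IsConsistent.eventually_lt_mleRightDeriv [IsProbabilityMeasure μ] {M : ℝ}
    (hM : IsConsistent φ aₒ bₒ μ X M) (h : IsLogConcaveModel φ aₒ bₒ)
    (hX : IsIIDSample μ X (distOf φ)) (hb : φ bₒ ≠ ⊥) {c D ε : ℝ} (hac : aₒ < c) (hcb : c < bₒ)
    (hD : ∀ y ∈ Ioo c bₒ, D ≤ ((φ bₒ).toReal - (φ y).toReal) / (bₒ - y)) (hε : 0 < ε)
    {t : ℕ → ℝ} (ht : ∀ n, t n < bₒ) (htlim : Tendsto t atTop (𝓝 bₒ))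
    (hlim : ∀ K : ℝ, ∀ᶠ n : ℕ in atTop, K * (Real.log n / n) < (bₒ - t n) ^ 3) :
    ∀ᶠ p in withHighProb μ, ((D - ε : ℝ) : EReal) < mleRightDeriv (obs X p) (t p.1) := by
  -- Any fixed value with `e^(2δ) ≤ 3 / 2` would do; here the fifth powers are compared, using `e <
  -- 3`.
  set δ : ℝ := 1 / 10 with hδ
  have hδ0 : 0 < δ := by norm_num
  have hexpδ : Real.exp (2 * δ) ≤ 3 / 2 := by
    refine le_of_pow_le_pow_left₀ (n := 5) (by norm_num) (by norm_num) ?_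
    rw [← Real.exp_nat_mul, hδ]
    norm_num
    linarith [Real.exp_one_lt_three]
  have hη : Tendsto (fun n => bₒ - t n) atTop (𝓝 0) := by
    simpa using htlim.const_sub bₒ
  have hlim1 : ∀ K : ℝ, ∀ᶠ n : ℕ in atTop, K * (Real.log n / n) ≤ bₒ - t n := by
    intro K
    filter_upwards [hlim K, hη.eventually (gt_mem_nhds one_pos)] with n hn hn1
    have h0 := sub_pos.2 (ht n)
    refine hn.le.trans ?_
    calc (bₒ - t n) ^ 3 ≤ (bₒ - t n) ^ 1 := pow_le_pow_of_le_one h0.le hn1.le (by norm_num)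
      _ = _ := pow_one _
  -- The slope estimate needs the estimator bounded below on the first three quarters of `[τ, bₒ]`
  -- for every knot `τ ≤ t n`, so the lower bound is applied at this later point.
  set t' : ℕ → ℝ := fun n => bₒ - (bₒ - t n) / 4 with ht'
  have ht'b : ∀ n, t' n < bₒ := fun n => by
    have := sub_pos.2 (ht n)
    simp only [ht']
    linarith
  have ht'lim : Tendsto t' atTop (𝓝 bₒ) := by
    simpa using (hη.div_const 4).const_sub bₒ
  have hnlim : Tendsto (fun n : ℕ => n * (bₒ - t' n)) atTop atTop := by
    refine tendsto_atTop_mono' atTop ?_ (Real.tendsto_log_atTop.comp tendsto_natCast_atTop_atTop)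
    filter_upwards [hlim1 4, eventually_gt_atTop 0] with n hn hn0
    have hn0 : (0 : ℝ) < n := by exact_mod_cast hn0
    have h1 := mul_le_mul_of_nonneg_left hn hn0.le
    have h2 : n * (4 * (Real.log n / n)) = 4 * Real.log n := by field_simp
    simp only [ht', sub_sub_cancel, Function.comp_apply]
    linarith
  obtain ⟨d', hcd', hd'b, hnear, hlower⟩ :=
    hM.exists_lower h hX hb hac hcb hδ0 ht'b ht'lim hnlim
  set v := (φ bₒ).toReal with hv
  set d := (d' + bₒ) / 2 with hd
  set e := (d + bₒ) / 2 with he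
  have hd'd : d' < d := by linarith
  have hdb : d < bₒ := by linarith
  have hde : d < e := by linarith
  have heb : e < bₒ := by linarith
  have had' : aₒ < (d' : EReal) := hac.trans (EReal.coe_lt_coe_iff.2 hcd')
  have had : aₒ < (d : EReal) := had'.trans (EReal.coe_lt_coe_iff.2 hd'd)
  obtain ⟨C, hC0, hemp⟩ := h.eventually_empMean_near_right_end hX hb had' hd'd hdb hnear hlim1
  set B := ε * Real.exp (v - 3 * δ) with hB
  have hB0 : 0 < B := by positivity
  have hfst := tendsto_fst_withHighProb μ
  have hed : 0 < ε * (e - d) / 4 := div_pos (mul_pos hε (sub_pos.2 hde)) (by norm_num)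
  filter_upwards [hlower, hemp, hM d e _ had hde heb hed,
    hfst.eventually (htlim.eventually (lt_mem_nhds heb)),
    hfst.eventually (hlim ((384 * C / B) ^ 2))]
    with p hlow hemp ⟨⟨a, b, g, hg⟩, hIC⟩ het hlimp
  obtain ⟨hac', ht'p, hgv⟩ := hlow a b g hg
  obtain ⟨-, -, hgφ⟩ := hIC a b g hg
  have hmle := hg.isMLEOn
  have htt' : t p.1 < t' p.1 := by
    have := ht p.1
    simp only [ht']
    linarith
  obtain ⟨q, τ, s, htq, hqb, hdτ, hτt, haff, hcase⟩ :=
    hmle.exists_knot (c := d) (β := t p.1) (by linarith) (by linarith) (by linarith)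
  have haff' : ∀ z ∈ Icc (t p.1) q, g z = g (t p.1) + s * (z - t p.1) := by
    intro z hz
    rw [haff z ⟨hτt.trans hz.1, hz.2⟩, haff (t p.1) ⟨hτt, htq.le⟩]
    ring
  rw [hg.mleRightDeriv_eq (by linarith) htq hqb haff', EReal.coe_lt_coe_iff]
  by_contra! hs
  rcases hcase with rfl | hknot
  -- Without a knot after `d`, the estimator is affine on `[d, e]` with slope at most `D - ε`, while
  -- interior consistency gives at least `D - ε / 2`.
  · have h1 := haff e ⟨hde.le, by linarith⟩
    have h2 := h.sub_ge_of_le_slope hb hac hD (y := d) (z := e) (by linarith) hde.le heb.le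
    have h3 := abs_le.1 (hgφ d ⟨le_rfl, hde.le⟩)
    have h4 := abs_le.1 (hgφ e ⟨hde.le, le_rfl⟩)
    have h5 := mul_le_mul_of_nonneg_right hs (sub_pos.2 hde).le
    have h6 := mul_pos hε (sub_pos.2 hde)
    linarith
  · obtain ⟨h1, h2⟩ := hemp τ ⟨hdτ, hτt⟩
    have hτb := hτt.trans_lt (ht p.1)
    have hτab : τ ∈ Icc a b := ⟨by linarith, by linarith⟩
    set H := bₒ - τ with hH
    have hH0 : 0 < H := sub_pos.2 hτb
    have hηH : bₒ - t p.1 ≤ H := by linarith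
    set κ := C * √(H * (Real.log p.1 / p.1)) with hκ
    have hend : bₒ - (bₒ - τ) / 4 ≤ t' p.1 := by simp only [ht']; linarith
    have hlog : 0 ≤ Real.log p.1 / p.1 := div_nonneg (Real.log_natCast_nonneg _) (Nat.cast_nonneg _)
    have key := h.mul_sq_le_of_isKnot hb hmle (v := v) (δ := δ) (ε := ε) (κ := κ) hknot hτab.1
      (had.trans_le (EReal.coe_le_coe_iff.2 hdτ)) hτb hg.le_right hε.le (by positivity) hexpδ
      (fun z hz => hnear z ⟨by linarith [hz.1], hz.2⟩) (by linarith)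
      (fun z hz => by
        linarith [(abs_le.1 (hgv z ⟨by linarith [hz.1], hz.2.trans hend⟩)).1])
      (fun y z hτy hyz hzb => by
        have h3 := hmle.concaveOn.sub_le_mul_of_affine hτab (q := q) ⟨by linarith, hqb⟩
          (y := y) (z := z) ⟨by linarith, by linarith⟩ ⟨by linarith, hzb⟩ (by linarith) haff hτy hyz
        have h4 := h.sub_ge_of_le_slope hb hac hD (y := y) (z := z) (by linarith) hyz
          (hzb.trans hg.le_right)
        have h5 := mul_le_mul_of_nonneg_right hs (sub_nonneg.2 hyz)
        linarith)
      (by rw [hκ]; linarith) h2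
    rw [← hB, ← hH] at key
    have h3 : (B * H ^ 2) ^ 2 ≤ (384 * κ) ^ 2 := pow_le_pow_left₀ (by positivity) key 2
    have h4 : κ ^ 2 = C ^ 2 * (H * (Real.log p.1 / p.1)) := by
      rw [hκ, mul_pow, Real.sq_sqrt (by positivity)]
    have h5 : (bₒ - t p.1) ^ 3 ≤ H ^ 3 := pow_le_pow_left₀ (sub_pos.2 (ht p.1)).le hηH 3
    -- Squaring `B H² ≤ 384 C √(H ρ)` and cancelling `H` gives a bound on `H³`, which contradicts
    -- the assumption on `t` because `H ≥ bₒ - t n`.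
    have h6 : H ^ 3 ≤ (384 * C / B) ^ 2 * (Real.log p.1 / p.1) := by
      rw [div_pow, div_mul_eq_mul_div, le_div_iff₀ (by positivity)]
      refine le_of_mul_le_mul_right ?_ hH0
      calc H ^ 3 * B ^ 2 * H = (B * H ^ 2) ^ 2 := by ring
        _ ≤ (384 * κ) ^ 2 := h3
        _ = _ := by rw [mul_pow 384 κ, h4]; ring
    linarith

theorem tendsto_mleRightDeriv [IsProbabilityMeasure μ] (h : IsLogConcaveModel φ aₒ bₒ)
    (hX : IsIIDSample μ X (distOf φ)) (hb : φ bₒ ≠ ⊥) (hD : ⊥ < leftDeriv φ bₒ)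
    {t : ℕ → ℝ} (ht : ∀ n, aₒ < t n ∧ t n < bₒ) (htlim : Tendsto t atTop (𝓝 bₒ))
    (hlim : Tendsto (fun n : ℕ => (Real.log n / n) ^ (-(1 / 3) : ℝ) *
      (1 - cdf (distOf φ) (t n))) atTop atTop) :
    Tendsto (fun p : ℕ × Ω => mleRightDeriv (obs X p) (t p.1)) (withHighProb μ)
      (𝓝 (leftDeriv φ bₒ)) := by
  obtain ⟨M, hM⟩ := h.exists_isConsistent hX
  obtain ⟨D, hDeq, hDle, hDlim⟩ := h.exists_leftDeriv_eq hb hD (ht 0).1 (ht 0).2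
  have hlim' : ∀ K : ℝ, ∀ᶠ n : ℕ in atTop, K * (Real.log n / n) < (bₒ - t n) ^ 3 := by
    refine fun K => eventually_mul_lt_pow_three ?_ (Eventually.of_forall fun _ => rfl)
      (h.tendsto_nat_mul_sub hb ht htlim (fun n => Real.rpow_nonneg
        (div_nonneg (Real.log_natCast_nonneg n) n.cast_nonneg) _) hlim) K
    filter_upwards [eventually_gt_atTop 1] with n hn
    have hn : (1 : ℝ) < n := by exact_mod_cast hn
    exact div_pos (Real.log_pos hn) (by linarith)
  rw [hDeq]
  refine tendsto_order.2 ⟨fun l hl => ?_, fun u hu => ?_⟩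
  · obtain ⟨x, hlx, hxD⟩ := EReal.lt_iff_exists_real_btwn.1 hl
    have hxD := EReal.coe_lt_coe_iff.1 hxD
    filter_upwards [hM.eventually_lt_mleRightDeriv h hX hb (ht 0).1 (ht 0).2 hDle
      (sub_pos.2 hxD) (fun n => (ht n).2) htlim hlim'] with p hp
    rw [sub_sub_cancel] at hp
    exact hlx.trans hp
  · obtain ⟨x, hDx, hxu⟩ := EReal.lt_iff_exists_real_btwn.1 hu
    filter_upwards [hM.eventually_mleRightDeriv_lt h hb (ht 0).1 (ht 0).2 hDlim
      (EReal.coe_lt_coe_iff.1 hDx) htlim] with p hp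
    exact hp.trans hxu

end IsLogConcaveModel
end

theorem theorem2
    -- the true log-density `φ`, concave and upper semicontinuous, and `F`, `(aₒ, bₒ)`, `bₒ < ∞`
    (φ : ℝ → EReal) (hφ : IsLogDensity φ) (hφ_usc : UpperSemicontinuous φ)
    (F : ℝ → ℝ) (hF : ∀ x, F x = cdf (distOf φ) x)
    (aₒ : EReal) (bₒ : ℝ)
    (hab : {x : ℝ | 0 < F x ∧ F x < 1} = {x : ℝ | aₒ < (x : EReal) ∧ x < bₒ})
    -- independent observations `X 0, X 1, …` with density `exp ∘ φ`
    {Ω : Type*} [MeasurableSpace Ω] (μ : Measure Ω) [IsProbabilityMeasure μ]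
    (X : ℕ → Ω → ℝ) (hX_indep : iIndepFun X μ) (hX_law : ∀ i, HasLaw (X i) (distOf φ) μ)
    -- the estimator `φhat n` based on the first `n` observations, and its right derivative
    (φhat φhat' : ℕ → Ω → ℝ → EReal)
    (hφhat : ∀ n ω, φhat n ω = logConcaveMLE (fun i : Fin n => X i ω))
    (hφhat' : ∀ n ω, φhat' n ω = mleRightDeriv (fun i : Fin n => X i ω)) :
    -- (a)
    (expFn φ bₒ = 0 →
      (∀ a : ℝ, aₒ < (a : EReal) → a < bₒ →
        TendstoInProb μ
          (fun n ω => supDist (Set.Ici a) (fun x => (expFn (φhat n ω) x : EReal))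
            (fun x => (expFn φ x : EReal))) 0) ∧
      leftDeriv φ bₒ = ⊥ ∧
      (∀ b : ℕ → ℝ, (∀ n, aₒ < (b n : EReal) ∧ b n < bₒ) → Tendsto b atTop (𝓝 bₒ) →
        TendstoInProb μ (fun n ω => φhat' n ω (b n)) (leftDeriv φ bₒ))) ∧
    -- (b)
    (0 < expFn φ bₒ →
      ∀ (a : ℝ) (b : ℕ → ℝ), aₒ < (a : EReal) → a < bₒ →
        (∀ n, aₒ < (b n : EReal) ∧ b n < bₒ) → Tendsto b atTop (𝓝 bₒ) →
        Tendsto (fun n : ℕ => (n : ℝ) * (1 - F (b n))) atTop atTop →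
        TendstoInProb μ (fun n ω => supDist (Set.Icc a (b n)) (φhat n ω) φ) 0) ∧
    -- (c)
    (0 < expFn φ bₒ → ⊥ < leftDeriv φ bₒ →
      ∀ b : ℕ → ℝ, (∀ n, aₒ < (b n : EReal) ∧ b n < bₒ) → Tendsto b atTop (𝓝 bₒ) →
        Tendsto (fun n : ℕ => (Real.log n / n) ^ (-(1 / 3) : ℝ) * (1 - F (b n))) atTop atTop →
        TendstoInProb μ (fun n ω => φhat' n ω (b n)) (leftDeriv φ bₒ)) := by
  have h : IsLogConcaveModel φ aₒ bₒ := ⟨hφ, hφ_usc, fun x => by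
    rw [← hF]; exact Set.ext_iff.1 hab x⟩
  have hX : IsIIDSample μ X (distOf φ) := ⟨hX_indep, hX_law⟩
  obtain rfl : φhat = fun n ω => logConcaveMLE (obs X (n, ω)) := funext₂ hφhat
  obtain rfl : φhat' = fun n ω => mleRightDeriv (obs X (n, ω)) := funext₂ hφhat'
  obtain rfl : F = fun x => cdf (distOf φ) x := funext hF
  have hpos : 0 < expFn φ bₒ → φ bₒ ≠ ⊥ := fun h0 hb => by simp [expFn, hb] at h0
  refine ⟨fun h0 => ?_, fun h0 a b ha hab' hb hlim hlim' => ?_, fun h0 hD b hb hlim hlim' => ?_⟩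
  · have hb : φ bₒ = ⊥ := EReal.exp_eq_zero_iff.1 h0
    refine ⟨fun a ha hab' => ?_, IsLogConcaveModel.leftDeriv_eq_bot hb, fun b _ hlim => ?_⟩
    · exact h.tendsto_supDist_expFn hX hb ha hab'
    · rw [IsLogConcaveModel.leftDeriv_eq_bot hb]
      exact h.tendsto_mleRightDeriv_bot hX hb hlim
  · exact h.tendsto_supDist hX (hpos h0) ha hab' hb hlim hlim'
  · exact h.tendsto_mleRightDeriv hX (hpos h0) hD hb hlim hlim'
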